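/- **Setting.** Let $n\in\mathbb N$, $0<H<1$. For $D>0$ and $\mathbf k\in\mathbb Z^n$ put $a_{\mathbf k}=(\pi D(1-H^2))^{-n/2}e^{-H^2|\mathbf k|^2/((1-H^2)D)}$, and let $S\subset\mathbb Z^n$ be a minimal (with respect to inclusion) finite index set with $\sum_{\mathbf k\in\mathbb Z^n\setminus S}a_{\mathbf k}<e^{-\pi^2D(1-H^2)}$. Let $h_1>0$, $h_2=Hh_1$, let $\Omega\subset\mathbb R^n$ be bounded, and put $Z_2=\{\mathbf m\in\mathbb Z^n: h_1\mathbf m+h_2\mathbf k\in\Omega\ \forall \mathbf k\in S\}$, $Z_1=\mathbb Z^n\setminus Z_2$. The associated piecewise uniform grid consists of $G_1=\{h_1\mathbf m\}_{\mathbf m\in Z_1}$ and of the family $G_2=\{h_1\mathbf m+h_2\mathbf k\}_{(\mathbf m,\mathbf k)\in Z_2\times S}$ (indexed by pairs, i.e. counted with multiplicity); put $\tilde a_g=a_{\mathbf k}$ for $g=h_1\mathbf m+h_2\mathbf k\in G_2$ and $\tilde a_g=1$ for $g\in G_1$. **Nodes.** Let $\mathbf X\subset\mathbb R^n$ be a set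 of nodes and $\kappa_1>0$ such that (Condition 1, piecewise) there is $J_0\subset \mathbf X$ such that each ball $B(h_1\mathbf j,\kappa_1h_1)$, $\mathbf j\in\mathbb Z^n$, contains a point of $J_0$, $\mathbf X\setminus J_0\subset\Omega$, and for each $\mathbf j\in\mathbb Z^n$ with $h_2\mathbf j\in\Omega$ the ball $B(h_2\mathbf j,\kappa_1h_2)$ contains a point of $\mathbf X\cap\Omega$; (Condition 4) for each $\mathbf x\in\mathbf X\cap\Omega$ there are $\mathbf m\in Z_2$, $\mathbf k\in S$ with $|\mathbf x-h_1\mathbf m-h_2\mathbf k|<\kappa_1h_2$. Put $J_1=\mathbf X\setminus\Omega$, $J_2=\mathbf X\cap\Omega$. To each $g\in G_\ell$ ($\ell=1,2$) assign a finite set $\Sigma(g)\subset J_\ell$ such that, for some $\kappa>0$ independent of $g$, some node of $\Sigma(g)$ lies in $B(g,\kappa h_\ell)$, and such that for every $\mathbf x_{\mathbf j}\in J_\ell$ the set $G(\mathbf x_{\mathbf j})=\{g\in G_\ell:\mathbf x_{\mathbf j}\in\Sigma(g)\}$ is finite. **Polynomials.** For $0<D_0<D$ let $$\mathcal C_{\beta,\gamma}(\mathbf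 x,\mathbf y)=\mathcal S_\beta(-\sqrt D\,\partial_{\mathbf x})\,\mathcal S_\gamma(-\sqrt D\,\partial_{\mathbf y})\,e^{(D-D_0)(|\mathbf x|^2+|\mathbf y|^2)/D_0^2}\,e^{-D|\mathbf x-\mathbf y|^2/2D_0^2},$$ where $\mathcal S_\beta(\mathbf t)=(1/2i)^{|\beta|}H_\beta(\mathbf t/2i)$ and $H_\beta(\mathbf t)=e^{|\mathbf t|^2}(-\partial_{\mathbf t})^\beta e^{-|\mathbf t|^2}$. For a degree $L$ and each $g\in G_\ell$ consider the linear system for $\{c_{\mathbf j,\beta}(g)\}_{\mathbf x_{\mathbf j}\in\Sigma(g),\,|\beta|\le L}$ $$(\mathrm{sys2})\qquad\sum_{\mathbf x_{\mathbf j}\in\Sigma(g)}\sum_{|\beta|=0}^L\mathcal C_{\beta,\gamma}\Big(\frac{\mathbf x_{\mathbf j}-g}{h_\ell},\frac{\mathbf x_{\mathbf k}-g}{h_\ell}\Big)c_{\mathbf j,\beta}(g)=\mathcal C_{0,\gamma}\Big(0,\frac{\mathbf x_{\mathbf k}-g}{h_\ell}\Big),\qquad \mathbf x_{\mathbf k}\in\Sigma(g),\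 0\le|\gamma|\le L ,$$ and, for $\mathbf x_{\mathbf j}\in J_\ell$, $\mathcal P_{\mathbf j}(\mathbf z)=\sum_{g\in G(\mathbf x_{\mathbf j})}\tilde a_g\sum_{|\beta|\le L}c_{\mathbf j,\beta}(g)\,\mathbf z^\beta$. Let $$\Theta(\mathbf x)=(\pi D)^{-n/2}\sum_{\ell=1,2}\ \sum_{\mathbf x_{\mathbf j}\in J_\ell}\mathcal P_{\mathbf j}\Big(\frac{\mathbf x-\mathbf x_{\mathbf j}}{h_\ell\sqrt D}\Big)e^{-|\mathbf x-\mathbf x_{\mathbf j}|^2/h_\ell^2D}.$$ **Theorem.** For every $\varepsilon>0$ (and given $n,H$) there is $D_{\min}>0$ such that for every $D\ge D_{\min}$, every $D_0\in(0,D)$ and every $\kappa>0$ there is $L_{\min}$ such that for every $L\ge L_{\min}$ and all $h_1,S,\Omega,\mathbf X,\kappa_1,\Sigma$ as above (with these $D$, $\kappa$): 1. all the systems (sys2) are uniquely solvable; 2. with their solutions, for every $\mathbf x\in\mathbb R^n$, the series of $\Theta$ grouped by grid points, $$(\pi D)^{-n/2}\sum_{\ell=1,2}\ \sum_{g\in G_\ell}\tilde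 a_g\Big(\sum_{\mathbf x_{\mathbf j}\in\Sigma(g)}\sum_{|\beta|\le L}c_{\mathbf j,\beta}(g)\Big(\frac{\mathbf x-\mathbf x_{\mathbf j}}{h_\ell\sqrt D}\Big)^\beta e^{-|\mathbf x-\mathbf x_{\mathbf j}|^2/h_\ell^2D}\Big),$$ converges absolutely as a series over $g$, and its sum differs from $1$ by less than $\varepsilon$; 3. at every $\mathbf x$ at which, for $\ell=1$, the double series over pairs $(g,\mathbf x_{\mathbf j})$, $\mathbf x_{\mathbf j}\in\Sigma(g)$, of the terms $\sum_{|\beta|\le L}c_{\mathbf j,\beta}(g)\big(\frac{\mathbf x-\mathbf x_{\mathbf j}}{h_1\sqrt D}\big)^\beta e^{-|\mathbf x-\mathbf x_{\mathbf j}|^2/h_1^2D}$ converges absolutely, the series over the nodes defining $\Theta(\mathbf x)$ converge absolutely and $|\Theta(\mathbf x)-1|<\varepsilon$; 4. if there are $R,\delta>0$ such that for all $g\in G_1$ one has $|\mathbf x_{\mathbf j}-g|\le R$ for all $\mathbf x_{\mathbf j}\in\Sigma(g)$ and any two distinct points of $\Sigma(g)$ are at distance at least $\delta$, then the double series in 3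 converges absolutely at every $\mathbf x$, hence $|\Theta(\mathbf x)-1|<\varepsilon$ for all $\mathbf x\in\mathbb R^n$. -/

import Mathlib

noncomputable section

namespace GaussPU

/-- Points of `ℝⁿ` with the Euclidean norm. -/
abbrev Pt (n : ℕ) : Type := EuclideanSpace ℝ (Fin n)

/-- The grid point `h m`, for `m ∈ ℤⁿ`. -/
def gridPt {n : ℕ} (h : ℝ) (m : Fin n → ℤ) : Pt n :=
  WithLp.toLp 2 (fun i => h * (m i : ℝ))

/-! ### Hermite polynomials and the polynomials `𝒮_β` -/

/-- The one-dimensional (physicists') Hermite polynomials. -/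
def physHermite : ℕ → Polynomial ℝ
  | 0 => 1
  | k + 1 => 2 * Polynomial.X * physHermite k - Polynomial.derivative (physHermite k)

/-- `H_k(t) e^{-t²} = (-d/dt)^k e^{-t²}`. -/
theorem physHermite_rodrigues (k : ℕ) :
    (fun t : ℝ => (physHermite k).eval t * Real.exp (-t ^ 2)) =
      fun t : ℝ => (-1) ^ k * iteratedDeriv k (fun s : ℝ => Real.exp (-s ^ 2)) t := by
  induction k with
  | zero => funext t; simp [physHermite]
  | succ k ih =>
    have key : iteratedDeriv k (fun s : ℝ => Real.exp (-s ^ 2)) =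
        fun t : ℝ => (-1) ^ k * ((physHermite k).eval t * Real.exp (-t ^ 2)) := by
      funext t
      have := congrFun ih t
      beta_reduce at this
      rw [this, ← mul_assoc, ← mul_pow]
      simp
    funext t
    rw [iteratedDeriv_succ, key]
    have h1 : HasDerivAt (fun s : ℝ => Real.exp (-s ^ 2))
        (Real.exp (-t ^ 2) * (-(2 * t))) t := by
      have : HasDerivAt (fun s : ℝ => -s ^ 2) (-(2 * t)) t := by
        simpa using (hasDerivAt_pow 2 t).fun_neg
      exact this.exp
    have h2 := (((physHermite k).hasDerivAt t).mul h1).const_mul ((-1 : ℝ) ^ k)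
    have h3 : deriv (fun t : ℝ => (-1 : ℝ) ^ k * ((physHermite k).eval t * Real.exp (-t ^ 2))) t
        = _ := h2.deriv
    rw [h3, pow_succ (-1 : ℝ) k]
    have h4 : ((-1 : ℝ) ^ k) * (-1) ^ k = 1 := by rw [← mul_pow]; simp
    simp only [physHermite, Polynomial.eval_sub, Polynomial.eval_mul, Polynomial.eval_X,
      Polynomial.eval_ofNat]
    generalize Real.exp (-t ^ 2) = E
    generalize (-1 : ℝ) ^ k = w at *
    linear_combination (2 * t * (physHermite k).eval t * E
      - (Polynomial.derivative (physHermite k)).eval t * E) * (-h4)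

/-- The one-dimensional polynomials `𝒮_k(t) = (1/(2i))^k H_k(t/(2i))`; they have real coefficients
(`sPoly_eq` below). -/
def sPoly : ℕ → Polynomial ℝ
  | 0 => 1
  | k + 1 => Polynomial.C (-(1 / 2)) * Polynomial.X * sPoly k - Polynomial.derivative (sPoly k)

/-- `𝒮_k(t) = (1/(2i))^k H_k(t/(2i))`. -/
theorem sPoly_eq (k : ℕ) :
    (sPoly k).map Complex.ofRealHom =
      Polynomial.C ((1 / (2 * Complex.I)) ^ k) *
        ((physHermite k).map Complex.ofRealHom).comp
          (Polynomial.C (1 / (2 * Complex.I)) * Polynomial.X) := by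
  induction k with
  | zero => simp [sPoly, physHermite]
  | succ k ih =>
    have hI : (1 / (2 * Complex.I)) ^ 2 = -(1 / 4 : ℂ) := by
      rw [div_pow, mul_pow, Complex.I_sq]; norm_num
    have h1 : (sPoly (k + 1)).map Complex.ofRealHom =
        Polynomial.C (-(1 / 2 : ℂ)) * Polynomial.X * (sPoly k).map Complex.ofRealHom
          - Polynomial.derivative ((sPoly k).map Complex.ofRealHom) := by
      simp [sPoly, Polynomial.derivative_map]
    have h2 : (physHermite (k + 1)).map Complex.ofRealHom =
        2 * Polynomial.X * (physHermite k).map Complex.ofRealHom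
          - Polynomial.derivative ((physHermite k).map Complex.ofRealHom) := by
      simp [physHermite, Polynomial.derivative_map]
    rw [h1, h2, ih]
    generalize (physHermite k).map Complex.ofRealHom = q
    generalize hw : (1 / (2 * Complex.I)) = w at *
    have hC : (Polynomial.C (-(1 / 2 : ℂ))) = 2 * Polynomial.C w * Polynomial.C w := by
      have : (-(1 / 2 : ℂ)) = 2 * w * w := by linear_combination (-2) * hI
      have h2 : (Polynomial.C (2 : ℂ)) = 2 := rfl
      rw [this, Polynomial.C_mul, Polynomial.C_mul, h2]
    rw [hC]
    simp only [Polynomial.derivative_mul, Polynomial.derivative_C, Polynomial.derivative_comp,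
      Polynomial.derivative_X, Polynomial.sub_comp, Polynomial.mul_comp, Polynomial.X_comp,
      Polynomial.ofNat_comp, pow_succ, Polynomial.C_mul]
    ring

/-- The polynomial `𝒮_β(t) = (1/(2i))^{|β|} H_β(t/(2i))` of `n` variables, where
`H_β(t) = ∏ᵢ H_{βᵢ}(tᵢ) = e^{|t|²} (-∂_t)^β e^{-|t|²}`. -/
def sMv {n : ℕ} (β : Fin n →₀ ℕ) : MvPolynomial (Fin n) ℝ :=
  ∏ i, Polynomial.aeval (MvPolynomial.X i) (sPoly (β i))

/-! ### Differential operators -/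

/-- The partial derivative `∂f/∂xᵢ`. -/
def partialDeriv {n : ℕ} (i : Fin n) (f : Pt n → ℝ) : Pt n → ℝ :=
  fun x => lineDeriv ℝ f x (EuclideanSpace.single i 1)

/-- `∂^α f`. -/
def multiDeriv {n : ℕ} (α : Fin n →₀ ℕ) (f : Pt n → ℝ) : Pt n → ℝ :=
  (List.finRange n).foldr (fun i g => (partialDeriv i)^[α i] g) f

/-- `P(s ∂) f`, for a polynomial `P` and a real number `s`. -/
def diffOp {n : ℕ} (P : MvPolynomial (Fin n) ℝ) (s : ℝ) (f : Pt n → ℝ) : Pt n → ℝ :=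
  fun x => ∑ α ∈ P.support, P.coeff α * s ^ α.degree * multiDeriv α f x

/-! ### The local linear systems -/

/-- `e^{(D-D₀)(|x|²+|y|²)/D₀²} e^{-D|x-y|²/(2D₀²)}`. -/
def kern {n : ℕ} (D D₀ : ℝ) (x y : Pt n) : ℝ :=
  Real.exp ((D - D₀) * (‖x‖ ^ 2 + ‖y‖ ^ 2) / D₀ ^ 2) *
    Real.exp (-(D * ‖x - y‖ ^ 2) / (2 * D₀ ^ 2))

/-- `𝒞_{β,γ}(x,y) = 𝒮_β(-√D ∂_x) 𝒮_γ(-√D ∂_y) kern(x,y)`. -/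
def calC {n : ℕ} (D D₀ : ℝ) (β γ : Fin n →₀ ℕ) (x y : Pt n) : ℝ :=
  diffOp (sMv β) (-Real.sqrt D)
    (fun x' => diffOp (sMv γ) (-Real.sqrt D) (fun y' => kern D D₀ x' y') y) x

/-- The multi-indices `β` with `0 ≤ |β| ≤ L`. -/
def multiIdx (n L : ℕ) : Finset (Fin n →₀ ℕ) :=
  (Finset.range (L + 1)).biUnion (fun k => Finset.univ.finsuppAntidiag k)

/-- `c = {c_{j,β}}` (`x_j ∈ Sig`, `|β| ≤ L`; extended by zero to all other pairs) solves the linear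
system attached to the grid point `g` and to the finite node set `Sig`, with scaling `h`. -/
def SolvesLocal {n : ℕ} (D D₀ : ℝ) (L : ℕ) (h : ℝ) (g : Pt n) (Sig : Finset (Pt n))
    (c : Pt n → (Fin n →₀ ℕ) → ℝ) : Prop :=
  (∀ a β, ¬ (a ∈ Sig ∧ β ∈ multiIdx n L) → c a β = 0) ∧
    ∀ b ∈ Sig, ∀ γ ∈ multiIdx n L,
      ∑ a ∈ Sig, ∑ β ∈ multiIdx n L, calC D D₀ β γ (h⁻¹ • (a - g)) (h⁻¹ • (b - g)) * c a β =
        calC D D₀ 0 γ 0 (h⁻¹ • (b - g))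

/-! ### The piecewise uniform grid -/

/-- The coefficients
`a_k = (π D (1-H²))^{-n/2} e^{-H²|k|²/((1-H²) D)}` of the approximate refinement relation. -/
def refCoeff {n : ℕ} (H D : ℝ) (k : Fin n → ℤ) : ℝ :=
  (Real.pi * D * (1 - H ^ 2)) ^ (-(n : ℝ) / 2) *
    Real.exp (-(H ^ 2 * ‖gridPt 1 k‖ ^ 2) / ((1 - H ^ 2) * D))

/-- `S` is a minimal (with respect to inclusion) index set with
`∑_{k ∈ ℤⁿ \ S} a_k < e^{-π² D (1-H²)}`. -/
def IsMinimalIndexSet {n : ℕ} (H D : ℝ) (S : Finset (Fin n → ℤ)) : Prop :=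
  Minimal (fun T : Finset (Fin n → ℤ) =>
    ∑' k : {k : Fin n → ℤ // k ∉ T}, refCoeff H D k.1 <
      Real.exp (-(Real.pi ^ 2 * D * (1 - H ^ 2)))) S

/-- `Z₂ = {m ∈ ℤⁿ : h₁ m + h₂ k ∈ Ω for all k ∈ S}`. -/
def Z₂ {n : ℕ} (h₁ h₂ : ℝ) (Ω : Set (Pt n)) (S : Finset (Fin n → ℤ)) : Set (Fin n → ℤ) :=
  {m | ∀ k ∈ S, gridPt h₁ m + gridPt h₂ k ∈ Ω}

/-- `Z₁ = ℤⁿ \ Z₂`; it indexes the coarse grid points `h₁ m` of `G₁`. -/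
def Z₁ {n : ℕ} (h₁ h₂ : ℝ) (Ω : Set (Pt n)) (S : Finset (Fin n → ℤ)) : Set (Fin n → ℤ) :=
  (Z₂ h₁ h₂ Ω S)ᶜ

/-- The index set `Z₂ × S` of the fine grid points `h₁ m + h₂ k` of `G₂`. -/
def I₂ {n : ℕ} (h₁ h₂ : ℝ) (Ω : Set (Pt n)) (S : Finset (Fin n → ℤ)) :
    Set ((Fin n → ℤ) × (Fin n → ℤ)) :=
  {p | p.1 ∈ Z₂ h₁ h₂ Ω S ∧ p.2 ∈ S}

/-- The fine grid point `h₁ m + h₂ k`. -/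
def finePt {n : ℕ} (h₁ h₂ : ℝ) (p : (Fin n → ℤ) × (Fin n → ℤ)) : Pt n :=
  gridPt h₁ p.1 + gridPt h₂ p.2

/-! ### The assumptions on the nodes -/

/-- The nodes are close to the uniform grid of size `h`: every ball `B(h j, κ h)` contains nodes. -/
def Condition1 {n : ℕ} (X : Set (Pt n)) (h κ : ℝ) : Prop :=
  ∀ j : Fin n → ℤ, (X ∩ Metric.ball (gridPt h j) (κ * h)).Nonempty

/-- Piecewise version: a subset `J₀` of the nodes satisfies `Condition1` with grid size `h₁`, the
remaining nodes lie in `Ω`, and inside `Ω` the nodes satisfy the condition with grid size `h₂`. -/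
def PiecewiseCondition1 {n : ℕ} (X Ω : Set (Pt n)) (h₁ h₂ κ₁ : ℝ) : Prop :=
  ∃ J₀ ⊆ X, Condition1 J₀ h₁ κ₁ ∧ X \ J₀ ⊆ Ω ∧
    ∀ j : Fin n → ℤ, gridPt h₂ j ∈ Ω →
      ((X ∩ Ω) ∩ Metric.ball (gridPt h₂ j) (κ₁ * h₂)).Nonempty

/-- Every node in `Ω` is at distance less than `κ₁ h₂` from some point of the fine grid `G₂`. -/
def Condition4 {n : ℕ} (X Ω : Set (Pt n)) (h₁ h₂ κ₁ : ℝ) (S : Finset (Fin n → ℤ)) : Prop :=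
  ∀ x ∈ X ∩ Ω, ∃ p ∈ I₂ h₁ h₂ Ω S, dist x (finePt h₁ h₂ p) < κ₁ * h₂

/-- The requirements on the choice of finite node sets `Σ(g)` for the grid points `g`, in the
family of grid points `(g i)`, `i ∈ I`, with grid size `h` and nodes from `J`: `Σ(g) ⊆ J`, the ball
`B(g, κ h)` contains a node of `Σ(g)`, and each node belongs to finitely many of the `Σ(g)`. -/
def AdmissibleChoice {n : ℕ} {ι : Type} (I : Set ι) (g : ι → Pt n) (h κ : ℝ) (J : Set (Pt n))
    (Sig : ι → Finset (Pt n)) : Prop :=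
  (∀ i ∈ I, (↑(Sig i) : Set (Pt n)) ⊆ J ∧ ∃ a ∈ Sig i, dist a (g i) < κ * h) ∧
    ∀ a ∈ J, {i ∈ I | a ∈ Sig i}.Finite

/-- The sets `Σ(g)` are uniformly local and uniformly separated. -/
def UniformChoice {n : ℕ} {ι : Type} (I : Set ι) (g : ι → Pt n) (Sig : ι → Finset (Pt n)) : Prop :=
  ∃ R > (0 : ℝ), ∃ δ > (0 : ℝ), ∀ i ∈ I,
    (∀ a ∈ Sig i, dist a (g i) ≤ R) ∧ ∀ a ∈ Sig i, ∀ b ∈ Sig i, a ≠ b → δ ≤ dist a b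

/-! ### The function `Θ` -/

/-- The polynomial `∑_{|β| ≤ L} c_β x^β`. -/
def polyOf {n : ℕ} (L : ℕ) (c : (Fin n →₀ ℕ) → ℝ) : MvPolynomial (Fin n) ℝ :=
  ∑ β ∈ multiIdx n L, MvPolynomial.monomial β (c β)

/-- `P((x - a)/(h √D)) e^{-|x-a|²/(h² D)}`. -/
def gaussTerm {n : ℕ} (D h : ℝ) (P : MvPolynomial (Fin n) ℝ) (a x : Pt n) : ℝ :=
  MvPolynomial.eval (fun i => (x i - a i) / (h * Real.sqrt D)) P *
    Real.exp (-‖x - a‖ ^ 2 / (h ^ 2 * D))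

/-- The polynomial of the node `a`: the sum, over the finitely many grid points `g` with
`a ∈ Σ(g)`, of the polynomials with coefficients `c_{a,β}(g)`, weighted by `w`. -/
def nodePoly {n : ℕ} {ι : Type} (L : ℕ) (I : Set ι) (w : ι → ℝ) (Sig : ι → Finset (Pt n))
    (c : ι → Pt n → (Fin n →₀ ℕ) → ℝ) (a : Pt n) : MvPolynomial (Fin n) ℝ :=
  ∑ᶠ i ∈ {i ∈ I | a ∈ Sig i}, w i • polyOf L (c i a)

/-- `Θ(x) = (π D)^{-n/2} (∑_{a ∈ J₁} P_a((x-a)/(h₁√D)) e^{-|x-a|²/(h₁²D)}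
  + ∑_{a ∈ J₂} P'_a((x-a)/(h₂√D)) e^{-|x-a|²/(h₂²D)})`. -/
def Theta {n : ℕ} (D h₁ h₂ : ℝ) (J₁ J₂ : Set (Pt n)) (P P' : Pt n → MvPolynomial (Fin n) ℝ)
    (x : Pt n) : ℝ :=
  (Real.pi * D) ^ (-(n : ℝ) / 2) *
    (∑' a : J₁, gaussTerm D h₁ (P a) a x + ∑' a : J₂, gaussTerm D h₂ (P' a) a x)

/-- The contribution of one grid point `g` to `Θ`:
`∑_{a ∈ Σ(g)} ∑_{|β| ≤ L} c_{a,β}(g) ((x-a)/(h√D))^β e^{-|x-a|²/(h²D)}`. -/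
def gridTerm {n : ℕ} (D h : ℝ) (L : ℕ) (Sig : Finset (Pt n)) (c : Pt n → (Fin n →₀ ℕ) → ℝ)
    (x : Pt n) : ℝ :=
  ∑ a ∈ Sig, gaussTerm D h (polyOf L (c a)) a x

end GaussPU

end

/-!
The proof compares the contribution `gridTerm` of each grid point `g` with the Gaussian
`e^{-|x-g|²/(h²D)}`, and sums these Gaussians by Poisson summation.

*The local systems.* In one variable put `φ_s(z) = e^{-s²/D₀ + √D s z/D₀}`, as an element of `L²`
of the standard normal distribution; in `ℝⁿ` take products. The kernel of the local systems is the
Gram kernel of these features, so `calC D D₀ β γ x y` is the inner product of `𝒮_β(-√D ∂) φ_x` and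
`𝒮_γ(-√D ∂) φ_y` (`inner_featureLp`), and a local system consists of the normal equations for the
best approximation in `L²` of `φ_0 = 1` by the functions `𝒮_β(-√D ∂) φ_y`, `|β| ≤ L`, where `y`
runs through the scaled nodes `(x_j - g)/h` (`solvesLocal_iff`). These functions are polynomials
times distinct exponentials, hence linearly independent (`eq_zero_of_sum_featureLp_eq_zero`), and
the system is uniquely solvable (`existsUnique_solvesLocal`).

*The local error.* Since `D₀ < D`, there are functions `ψ_x` in `L²`, of norm at most
`C e^{-q|x|²}`, with `⟨𝒮_β(-√D ∂) φ_a, ψ_x⟩ = ((x-a)/√D)^β e^{-|x-a|²/D}`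
(`exists_evaluation_vector`). The difference between the Gaussian at `g` and `gridTerm` is
therefore the inner product of the residual of the least squares problem with `ψ_y`, where
`y = (x-g)/h`. The residual is not larger than the one obtained from the single node close to
`g`, and the latter is small for large `L`, uniformly in the position of the node, by the Taylor
expansion of the exponential function (`exists_norm_featureLp_sub_le`). This gives an error
`η e^{-q|x-g|²/h²}` with arbitrarily small `η` (`exists_abs_gridTerm_sub_le`).

*The sum over the grid.* By Poisson summation, `∑_m e^{-|x-m|²/D}` is `(πD)^{n/2}` up to a
relative error that tends to zero as `D → ∞` (`hasSum_gaussian_lattice`). Completing squares, the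
same formula shows that a Gaussian of the coarse grid is, up to a small relative error, the
combination of fine Gaussians with the coefficients `a_k` (`hasSum_refinement`). The truncation to
`k ∈ S` costs about `∑_{k ∉ S} a_k`, which is small by the choice of `S`. So the Gaussians of
the piecewise uniform grid add up to nearly `1` (`abs_piecewise_gaussian_sub_one_le`), and adding
the local errors proves the assertion for the series grouped by grid points
(`exists_abs_grid_series_sub_one_lt`).

*Grouping by nodes.* Where the double series over grid points and nodes converges absolutely, it
may be summed in either order (`summable_and_tsum_nodePoly`); for the fine grid it is a finite
sum. If the node sets are uniformly local and separated, then they have boundedly many elements,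
and a compactness argument makes the linear independence of the features quantitative, so that the
solutions of the local systems are bounded (`exists_abs_coeff_le`) and the terms of the double
series are dominated by a Gaussian of the distance to the grid point
(`summable_of_uniformChoice`).
-/

noncomputable section

namespace GaussPU

/-! ### Differential operators on products of functions of one variable -/

/-- The function `x ↦ ∏ᵢ fᵢ(xᵢ)` on `ℝⁿ`. -/
def prodFn {n : ℕ} (f : Fin n → ℝ → ℝ) : Pt n → ℝ := fun x => ∏ i, f i (x i)

/-- `P(s d/dt) f`, for a polynomial `P` of one variable and a real number `s`. -/
def diffOp₁ (P : Polynomial ℝ) (s : ℝ) (f : ℝ → ℝ) : ℝ → ℝ :=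
  fun t => P.sum fun k c => c * s ^ k * deriv^[k] f t

theorem partialDeriv_prodFn {n : ℕ} (i : Fin n) (f : Fin n → ℝ → ℝ) :
    partialDeriv i (prodFn f) = prodFn (Function.update f i (deriv (f i))) := by
  funext x
  have h1 : ∀ t : ℝ, prodFn f (x + t • EuclideanSpace.single i 1) =
      (∏ j ∈ Finset.univ.erase i, f j (x j)) * f i (t + x i) := by
    intro t
    rw [prodFn, ← Finset.mul_prod_erase _ _ (Finset.mem_univ i), mul_comm]
    congr 1
    · refine Finset.prod_congr rfl fun j hj => ?_
      simp [Finset.ne_of_mem_erase hj]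
    · simp [add_comm]
  have h2 : prodFn (Function.update f i (deriv (f i))) x =
      (∏ j ∈ Finset.univ.erase i, f j (x j)) * deriv (f i) (x i) := by
    rw [prodFn, ← Finset.mul_prod_erase _ _ (Finset.mem_univ i), mul_comm]
    congr 1
    · refine Finset.prod_congr rfl fun j hj => ?_
      simp [Finset.ne_of_mem_erase hj]
    · simp
  rw [h2, partialDeriv, lineDeriv]
  simp_rw [h1]
  rw [deriv_const_mul_field, deriv_comp_add_const]
  simp

theorem partialDeriv_iterate_prodFn {n : ℕ} (i : Fin n) (k : ℕ) (f : Fin n → ℝ → ℝ) :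
    (partialDeriv i)^[k] (prodFn f) = prodFn (Function.update f i (deriv^[k] (f i))) := by
  induction k with
  | zero => simp
  | succ k ih =>
    rw [Function.iterate_succ_apply', ih, partialDeriv_prodFn]
    simp [Function.iterate_succ_apply']

theorem multiDeriv_prodFn {n : ℕ} (α : Fin n →₀ ℕ) (f : Fin n → ℝ → ℝ) :
    multiDeriv α (prodFn f) = prodFn fun i => deriv^[α i] (f i) := by
  have key : ∀ l : List (Fin n), l.Nodup →
      l.foldr (fun i g => (partialDeriv i)^[α i] g) (prodFn f) =
        prodFn fun i => if i ∈ l then deriv^[α i] (f i) else f i := by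
    intro l
    induction l with
    | nil => simp
    | cons a l ih =>
      intro hl
      rw [List.nodup_cons] at hl
      rw [List.foldr_cons, ih hl.2, partialDeriv_iterate_prodFn]
      congr 1
      funext i
      by_cases h : i = a
      · subst h; simp [hl.1]
      · simp [h]
  rw [multiDeriv, key _ (List.nodup_finRange n)]
  simp

theorem prod_aeval_X_eq_sum {n : ℕ} (p : Fin n → Polynomial ℝ) :
    ∏ i, Polynomial.aeval (MvPolynomial.X i : MvPolynomial (Fin n) ℝ) (p i) =
      ∑ e ∈ Fintype.piFinset fun i => (p i).support,
        MvPolynomial.monomial (Finsupp.equivFunOnFinite.symm e) (∏ i, (p i).coeff (e i)) := by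
  have hp : ∀ i, Polynomial.aeval (MvPolynomial.X i : MvPolynomial (Fin n) ℝ) (p i) =
      ∑ k ∈ (p i).support, MvPolynomial.C ((p i).coeff k) * MvPolynomial.X i ^ k := by
    intro i
    rw [Polynomial.aeval_eq_sum_range,
      ← Finset.sum_subset Polynomial.supp_subset_range_natDegree_succ]
    · exact Finset.sum_congr rfl fun k _ => by rw [MvPolynomial.smul_eq_C_mul]
    · intro k _ hk
      rw [Polynomial.notMem_support_iff.1 hk, zero_smul]
  simp_rw [hp]
  rw [Finset.prod_univ_sum]
  refine Finset.sum_congr rfl fun e _ => ?_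
  rw [Finset.prod_mul_distrib, ← map_prod, MvPolynomial.monomial_eq]
  congr 1
  rw [Finsupp.prod_fintype _ _ (by simp)]
  simp

/-- A constant coefficient differential operator whose symbol is a product of polynomials of one
variable acts on products of functions of one variable factor by factor. -/
theorem diffOp_prodFn {n : ℕ} (p : Fin n → Polynomial ℝ) (s : ℝ) (f : Fin n → ℝ → ℝ) (x : Pt n) :
    diffOp (∏ i, Polynomial.aeval (MvPolynomial.X i) (p i)) s (prodFn f) x =
      ∏ i, diffOp₁ (p i) s (f i) (x i) := by
  -- the left hand side is linear in the symbol and multiplicative on monomials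
  let w : (Fin n →₀ ℕ) → ℝ := fun α => s ^ α.degree * ∏ i, deriv^[α i] (f i) (x i)
  let ev : MvPolynomial (Fin n) ℝ →ₗ[ℝ] ℝ := (MvPolynomial.basisMonomials (Fin n) ℝ).constr ℝ w
  have hmon : ∀ α c, ev (MvPolynomial.monomial α c) = c * w α := by
    intro α c
    have h : MvPolynomial.monomial α c = c • MvPolynomial.basisMonomials (Fin n) ℝ α := by
      simp [MvPolynomial.coe_basisMonomials, MvPolynomial.smul_monomial]
    rw [h, map_smul, Module.Basis.constr_basis, smul_eq_mul]
  have hev : ∀ P, diffOp P s (prodFn f) x = ev P := by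
    intro P
    conv_rhs => rw [← MvPolynomial.support_sum_monomial_coeff P, map_sum]
    refine Finset.sum_congr rfl fun α _ => ?_
    rw [hmon, multiDeriv_prodFn, prodFn, mul_assoc]
  rw [hev, prod_aeval_X_eq_sum]
  simp_rw [diffOp₁, Polynomial.sum_def]
  rw [Finset.prod_univ_sum, map_sum]
  refine Finset.sum_congr rfl fun e _ => ?_
  rw [hmon]
  simp only [w, Finset.prod_mul_distrib, Finset.prod_pow_eq_pow_sum, Finsupp.degree_eq_sum,
    Finsupp.equivFunOnFinite_symm_apply_apply]
  ring

/-- The kernel `(s,t) ↦ e^{(D-D₀)(s²+t²)/D₀²} e^{-D(s-t)²/(2D₀²)}` of one variable. -/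
def kern₁ (D D₀ s t : ℝ) : ℝ :=
  Real.exp ((D - D₀) * (s ^ 2 + t ^ 2) / D₀ ^ 2) * Real.exp (-(D * (s - t) ^ 2) / (2 * D₀ ^ 2))

theorem kern_eq_prod {n : ℕ} (D D₀ : ℝ) (x y : Pt n) :
    kern D D₀ x y = ∏ i, kern₁ D D₀ (x i) (y i) := by
  simp only [kern₁]
  rw [Finset.prod_mul_distrib, ← Real.exp_sum, ← Real.exp_sum, kern]
  simp only [EuclideanSpace.real_norm_sq_eq, ← Finset.sum_add_distrib, Finset.mul_sum,
    Finset.sum_div, PiLp.sub_apply, Finset.sum_neg_distrib, neg_div]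

/-- The one-dimensional analogue of `calC`: `𝒮_b(-√D ∂_s) 𝒮_c(-√D ∂_t) kern₁(s,t)`. -/
def calC₁ (D D₀ : ℝ) (b c : ℕ) (s t : ℝ) : ℝ :=
  diffOp₁ (sPoly b) (-Real.sqrt D)
    (fun s' => diffOp₁ (sPoly c) (-Real.sqrt D) (fun t' => kern₁ D D₀ s' t') t) s

theorem calC_eq_prod {n : ℕ} (D D₀ : ℝ) (β γ : Fin n →₀ ℕ) (x y : Pt n) :
    calC D D₀ β γ x y = ∏ i, calC₁ D D₀ (β i) (γ i) (x i) (y i) := by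
  have h1 : ∀ x' : Pt n, (fun y' => kern D D₀ x' y') =
      prodFn fun i t => kern₁ D D₀ (x' i) t :=
    fun x' => funext fun y' => kern_eq_prod D D₀ x' y'
  unfold calC sMv
  simp_rw [h1, diffOp_prodFn]
  exact diffOp_prodFn _ _ (fun i s => diffOp₁ (sPoly (γ i)) (-Real.sqrt D)
    (fun t => kern₁ D D₀ s t) (y i)) x

end GaussPU

namespace GaussPU
open MeasureTheory ProbabilityTheory

/-! ### The features of one variable and their Gram kernel -/

/-- The functions of the standard normal variable that stay integrable after multiplication by any
`e^{c|z|}`. -/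
def ExpIntegrable (ρ : ℝ → ℝ) : Prop :=
  ∀ c : ℝ, Integrable (fun z => Real.exp (c * |z|) * ρ z) (gaussianReal 0 1)

theorem expIntegrable_one : ExpIntegrable fun _ => 1 := by
  intro c
  simp only [mul_one]
  have h : Integrable (fun z : ℝ => Real.exp (c * z) + Real.exp (-c * z)) (gaussianReal 0 1) :=
    (integrable_exp_mul_gaussianReal c).add (integrable_exp_mul_gaussianReal (-c))
  refine h.mono' (by fun_prop) (.of_forall fun z => ?_)
  rw [Real.norm_eq_abs, abs_of_pos (Real.exp_pos _)]
  rcases abs_cases z with ⟨hz, -⟩ | ⟨hz, -⟩ <;> rw [hz]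
  · linarith [Real.exp_pos (-c * z)]
  · rw [mul_neg, ← neg_mul]; linarith [Real.exp_pos (c * z)]

theorem ExpIntegrable.integrable {ρ : ℝ → ℝ} (h : ExpIntegrable ρ) :
    Integrable ρ (gaussianReal 0 1) := by simpa using h 0

theorem ExpIntegrable.mono {ρ σ : ℝ → ℝ} (h : ExpIntegrable ρ)
    (hσ : AEStronglyMeasurable σ (gaussianReal 0 1)) (A c : ℝ)
    (hb : ∀ z, |σ z| ≤ A * Real.exp (c * |z|) * |ρ z|) : ExpIntegrable σ := by
  intro c'
  have h1 := ((h (c' + c)).norm.const_mul A)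
  refine h1.mono' ((by fun_prop : Continuous fun z : ℝ =>
    Real.exp (c' * |z|)).aestronglyMeasurable.mul hσ) (.of_forall fun z => ?_)
  simp only [Real.norm_eq_abs, abs_mul, Real.abs_exp, add_mul, Real.exp_add]
  calc _ ≤ Real.exp (c' * |z|) * (A * Real.exp (c * |z|) * |ρ z|) := by gcongr; exact hb z
    _ = _ := by ring

theorem exists_abs_eval_le_exp (P : Polynomial ℝ) :
    ∃ A, 0 ≤ A ∧ ∀ v : ℝ, |P.eval v| ≤ A * Real.exp |v| := by
  refine ⟨∑ k ∈ P.support, |P.coeff k| * (k.factorial : ℝ), by positivity, fun v => ?_⟩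
  rw [Polynomial.eval_eq_sum, Polynomial.sum_def, Finset.sum_mul]
  refine (Finset.abs_sum_le_sum_abs _ _).trans (Finset.sum_le_sum fun k _ => ?_)
  rw [abs_mul, abs_pow, mul_assoc]
  gcongr
  have := Real.pow_div_factorial_le_exp |v| (abs_nonneg v) k
  rwa [div_le_iff₀' (by positivity)] at this

/-- The feature `e^{-s²/D₀ + √D s z/D₀}`; as functions of a standard normal variable `z`, the
features have the Gram kernel `kern₁`. -/
def feature (D D₀ s z : ℝ) : ℝ := Real.exp (-s ^ 2 / D₀ + Real.sqrt D / D₀ * s * z)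

/-- The logarithmic derivative of `s ↦ feature D D₀ s z`. -/
def slope (D D₀ s z : ℝ) : ℝ := Real.sqrt D / D₀ * z - 2 * s / D₀

/-- `(∂/∂s)^k feature` is `featurePoly D₀ k`, evaluated at the slope, times `feature`. -/
def featurePoly (D₀ : ℝ) : ℕ → Polynomial ℝ
  | 0 => 1
  | k + 1 => Polynomial.X * featurePoly D₀ k
      - Polynomial.C (2 / D₀) * Polynomial.derivative (featurePoly D₀ k)

/-- For bounded `s`, polynomials in the slope times the feature, such as the derivatives of the
feature, have a common bound of exponential growth in `z`. -/
theorem exists_abs_eval_slope_mul_feature_le (D D₀ : ℝ) (P : Polynomial ℝ) (r : ℝ) :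
    ∃ A c, ∀ s, |s| ≤ r → ∀ z,
      |P.eval (slope D D₀ s z) * feature D D₀ s z| ≤ A * Real.exp (c * |z|) := by
  obtain ⟨A, hA, hP⟩ := exists_abs_eval_le_exp P
  set l := |Real.sqrt D / D₀| with hl
  have hl0 : 0 ≤ l := abs_nonneg _
  refine ⟨A * Real.exp (|2 / D₀| * r + |1 / D₀| * r ^ 2), l + l * r, fun s hs z => ?_⟩
  have hr : 0 ≤ r := (abs_nonneg s).trans hs
  have h1 : |slope D D₀ s z| ≤ l * |z| + |2 / D₀| * r := by
    unfold slope
    refine (abs_sub _ _).trans ?_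
    rw [abs_mul, mul_div_right_comm, abs_mul]
    gcongr
  have h2 : -s ^ 2 / D₀ + Real.sqrt D / D₀ * s * z ≤ |1 / D₀| * r ^ 2 + l * r * |z| := by
    have e1 : -s ^ 2 / D₀ ≤ |1 / D₀| * r ^ 2 := by
      calc -s ^ 2 / D₀ ≤ |-s ^ 2 / D₀| := le_abs_self _
        _ = |1 / D₀| * |s| ^ 2 := by
          rw [neg_div, abs_neg, div_eq_mul_one_div, abs_mul, abs_pow, mul_comm]
        _ ≤ _ := by gcongr
    have e2 : Real.sqrt D / D₀ * s * z ≤ l * r * |z| := by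
      calc _ ≤ |Real.sqrt D / D₀ * s * z| := le_abs_self _
        _ = l * |s| * |z| := by rw [abs_mul, abs_mul]
        _ ≤ _ := by gcongr
    linarith
  rw [abs_mul, feature, abs_of_pos (Real.exp_pos _)]
  calc _ ≤ (A * Real.exp (l * |z| + |2 / D₀| * r)) * Real.exp (|1 / D₀| * r ^ 2 + l * r * |z|) := by
        gcongr
        exact (hP _).trans (by gcongr)
    _ = _ := by
      simp only [mul_assoc, ← Real.exp_add]
      congr 2; ring

@[fun_prop]
theorem continuous_slope (D D₀ : ℝ) : Continuous fun p : ℝ × ℝ => slope D D₀ p.1 p.2 := by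
  unfold slope; fun_prop

@[fun_prop]
theorem continuous_feature (D D₀ : ℝ) : Continuous fun p : ℝ × ℝ => feature D D₀ p.1 p.2 := by
  unfold feature; fun_prop

theorem continuous_eval_slope_mul_feature (D D₀ : ℝ) (P : Polynomial ℝ) :
    Continuous fun p : ℝ × ℝ => P.eval (slope D D₀ p.1 p.2) * feature D D₀ p.1 p.2 :=
  (P.continuous.comp (continuous_slope D D₀)).mul (continuous_feature D D₀)

theorem ExpIntegrable.eval_slope_mul_feature {ρ : ℝ → ℝ} (h : ExpIntegrable ρ) (D D₀ s : ℝ)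
    (P : Polynomial ℝ) :
    ExpIntegrable fun z => P.eval (slope D D₀ s z) * feature D D₀ s z * ρ z := by
  obtain ⟨A, c, hb⟩ := exists_abs_eval_slope_mul_feature_le D D₀ P |s|
  refine h.mono (((continuous_eval_slope_mul_feature D D₀ P).comp
    (by fun_prop : Continuous fun z : ℝ => (s, z))).aestronglyMeasurable.mul
      h.integrable.aestronglyMeasurable) A c fun z => ?_
  rw [abs_mul]
  gcongr
  exact hb s le_rfl z

theorem hasDerivAt_eval_slope_mul_feature (D D₀ s z : ℝ) (P : Polynomial ℝ) :
    HasDerivAt (fun s => P.eval (slope D D₀ s z) * feature D D₀ s z)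
      ((Polynomial.X * P - Polynomial.C (2 / D₀) * Polynomial.derivative P).eval (slope D D₀ s z)
        * feature D D₀ s z) s := by
  have h1 : HasDerivAt (fun s => slope D D₀ s z) (-(2 / D₀)) s := by
    unfold slope
    have := ((hasDerivAt_id s).const_mul (2 / D₀)).const_sub (Real.sqrt D / D₀ * z)
    simp only [id, mul_one] at this
    refine this.congr_of_eventuallyEq (.of_forall fun t => ?_)
    simp only; ring
  have h2 : HasDerivAt (fun s => feature D D₀ s z) (feature D D₀ s z * slope D D₀ s z) s := by
    unfold feature
    have h3 : HasDerivAt (fun s => -s ^ 2 / D₀ + Real.sqrt D / D₀ * s * z) (slope D D₀ s z) s := by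
      have := (((hasDerivAt_pow 2 s).neg).div_const D₀).add
        (((hasDerivAt_id s).const_mul (Real.sqrt D / D₀)).mul_const z)
      refine this.congr_deriv ?_
      unfold slope; simp; ring
    exact h3.exp
  refine (((P.hasDerivAt _).comp s h1).mul h2).congr_deriv ?_
  simp only [Polynomial.eval_sub, Polynomial.eval_mul, Polynomial.eval_X, Polynomial.eval_C,
    Function.comp]
  ring

theorem hasDerivAt_integral_eval_slope_mul_feature {ρ : ℝ → ℝ} (h : ExpIntegrable ρ) (D D₀ s : ℝ)
    (P : Polynomial ℝ) :
    HasDerivAt (fun s => ∫ z, P.eval (slope D D₀ s z) * feature D D₀ s z * ρ z ∂gaussianReal 0 1)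
      (∫ z, (Polynomial.X * P - Polynomial.C (2 / D₀) * Polynomial.derivative P).eval
        (slope D D₀ s z) * feature D D₀ s z * ρ z ∂gaussianReal 0 1) s := by
  obtain ⟨A, c, hb⟩ := exists_abs_eval_slope_mul_feature_le D D₀
    (Polynomial.X * P - Polynomial.C (2 / D₀) * Polynomial.derivative P) (|s| + 1)
  refine (hasDerivAt_integral_of_dominated_loc_of_deriv_le (Metric.ball_mem_nhds s one_pos)
    (bound := fun z => A * ‖Real.exp (c * |z|) * ρ z‖)
    (F' := fun s z => (Polynomial.X * P - Polynomial.C (2 / D₀) * Polynomial.derivative P).eval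
        (slope D D₀ s z) * feature D D₀ s z * ρ z) ?_ ?_ ?_ ?_ ?_ ?_).2
  · exact .of_forall fun t => (h.eval_slope_mul_feature D D₀ t P).integrable.aestronglyMeasurable
  · exact (h.eval_slope_mul_feature D D₀ s P).integrable
  · exact (h.eval_slope_mul_feature D D₀ s _).integrable.aestronglyMeasurable
  · refine .of_forall fun z t ht => ?_
    have ht' : |t| ≤ |s| + 1 := by
      rw [Metric.mem_ball, Real.dist_eq] at ht
      have := abs_sub_abs_le_abs_sub t s
      linarith
    rw [norm_mul, norm_mul (Real.exp _), ← mul_assoc, Real.norm_eq_abs (Real.exp _), Real.abs_exp]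
    gcongr
    exact hb t ht' z
  · exact (h c).norm.const_mul A
  · exact .of_forall fun z t _ => (hasDerivAt_eval_slope_mul_feature D D₀ t z P).mul_const _

theorem iterate_deriv_integral_feature {ρ : ℝ → ℝ} (h : ExpIntegrable ρ) (D D₀ : ℝ) (k : ℕ) :
    deriv^[k] (fun s => ∫ z, feature D D₀ s z * ρ z ∂gaussianReal 0 1) =
      fun s => ∫ z, (featurePoly D₀ k).eval (slope D D₀ s z) * feature D D₀ s z * ρ z
        ∂gaussianReal 0 1 := by
  induction k with
  | zero => simp [featurePoly]
  | succ k ih =>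
    rw [Function.iterate_succ_apply', ih]
    funext s
    exact (hasDerivAt_integral_eval_slope_mul_feature h D D₀ s _).deriv

/-- `𝒮_b(-√D ∂_s) feature` is `sFeaturePoly D D₀ b`, evaluated at the slope, times `feature`. -/
def sFeaturePoly (D D₀ : ℝ) (b : ℕ) : Polynomial ℝ :=
  (sPoly b).sum fun k c => Polynomial.C (c * (-Real.sqrt D) ^ k) * featurePoly D₀ k

/-- The function `𝒮_b(-√D ∂_s) feature` of `s` and `z`. -/
def sFeature (D D₀ : ℝ) (b : ℕ) (s z : ℝ) : ℝ :=
  (sFeaturePoly D D₀ b).eval (slope D D₀ s z) * feature D D₀ s z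

theorem ExpIntegrable.sFeature_mul {ρ : ℝ → ℝ} (h : ExpIntegrable ρ) (D D₀ s : ℝ) (b : ℕ) :
    ExpIntegrable fun z => sFeature D D₀ b s z * ρ z :=
  h.eval_slope_mul_feature D D₀ s _

theorem expIntegrable_sFeature (D D₀ s : ℝ) (b : ℕ) : ExpIntegrable (sFeature D D₀ b s) := by
  simpa using expIntegrable_one.sFeature_mul D D₀ s b

/-- The operator `𝒮_b(-√D ∂_s)` may be applied under the integral sign. -/
theorem diffOp₁_integral_feature {ρ : ℝ → ℝ} (h : ExpIntegrable ρ) (D D₀ s : ℝ) (b : ℕ) :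
    diffOp₁ (sPoly b) (-Real.sqrt D)
        (fun s => ∫ z, feature D D₀ s z * ρ z ∂gaussianReal 0 1) s =
      ∫ z, sFeature D D₀ b s z * ρ z ∂gaussianReal 0 1 := by
  simp only [diffOp₁, iterate_deriv_integral_feature h, sFeature, sFeaturePoly, Polynomial.sum_def,
    Polynomial.eval_finsetSum, Finset.sum_mul]
  rw [integral_finsetSum]
  · refine Finset.sum_congr rfl fun k _ => ?_
    rw [← integral_const_mul]
    congr 1
    funext z
    simp only [Polynomial.eval_mul, Polynomial.eval_C]
    ring
  · intro k _
    exact (h.eval_slope_mul_feature D D₀ s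
      (Polynomial.C ((sPoly b).coeff k * (-Real.sqrt D) ^ k) * featurePoly D₀ k)).integrable

/-- `kern₁` is the Gram kernel of the features; this is the Laplace transform of the normal
distribution. -/
theorem integral_feature_mul_feature {D D₀ : ℝ} (hD : 0 ≤ D) (hD₀ : D₀ ≠ 0) (s t : ℝ) :
    ∫ z, feature D D₀ s z * feature D D₀ t z ∂gaussianReal 0 1 = kern₁ D D₀ s t := by
  have h1 : ∀ z, feature D D₀ s z * feature D D₀ t z =
      Real.exp (-(s ^ 2 + t ^ 2) / D₀) * Real.exp (Real.sqrt D / D₀ * (s + t) * z) := by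
    intro z
    rw [feature, feature, ← Real.exp_add, ← Real.exp_add]
    congr 1; ring
  simp_rw [h1]
  rw [integral_const_mul]
  have h2 : ∫ z, Real.exp (Real.sqrt D / D₀ * (s + t) * z) ∂gaussianReal 0 1 =
      Real.exp ((Real.sqrt D / D₀ * (s + t)) ^ 2 / 2) := by
    have := mgf_gaussianReal (X := id) (p := gaussianReal 0 1) (μ := 0) (v := 1)
      Measure.map_id (Real.sqrt D / D₀ * (s + t))
    simpa [mgf] using this
  rw [h2, kern₁, ← Real.exp_add, ← Real.exp_add]
  congr 1
  rw [mul_pow, div_pow, Real.sq_sqrt hD]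
  field_simp
  ring

theorem calC₁_eq_integral {D D₀ : ℝ} (hD : 0 ≤ D) (hD₀ : D₀ ≠ 0) (b c : ℕ) (s t : ℝ) :
    calC₁ D D₀ b c s t = ∫ z, sFeature D D₀ b s z * sFeature D D₀ c t z ∂gaussianReal 0 1 := by
  have h0 : ∀ s : ℝ, ExpIntegrable (feature D D₀ s) := fun s => by
    simpa using expIntegrable_one.eval_slope_mul_feature D D₀ s 1
  have h1 : ∀ s' : ℝ, diffOp₁ (sPoly c) (-Real.sqrt D) (fun t' => kern₁ D D₀ s' t') t =
      ∫ z, feature D D₀ s' z * sFeature D D₀ c t z ∂gaussianReal 0 1 := by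
    intro s'
    have : (fun t' => kern₁ D D₀ s' t') =
        fun t' => ∫ z, feature D D₀ t' z * feature D D₀ s' z ∂gaussianReal 0 1 := by
      funext t'
      rw [← integral_feature_mul_feature hD hD₀]
      simp_rw [mul_comm]
    rw [this, diffOp₁_integral_feature (h0 s')]
    simp_rw [mul_comm]
  simp only [calC₁, h1]
  exact diffOp₁_integral_feature (expIntegrable_sFeature D D₀ t c) D D₀ s b

end GaussPU

namespace GaussPU
open MeasureTheory ProbabilityTheory

/-! ### Evaluation of Gaussians as a pairing with the features -/

/-- The polynomials `𝒮_k` form an Appell sequence, up to normalization. -/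
theorem derivative_sPoly_succ (k : ℕ) :
    Polynomial.derivative (sPoly (k + 1)) = Polynomial.C (-((k + 1 : ℝ) / 2)) * sPoly k := by
  induction k with
  | zero => simp [sPoly]
  | succ k ih =>
    rw [sPoly, Polynomial.derivative_sub, ih, Polynomial.derivative_C_mul]
    rw [Polynomial.derivative_mul, ih]
    simp only [Polynomial.derivative_C_mul, Polynomial.derivative_X]
    have h : sPoly (k + 1) = Polynomial.C (-(1 / 2)) * Polynomial.X * sPoly k
      - Polynomial.derivative (sPoly k) := rfl
    have h2 : Polynomial.derivative (sPoly k) = Polynomial.C (-(1 / 2)) * Polynomial.X * sPoly k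
      - sPoly (k + 1) := by rw [h]; ring
    rw [h2]
    have h3 : Polynomial.C (-(((k + 1 : ℕ) + 1 : ℝ) / 2)) =
      Polynomial.C (-(1 / 2)) + Polynomial.C (-((k + 1 : ℝ) / 2)) := by
      rw [← Polynomial.C_add]; congr 1; push_cast; ring
    rw [h3]
    ring

theorem diffOp₁_eq_lsum (P : Polynomial ℝ) (s : ℝ) (f : ℝ → ℝ) (t : ℝ) :
    diffOp₁ P s f t =
      Polynomial.lsum (fun k => (s ^ k * deriv^[k] f t) • (LinearMap.id : ℝ →ₗ[ℝ] ℝ)) P := by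
  rw [Polynomial.lsum_apply]
  simp only [diffOp₁, LinearMap.smul_apply, LinearMap.id_apply, smul_eq_mul]
  congr 1
  funext k c
  ring

theorem diffOp₁_sub (P Q : Polynomial ℝ) (s : ℝ) (f : ℝ → ℝ) (t : ℝ) :
    diffOp₁ (P - Q) s f t = diffOp₁ P s f t - diffOp₁ Q s f t := by
  simp only [diffOp₁_eq_lsum, map_sub]

theorem diffOp₁_C_mul (a : ℝ) (P : Polynomial ℝ) (s : ℝ) (f : ℝ → ℝ) (t : ℝ) :
    diffOp₁ (Polynomial.C a * P) s f t = a * diffOp₁ P s f t := by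
  rw [← Polynomial.smul_eq_C_mul]
  simp only [diffOp₁_eq_lsum, map_smul, smul_eq_mul]

theorem diffOp₁_X_mul (P : Polynomial ℝ) (s : ℝ) {f : ℝ → ℝ}
    (hf : ∀ k, Differentiable ℝ (deriv^[k] f)) (t : ℝ) :
    diffOp₁ (Polynomial.X * P) s f t = s * deriv (diffOp₁ P s f) t := by
  induction P using Polynomial.induction_on' with
  | add P Q hP hQ =>
    have hd : ∀ P : Polynomial ℝ, Differentiable ℝ (diffOp₁ P s f) := by
      intro P
      unfold diffOp₁
      simp only [Polynomial.sum_def]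
      exact Differentiable.fun_sum fun k _ => (hf k).const_mul _
    have h : diffOp₁ (P + Q) s f = diffOp₁ P s f + diffOp₁ Q s f := by
      funext t; simp only [Pi.add_apply, diffOp₁_eq_lsum, map_add]
    rw [mul_add, h, deriv_add (hd P t) (hd Q t), mul_add, ← hP, ← hQ]
    simp only [diffOp₁_eq_lsum, map_add]
  | monomial k a =>
    have h : diffOp₁ (Polynomial.monomial k a) s f = fun t => a * s ^ k * deriv^[k] f t := by
      funext t; rw [diffOp₁, Polynomial.sum_monomial_index _ _ (by simp)]
    rw [h, Polynomial.X_mul_monomial, deriv_const_mul_field, diffOp₁,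
      Polynomial.sum_monomial_index _ _ (by simp), Function.iterate_succ_apply']
    ring

/-- The operators `𝒮_b(-√D d/ds)` generate the monomial multiples of the Gaussian. -/
theorem diffOp₁_sPoly_gaussian {D : ℝ} (hD : 0 < D) (x : ℝ) (b : ℕ) :
    diffOp₁ (sPoly b) (-Real.sqrt D) (fun s => Real.exp (-(x - s) ^ 2 / D)) =
      fun s => ((x - s) / Real.sqrt D) ^ b * Real.exp (-(x - s) ^ 2 / D) := by
  have hr : Real.sqrt D ≠ 0 := (Real.sqrt_pos.2 hD).ne'
  have hsq : Real.sqrt D ^ 2 = D := Real.sq_sqrt hD.le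
  have hf : ∀ k, Differentiable ℝ (deriv^[k] fun s => Real.exp (-(x - s) ^ 2 / D)) := by
    intro k
    rw [← iteratedDeriv_eq_iterate]
    have : ContDiff ℝ (k + 1 : ℕ) fun s => Real.exp (-(x - s) ^ 2 / D) := by fun_prop
    exact this.differentiable_iteratedDeriv k (by exact_mod_cast Nat.lt_succ_self k)
  have hg : ∀ s, HasDerivAt (fun s => Real.exp (-(x - s) ^ 2 / D))
      (Real.exp (-(x - s) ^ 2 / D) * (2 * (x - s) / D)) s := by
    intro s
    have := ((((hasDerivAt_id s).const_sub x).pow 2).neg.div_const D).exp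
    refine this.congr_deriv ?_
    simp
  have hy : ∀ s, HasDerivAt (fun s => (x - s) / Real.sqrt D) (-1 / Real.sqrt D) s := fun s =>
    ((hasDerivAt_id s).const_sub x).div_const _
  induction b using Nat.strong_induction_on with
  | _ b ih =>
  have h0 : ∀ s, diffOp₁ 0 (-Real.sqrt D) (fun s => Real.exp (-(x - s) ^ 2 / D)) s = 0 := by
    intro s; simp [diffOp₁]
  funext s
  rcases b with _ | b
  · rw [sPoly, ← Polynomial.C_1, diffOp₁, Polynomial.sum_C_index (by simp)]
    simp
  · have h1 : diffOp₁ (Polynomial.derivative (sPoly b)) (-Real.sqrt D)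
        (fun s => Real.exp (-(x - s) ^ 2 / D)) s =
        -(b / 2 : ℝ) * (((x - s) / Real.sqrt D) ^ (b - 1) * Real.exp (-(x - s) ^ 2 / D)) := by
      rcases b with _ | b
      · simp [sPoly, h0]
      · rw [derivative_sPoly_succ, diffOp₁_C_mul, ih b (by omega)]
        simp
    have h2 : HasDerivAt (fun s => ((x - s) / Real.sqrt D) ^ b * Real.exp (-(x - s) ^ 2 / D)) _ s :=
      ((hy s).pow b).mul (hg s)
    rw [sPoly, diffOp₁_sub, mul_assoc, diffOp₁_C_mul, diffOp₁_X_mul _ _ hf, h1,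
      ih b (by omega), h2.deriv]
    have h3 : 2 * (x - s) / D = 2 / Real.sqrt D * ((x - s) / Real.sqrt D) := by
      rw [div_mul_div_comm, ← sq, hsq]
    simp only [Pi.pow_apply]
    rw [h3, pow_succ]
    generalize (x - s) / Real.sqrt D = y
    field_simp
    ring

theorem integral_exp_quadratic_gaussianReal {w : ℝ} (hw : 0 < w) (v : ℝ) :
    ∫ z, Real.exp (-((w - 1) / 2) * z ^ 2 + v * z) ∂gaussianReal 0 1 =
      (Real.sqrt w)⁻¹ * Real.exp (v ^ 2 / (2 * w)) := by
  rw [integral_gaussianReal_eq_integral_smul one_ne_zero]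
  have h1 : ∀ z : ℝ, gaussianPDFReal 0 1 z • Real.exp (-((w - 1) / 2) * z ^ 2 + v * z) =
      ((Real.sqrt (2 * Real.pi))⁻¹ * Real.exp (v ^ 2 / (2 * w))) *
        Real.exp (-(w / 2) * (z - v / w) ^ 2) := by
    intro z
    simp only [gaussianPDFReal, NNReal.coe_one, mul_one, smul_eq_mul, sub_zero]
    rw [mul_assoc, mul_assoc, ← Real.exp_add, ← Real.exp_add]
    congr 2
    field_simp
    ring
  simp_rw [h1]
  rw [integral_const_mul, integral_sub_right_eq_self (fun z => Real.exp (-(w / 2) * z ^ 2)),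
    integral_gaussian]
  have h2 : Real.pi / (w / 2) = 2 * Real.pi / w := by field_simp
  have h3 : Real.sqrt (2 * Real.pi) ≠ 0 := (Real.sqrt_pos.2 (by positivity)).ne'
  rw [h2, Real.sqrt_div (by positivity)]
  field_simp

/-- The constant `w` such that multiplying the standard normal density by the Gaussian factor of
`dual` gives a normal density of variance `1/w`. -/
def dualPrec (D D₀ : ℝ) : ℝ := D ^ 2 / (2 * D₀ * (D - D₀))

/-- The linear term of the exponent of `dual`. -/
def dualShift (D D₀ x : ℝ) : ℝ := 2 * x * dualPrec D D₀ / (D * (Real.sqrt D / D₀))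

/-- The function of the standard normal variable `z` that represents the evaluation at `x` of
Gaussians: its pairing with `feature D D₀ s` is `e^{-(x-s)²/D}`. -/
def dual (D D₀ x z : ℝ) : ℝ :=
  Real.sqrt (dualPrec D D₀) *
    Real.exp (-x ^ 2 / D - dualShift D D₀ x ^ 2 / (2 * dualPrec D D₀)) *
    Real.exp (-((dualPrec D D₀ - 1) / 2) * z ^ 2 + dualShift D D₀ x * z)

theorem one_lt_dualPrec {D D₀ : ℝ} (h₀ : 0 < D₀) (h : D₀ < D) : 1 < dualPrec D D₀ := by
  rw [dualPrec, lt_div_iff₀ (by nlinarith)]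
  nlinarith [sq_nonneg (D - D₀), mul_pos h₀ h₀, mul_pos h₀ (sub_pos.2 h)]

theorem expIntegrable_dual {D D₀ : ℝ} (h₀ : 0 < D₀) (h : D₀ < D) (x : ℝ) :
    ExpIntegrable (dual D D₀ x) := by
  have hw := one_lt_dualPrec h₀ h
  refine expIntegrable_one.mono
    (by unfold dual; fun_prop : Continuous (dual D D₀ x)).aestronglyMeasurable
    (Real.sqrt (dualPrec D D₀) *
      Real.exp (-x ^ 2 / D - dualShift D D₀ x ^ 2 / (2 * dualPrec D D₀)))
    |dualShift D D₀ x| fun z => ?_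
  rw [dual, abs_mul, abs_of_nonneg (by positivity), Real.abs_exp, abs_one, mul_one]
  gcongr
  have h1 : dualShift D D₀ x * z ≤ |dualShift D D₀ x| * |z| := by
    rw [← abs_mul]; exact le_abs_self _
  nlinarith [sq_nonneg z]

theorem integral_feature_mul_dual {D D₀ : ℝ} (h₀ : 0 < D₀) (h : D₀ < D) (x s : ℝ) :
    ∫ z, feature D D₀ s z * dual D D₀ x z ∂gaussianReal 0 1 = Real.exp (-(x - s) ^ 2 / D) := by
  have hw : 0 < dualPrec D D₀ := one_pos.trans (one_lt_dualPrec h₀ h)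
  have hD : 0 < D := h₀.trans h
  have hl : (Real.sqrt D / D₀) ^ 2 = D / D₀ ^ 2 := by rw [div_pow, Real.sq_sqrt hD.le]
  set l := Real.sqrt D / D₀ with hldef
  have hl0 : 0 < l := div_pos (Real.sqrt_pos.2 hD) h₀
  set w := dualPrec D D₀ with hwdef
  set v := dualShift D D₀ x with hv
  have h1 : ∀ z, feature D D₀ s z * dual D D₀ x z =
      (Real.sqrt w * Real.exp (-s ^ 2 / D₀ - x ^ 2 / D - v ^ 2 / (2 * w))) *
        Real.exp (-((w - 1) / 2) * z ^ 2 + (l * s + v) * z) := by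
    intro z
    rw [feature, dual, ← hldef, ← hwdef, ← hv, mul_comm]
    simp only [mul_assoc (Real.sqrt w), ← Real.exp_add]
    congr 2
    ring
  simp_rw [h1]
  rw [integral_const_mul, integral_exp_quadratic_gaussianReal hw]
  have hsw : Real.sqrt w ≠ 0 := (Real.sqrt_pos.2 hw).ne'
  have e1 : (l * s + v) ^ 2 / (2 * w) =
      (l * s) ^ 2 / (2 * w) + l * s * v / w + v ^ 2 / (2 * w) := by
    field_simp; ring
  have e2 : (l * s) ^ 2 / (2 * w) = s ^ 2 * (1 / D₀ - 1 / D) := by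
    have hDD : D - D₀ ≠ 0 := (sub_pos.2 h).ne'
    rw [mul_pow, hl, hwdef, dualPrec]
    field_simp
  have e3 : l * s * v / w = 2 * x * s / D := by
    rw [hv, dualShift, ← hldef, ← hwdef]
    field_simp
  calc _ = (Real.sqrt w * (Real.sqrt w)⁻¹) * (Real.exp (-s ^ 2 / D₀ - x ^ 2 / D - v ^ 2 / (2 * w))
        * Real.exp ((l * s + v) ^ 2 / (2 * w))) := by ring
    _ = _ := by
      rw [mul_inv_cancel₀ hsw, one_mul, ← Real.exp_add, e1, e2, e3]
      congr 1
      field_simp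
      ring

/-- The squared norm of the function representing the evaluation at `x` decays like a Gaussian; the
rate `q` is positive because `D₀ < D`. -/
theorem exists_integral_dual_sq {D D₀ : ℝ} (h₀ : 0 < D₀) (h : D₀ < D) :
    ∃ C > 0, ∃ q > 0, ∀ x,
      ∫ z, dual D D₀ x z ^ 2 ∂gaussianReal 0 1 = C * Real.exp (-q * x ^ 2) := by
  have hw1 := one_lt_dualPrec h₀ h
  have hD : 0 < D := h₀.trans h
  have hDD : 0 < D - D₀ := sub_pos.2 h
  have hl : (Real.sqrt D / D₀) ^ 2 = D / D₀ ^ 2 := by rw [div_pow, Real.sq_sqrt hD.le]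
  set l := Real.sqrt D / D₀ with hldef
  have hl0 : 0 < l := div_pos (Real.sqrt_pos.2 hD) h₀
  set w := dualPrec D D₀ with hwdef
  have hw : 0 < w := one_pos.trans hw1
  have hw2 : 0 < 2 * w - 1 := by linarith
  have hden : 0 < D ^ 2 - D * D₀ + D₀ ^ 2 := by nlinarith
  refine ⟨w * (Real.sqrt (2 * w - 1))⁻¹, mul_pos hw (inv_pos.2 (Real.sqrt_pos.2 hw2)),
    2 / D * ((D ^ 2 - D * D₀) / (D ^ 2 - D * D₀ + D₀ ^ 2)), ?_, fun x => ?_⟩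
  · have : 0 < D ^ 2 - D * D₀ := by nlinarith
    positivity
  set v := dualShift D D₀ x with hv
  have h1 : ∀ z, dual D D₀ x z ^ 2 = (w * Real.exp (-2 * x ^ 2 / D - v ^ 2 / w)) *
      Real.exp (-((2 * w - 1 - 1) / 2) * z ^ 2 + (2 * v) * z) := by
    intro z
    rw [dual, ← hwdef, ← hv, mul_pow, mul_pow, Real.sq_sqrt hw.le, ← Real.exp_nat_mul,
      ← Real.exp_nat_mul]
    congr 3
    · push_cast; field_simp
    · push_cast; ring
  simp_rw [h1]
  rw [integral_const_mul, integral_exp_quadratic_gaussianReal hw2]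
  have e : -2 * x ^ 2 / D - v ^ 2 / w + (2 * v) ^ 2 / (2 * (2 * w - 1)) =
      -(2 / D * ((D ^ 2 - D * D₀) / (D ^ 2 - D * D₀ + D₀ ^ 2))) * x ^ 2 := by
    have hv2 : v ^ 2 = 4 * x ^ 2 * w ^ 2 / (D ^ 2 * (D / D₀ ^ 2)) := by
      rw [hv, dualShift, ← hldef, ← hwdef, div_pow, mul_pow, mul_pow, mul_pow, hl]; norm_num
    have hw3 : 2 * w - 1 = (D ^ 2 - D * D₀ + D₀ ^ 2) / (D₀ * (D - D₀)) := by
      rw [hwdef, dualPrec]; field_simp; ring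
    rw [mul_pow, hv2, hw3, hwdef, dualPrec]
    field_simp
    ring
  calc _ = (w * (Real.sqrt (2 * w - 1))⁻¹) * (Real.exp (-2 * x ^ 2 / D - v ^ 2 / w)
        * Real.exp ((2 * v) ^ 2 / (2 * (2 * w - 1)))) := by ring
    _ = _ := by rw [← Real.exp_add, e]

theorem integral_sFeature_mul_dual {D D₀ : ℝ} (h₀ : 0 < D₀) (h : D₀ < D) (b : ℕ) (x s : ℝ) :
    ∫ z, sFeature D D₀ b s z * dual D D₀ x z ∂gaussianReal 0 1 =
      ((x - s) / Real.sqrt D) ^ b * Real.exp (-(x - s) ^ 2 / D) := by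
  rw [← diffOp₁_integral_feature (expIntegrable_dual h₀ h x)]
  simp_rw [integral_feature_mul_dual h₀ h]
  rw [diffOp₁_sPoly_gaussian (h₀.trans h)]

end GaussPU

namespace GaussPU
open MeasureTheory ProbabilityTheory Filter Topology

/-! ### Linear independence -/

theorem coeff_prod_aeval_X {n : ℕ} (p : Fin n → Polynomial ℝ) (α : Fin n →₀ ℕ) :
    (∏ i, Polynomial.aeval (MvPolynomial.X i : MvPolynomial (Fin n) ℝ) (p i)).coeff α =
      ∏ i, (p i).coeff (α i) := by
  classical
  rw [prod_aeval_X_eq_sum, MvPolynomial.coeff_sum]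
  simp_rw [MvPolynomial.coeff_monomial, Equiv.symm_apply_eq]
  rw [Finset.sum_ite_eq' _ (Finsupp.equivFunOnFinite α)]
  split_ifs with h
  · simp
  · simp only [Fintype.mem_piFinset, not_forall, Polynomial.mem_support_iff, not_not] at h
    obtain ⟨i, hi⟩ := h
    exact (Finset.prod_eq_zero (Finset.mem_univ i) (by simpa using hi)).symm

/-- Products of polynomials of one variable, one polynomial of each degree, are linearly
independent as functions of several variables. -/
theorem eq_zero_of_sum_prod_eval_eq_zero {n : ℕ} {q : ℕ → Polynomial ℝ}
    (hq : ∀ b, (q b).degree = b) {T : Finset (Fin n →₀ ℕ)} {c : (Fin n →₀ ℕ) → ℝ}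
    (h : ∀ v : Fin n → ℝ, ∑ β ∈ T, c β * ∏ i, (q (β i)).eval (v i) = 0) :
    ∀ β ∈ T, c β = 0 := by
  classical
  have hP : ∑ β ∈ T, MvPolynomial.C (c β) *
      ∏ i, Polynomial.aeval (MvPolynomial.X i : MvPolynomial (Fin n) ℝ) (q (β i)) = 0 := by
    refine MvPolynomial.funext fun v => ?_
    rw [map_zero, ← h v, map_sum]
    refine Finset.sum_congr rfl fun β _ => ?_
    rw [map_mul, MvPolynomial.eval_C, map_prod]
    congr 1
    refine Finset.prod_congr rfl fun i _ => ?_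
    rw [← MvPolynomial.coe_aeval_eq_eval, RingHom.coe_coe, ← Polynomial.aeval_algHom_apply]
    simp [Polynomial.aeval_def, Polynomial.eval₂_id]
  by_contra! hne
  -- for a maximal `β` with `c β ≠ 0`, only the product for `β` contains the monomial of `β`
  obtain ⟨β₀, hβ₀, hc₀⟩ := hne
  obtain ⟨β, hβ⟩ := (T.filter fun β => c β ≠ 0).exists_maximal ⟨β₀, by simp [hβ₀, hc₀]⟩
  have hβT := Finset.mem_filter.1 hβ.prop
  have h1 := congrArg (MvPolynomial.coeff β) hP
  rw [MvPolynomial.coeff_sum, MvPolynomial.coeff_zero] at h1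
  simp only [MvPolynomial.coeff_C_mul, coeff_prod_aeval_X] at h1
  rw [Finset.sum_eq_single β] at h1
  · refine (mul_ne_zero hβT.2 (Finset.prod_ne_zero_iff.2 fun i _ => ?_)) h1
    exact Polynomial.coeff_ne_zero_of_eq_degree (hq _)
  · intro β' hβ' hne
    by_contra hz
    obtain ⟨hc, hprod⟩ := mul_ne_zero_iff.1 hz
    have hle : β ≤ β' := by
      intro i
      by_contra hlt
      refine Finset.prod_ne_zero_iff.1 hprod i (Finset.mem_univ i) ?_
      refine Polynomial.coeff_eq_zero_of_degree_lt ?_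
      rw [hq]
      exact_mod_cast not_le.1 hlt
    exact hne (le_antisymm (hβ.le_of_ge (Finset.mem_filter.2 ⟨hβ', hc⟩) hle) hle)
  · exact fun h => absurd hβT.1 h

/-- Functions that restrict to polynomials on lines, multiplied by distinct exponentials, are
linearly independent: along the direction of the frequency of largest norm, the corresponding
exponential dominates the others. -/
theorem eq_zero_of_sum_mul_exp_eq_zero {n : ℕ} {l : ℝ} (hl : 0 < l) (A : Finset (Pt n))
    {F : Pt n → (Fin n → ℝ) → ℝ}
    (hF : ∀ (a : Pt n) (z w : Fin n → ℝ), ∃ p : Polynomial ℝ, ∀ t : ℝ,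
      F a (fun i => z i + t * w i) = p.eval t)
    (h : ∀ z : Fin n → ℝ, ∑ a ∈ A, F a z * Real.exp (l * ∑ i, a i * z i) = 0) :
    ∀ a ∈ A, ∀ z, F a z = 0 := by
  classical
  induction A using Finset.strongInduction with
  | H A ih =>
  rcases A.eq_empty_or_nonempty with rfl | hA
  · simp
  obtain ⟨J, hJ, hmax⟩ := A.exists_max_image (fun a : Pt n => ∑ i, a i ^ 2) hA
  -- a polynomial that tends to zero at infinity vanishes
  have hJ0 : ∀ z, F J z = 0 := by
    intro z
    choose p hp using fun a => hF a z (fun i => J i)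
    have hlim : Tendsto (fun t => (p J).eval t) atTop (𝓝 0) := by
      have h1 : ∀ t, (p J).eval t = -∑ a ∈ A.erase J,
          Real.exp (l * ∑ i, a i * z i - l * ∑ i, J i * z i) * ((p a).eval t *
            Real.exp (-(l * (∑ i, J i ^ 2 - ∑ i, a i * J i)) * t)) := by
        intro t
        have h2 := h fun i => z i + t * J i
        simp only [hp] at h2
        rw [← Finset.add_sum_erase _ _ hJ] at h2
        have h3 : ∀ a : Pt n, ∑ i, a i * (z i + t * J i) = ∑ i, a i * z i + t * ∑ i, a i * J i := by
          intro a
          rw [Finset.mul_sum, ← Finset.sum_add_distrib]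
          exact Finset.sum_congr rfl fun i _ => by ring
        have h4 := congrArg (· * Real.exp (-(l * (∑ i, J i * z i + t * ∑ i, J i * J i)))) h2
        simp only [zero_mul, add_mul, Finset.sum_mul, h3, mul_assoc, ← Real.exp_add,
          add_neg_cancel, Real.exp_zero, mul_one] at h4
        rw [eq_neg_of_add_eq_zero_left h4]
        congr 1
        refine Finset.sum_congr rfl fun a _ => ?_
        rw [mul_left_comm, ← Real.exp_add]
        congr 2
        simp only [sq]
        ring
      have h5 : Tendsto (fun t => -∑ a ∈ A.erase J,
          Real.exp (l * ∑ i, a i * z i - l * ∑ i, J i * z i) * ((p a).eval t *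
            Real.exp (-(l * (∑ i, J i ^ 2 - ∑ i, a i * J i)) * t))) atTop
          (𝓝 (-∑ a ∈ A.erase J, Real.exp (l * ∑ i, a i * z i - l * ∑ i, J i * z i) * 0)) := by
        refine Tendsto.neg (tendsto_finsetSum _ fun a ha => Tendsto.const_mul _ ?_)
        obtain ⟨hne, haA⟩ := Finset.mem_erase.1 ha
        have hμ : 0 < l * (∑ i, J i ^ 2 - ∑ i, a i * J i) := by
          refine mul_pos hl ?_
          have e1 : 0 < ∑ i, (J i - a i) ^ 2 := by
            obtain ⟨i, hi⟩ : ∃ i, J i - a i ≠ 0 := by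
              by_contra! hall
              exact hne (by ext i; linarith [hall i])
            exact Finset.sum_pos' (fun i _ => sq_nonneg _) ⟨i, Finset.mem_univ i, by positivity⟩
          have e2 : ∑ i, (J i - a i) ^ 2 = ∑ i, J i ^ 2 - 2 * ∑ i, a i * J i + ∑ i, a i ^ 2 := by
            rw [Finset.mul_sum, ← Finset.sum_sub_distrib, ← Finset.sum_add_distrib]
            exact Finset.sum_congr rfl fun i _ => by ring
          have e3 := hmax a haA
          linarith
        set μ := l * (∑ i, J i ^ 2 - ∑ i, a i * J i)
        have h6 := (Polynomial.tendsto_div_exp_atTop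
          ((p a).comp (Polynomial.C μ⁻¹ * Polynomial.X))).comp
          (tendsto_id.const_mul_atTop hμ)
        refine h6.congr fun t => ?_
        simp only [Function.comp, Polynomial.eval_comp, Polynomial.eval_mul, Polynomial.eval_C,
          Polynomial.eval_X, id, neg_mul, Real.exp_neg, div_eq_mul_inv]
        rw [inv_mul_cancel_left₀ hμ.ne']
      simp only [mul_zero, Finset.sum_const_zero, neg_zero] at h5
      exact h5.congr fun t => (h1 t).symm
    have h7 := ((p J).tendsto_nhds_iff).1 hlim
    have h8 : p J = 0 := Polynomial.leadingCoeff_eq_zero.1 h7.1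
    have h9 := hp J 0
    simpa [h8] using h9
  intro a ha
  by_cases haJ : a = J
  · rw [haJ]; exact hJ0
  · refine ih (A.erase J) (Finset.erase_ssubset hJ) (fun z => ?_) a (Finset.mem_erase.2 ⟨haJ, ha⟩)
    have := h z
    rwa [← Finset.add_sum_erase _ _ hJ, hJ0, zero_mul, zero_add] at this

theorem degree_featurePoly (D₀ : ℝ) (k : ℕ) : (featurePoly D₀ k).degree = k := by
  induction k with
  | zero => simp [featurePoly]
  | succ k ih =>
    rw [featurePoly, Polynomial.degree_sub_eq_left_of_degree_lt, Polynomial.degree_mul,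
      Polynomial.degree_X, ih, add_comm]
    · rfl
    · rw [Polynomial.degree_mul (p := Polynomial.X), Polynomial.degree_X, ih, add_comm]
      rw [← Polynomial.smul_eq_C_mul]
      refine (Polynomial.degree_smul_le _ _).trans_lt ?_
      refine (Polynomial.degree_derivative_le).trans_lt ?_
      rw [ih]
      exact_mod_cast Nat.lt_succ_self k

theorem degree_sPoly (k : ℕ) : (sPoly k).degree = k := by
  induction k with
  | zero => simp [sPoly]
  | succ k ih =>
    have h : (Polynomial.C (-(1 / 2 : ℝ)) * Polynomial.X * sPoly k).degree =
        ((k + 1 : ℕ) : WithBot ℕ) := by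
      rw [mul_assoc, Polynomial.degree_C_mul (by norm_num), Polynomial.degree_mul,
        Polynomial.degree_X, ih, add_comm]
      rfl
    rw [sPoly, Polynomial.degree_sub_eq_left_of_degree_lt, h]
    rw [h]
    refine (Polynomial.degree_derivative_le).trans_lt ?_
    rw [ih]
    exact_mod_cast Nat.lt_succ_self k

theorem degree_sFeaturePoly {D : ℝ} (hD : 0 < D) (D₀ : ℝ) (b : ℕ) :
    (sFeaturePoly D D₀ b).degree = b := by
  have hr : -Real.sqrt D ≠ 0 := neg_ne_zero.2 (Real.sqrt_pos.2 hD).ne'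
  have hb : b ∈ (sPoly b).support := by
    rw [Polynomial.mem_support_iff]
    exact Polynomial.coeff_ne_zero_of_eq_degree (degree_sPoly b)
  have hdeg : ∀ k ∈ (sPoly b).support, (Polynomial.C ((sPoly b).coeff k * (-Real.sqrt D) ^ k) *
      featurePoly D₀ k).degree = k := by
    intro k hk
    rw [Polynomial.degree_C_mul (mul_ne_zero (Polynomial.mem_support_iff.1 hk) (pow_ne_zero _ hr)),
      degree_featurePoly]
  rw [sFeaturePoly, Polynomial.sum_def, ← Finset.add_sum_erase _ _ hb,
    Polynomial.degree_add_eq_left_of_degree_lt, hdeg b hb]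
  rw [hdeg b hb]
  refine (Polynomial.degree_sum_le _ _).trans_lt ((Finset.sup_lt_iff (WithBot.bot_lt_coe b)).2 ?_)
  intro k hk
  obtain ⟨hkb, hks⟩ := Finset.mem_erase.1 hk
  rw [hdeg k hks]
  have := Polynomial.le_degree_of_mem_supp k hks
  rw [degree_sPoly] at this
  have h2 : k ≤ b := by exact_mod_cast this
  exact Nat.cast_lt.2 (lt_of_le_of_ne h2 hkb)

end GaussPU

namespace GaussPU
open MeasureTheory ProbabilityTheory Filter Topology

/-! ### Features in `L²` -/

/-- The standard normal distribution on `ℝⁿ`. -/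
abbrev stdNormal (n : ℕ) : Measure (Fin n → ℝ) := Measure.pi fun _ => gaussianReal 0 1

theorem memLp_prod {n : ℕ} {f : Fin n → ℝ → ℝ}
    (hm : ∀ i, Continuous (f i)) (hf : ∀ i, Integrable (fun z => f i z ^ 2) (gaussianReal 0 1)) :
    MemLp (fun z : Fin n → ℝ => ∏ i, f i (z i)) 2 (stdNormal n) := by
  have hc : Continuous fun z : Fin n → ℝ => ∏ i, f i (z i) :=
    continuous_finsetProd _ fun i _ => (hm i).comp (continuous_apply i)
  rw [memLp_two_iff_integrable_sq hc.aestronglyMeasurable]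
  simp_rw [← Finset.prod_pow]
  exact Integrable.fintype_prod hf

theorem continuous_sFeature (D D₀ : ℝ) (b : ℕ) (s : ℝ) : Continuous (sFeature D D₀ b s) :=
  (continuous_eval_slope_mul_feature D D₀ (sFeaturePoly D D₀ b)).comp
    (by fun_prop : Continuous fun z : ℝ => (s, z))

theorem continuous_dual (D D₀ x : ℝ) : Continuous (dual D D₀ x) := by
  unfold dual; fun_prop

/-- `𝒮_β(-√D ∂_a)` of the feature at `a ∈ ℝⁿ`, as a function of `z ∈ ℝⁿ`. -/
def featureFun {n : ℕ} (D D₀ : ℝ) (β : Fin n →₀ ℕ) (a : Pt n) (z : Fin n → ℝ) : ℝ :=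
  ∏ i, sFeature D D₀ (β i) (a i) (z i)

theorem memLp_featureFun {n : ℕ} (D D₀ : ℝ) (β : Fin n →₀ ℕ) (a : Pt n) :
    MemLp (featureFun D D₀ β a) 2 (stdNormal n) :=
  memLp_prod (fun _ => continuous_sFeature _ _ _ _) fun i => by
    simpa only [sq] using
      ((expIntegrable_sFeature D D₀ (a i) (β i)).sFeature_mul D D₀ (a i) (β i)).integrable

theorem memLp_dual {n : ℕ} {D D₀ : ℝ} (h₀ : 0 < D₀) (h : D₀ < D) (x : Pt n) :
    MemLp (fun z : Fin n → ℝ => ∏ i, dual D D₀ (x i) (z i)) 2 (stdNormal n) := by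
  refine memLp_prod (fun _ => continuous_dual _ _ _) fun i => ?_
  obtain ⟨C, hC, q, -, hq⟩ := exists_integral_dual_sq h₀ h
  refine not_imp_comm.1 integral_undef ?_
  rw [hq]
  positivity

/-- The element of `L²` given by `featureFun`. -/
def featureLp {n : ℕ} (D D₀ : ℝ) (β : Fin n →₀ ℕ) (a : Pt n) : Lp ℝ 2 (stdNormal n) :=
  (memLp_featureFun D D₀ β a).toLp

open scoped InnerProductSpace

theorem inner_toLp {α : Type*} [MeasurableSpace α] {μ : Measure α} {f g : α → ℝ} (hf : MemLp f 2 μ)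
    (hg : MemLp g 2 μ) : ⟪hf.toLp, hg.toLp⟫_ℝ = ∫ z, f z * g z ∂μ := by
  rw [L2.inner_def]
  refine integral_congr_ae ?_
  filter_upwards [hf.coeFn_toLp, hg.coeFn_toLp] with z h1 h2
  rw [h1, h2]
  simp [mul_comm]

theorem coeFn_sum_smul_toLp {α ι : Type*} [MeasurableSpace α] {μ : Measure α} (s : Finset ι)
    (c : ι → ℝ) {f : ι → α → ℝ} (hf : ∀ i, MemLp (f i) 2 μ) :
    ⇑(∑ i ∈ s, c i • (hf i).toLp) =ᵐ[μ] fun z => ∑ i ∈ s, c i * f i z := by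
  classical
  induction s using Finset.induction_on with
  | empty => simpa using! Lp.coeFn_zero ℝ 2 μ
  | insert i s hi ih =>
    rw [Finset.sum_insert hi]
    filter_upwards [Lp.coeFn_add (c i • (hf i).toLp) (∑ i ∈ s, c i • (hf i).toLp),
      Lp.coeFn_smul (c i) (hf i).toLp, (hf i).coeFn_toLp, ih] with z h1 h2 h3 h4
    rw [h1, Pi.add_apply, h2, Pi.smul_apply, h3, h4, Finset.sum_insert hi, smul_eq_mul]

/-- The matrix of the local systems is a Gram matrix. -/
theorem inner_featureLp {n : ℕ} {D D₀ : ℝ} (hD : 0 ≤ D) (hD₀ : D₀ ≠ 0) (β γ : Fin n →₀ ℕ)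
    (a b : Pt n) : ⟪featureLp D D₀ β a, featureLp D D₀ γ b⟫_ℝ = calC D D₀ β γ a b := by
  rw [featureLp, featureLp, inner_toLp, calC_eq_prod]
  simp_rw [featureFun, ← Finset.prod_mul_distrib]
  rw [integral_fintype_prod_eq_prod fun i z =>
    sFeature D D₀ (β i) (a i) z * sFeature D D₀ (γ i) (b i) z]
  simp_rw [calC₁_eq_integral hD hD₀]

/-- Evaluation at `x` of polynomials times Gaussians is given by a vector of `L²`, whose norm decays
like a Gaussian in `x`. -/
theorem exists_evaluation_vector (n : ℕ) {D D₀ : ℝ} (h₀ : 0 < D₀) (h : D₀ < D) :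
    ∃ C > 0, ∃ q > 0, ∀ x : Pt n, ∃ ψ : Lp ℝ 2 (stdNormal n),
      ‖ψ‖ ≤ C * Real.exp (-q * ‖x‖ ^ 2) ∧ ∀ β a, ⟪featureLp D D₀ β a, ψ⟫_ℝ =
        (∏ i, ((x i - a i) / Real.sqrt D) ^ β i) * Real.exp (-‖x - a‖ ^ 2 / D) := by
  obtain ⟨C, hC, q, hq, hnorm⟩ := exists_integral_dual_sq h₀ h
  refine ⟨Real.sqrt (C ^ n), by positivity, q / 2, by positivity, fun x =>
    ⟨(memLp_dual h₀ h x).toLp, ?_, fun β a => ?_⟩⟩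
  · have h1 : ‖(memLp_dual h₀ h x).toLp‖ ^ 2 = C ^ n * Real.exp (-q * ‖x‖ ^ 2) := by
      rw [← real_inner_self_eq_norm_sq, inner_toLp]
      simp_rw [← sq, ← Finset.prod_pow]
      rw [integral_fintype_prod_eq_prod (fun i z => dual D D₀ (x i) z ^ 2)]
      simp_rw [hnorm]
      rw [Finset.prod_mul_distrib, ← Real.exp_sum, ← Finset.mul_sum, EuclideanSpace.real_norm_sq_eq]
      simp
    refine le_of_sq_le_sq ?_ (by positivity)
    rw [h1, mul_pow, Real.sq_sqrt (by positivity), ← Real.exp_nat_mul]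
    refine le_of_eq ?_
    congr 2
    push_cast; ring
  · rw [featureLp, inner_toLp]
    simp_rw [featureFun, ← Finset.prod_mul_distrib]
    rw [integral_fintype_prod_eq_prod fun i z => sFeature D D₀ (β i) (a i) z * dual D D₀ (x i) z]
    simp_rw [integral_sFeature_mul_dual h₀ h]
    rw [Finset.prod_mul_distrib, ← Real.exp_sum, EuclideanSpace.real_norm_sq_eq, ← Finset.sum_div,
      Finset.sum_neg_distrib]
    rfl

instance : (gaussianReal 0 1).IsOpenPosMeasure :=
  (gaussianReal_absolutelyContinuous' 0 one_ne_zero).isOpenPosMeasure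

theorem featureFun_eq {n : ℕ} (D D₀ : ℝ) (β : Fin n →₀ ℕ) (a : Pt n) (z : Fin n → ℝ) :
    featureFun D D₀ β a z = (∏ i, (sFeaturePoly D D₀ (β i)).eval (slope D D₀ (a i) (z i))) *
      (Real.exp (-‖a‖ ^ 2 / D₀) * Real.exp (Real.sqrt D / D₀ * ∑ i, a i * z i)) := by
  unfold featureFun sFeature feature
  rw [Finset.prod_mul_distrib, ← Real.exp_sum, ← Real.exp_add, EuclideanSpace.real_norm_sq_eq,
    Finset.mul_sum, ← Finset.sum_neg_distrib, Finset.sum_div, ← Finset.sum_add_distrib]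
  simp only [mul_assoc]

/-- The features `𝒮_β(-√D ∂_a)` at different points `a` are linearly independent in `L²`. -/
theorem eq_zero_of_sum_featureLp_eq_zero {n : ℕ} {D D₀ : ℝ} (hD : 0 < D) (h₀ : 0 < D₀)
    (A : Finset (Pt n)) (T : Finset (Fin n →₀ ℕ)) (c : Pt n → (Fin n →₀ ℕ) → ℝ)
    (h : ∑ a ∈ A, ∑ β ∈ T, c a β • featureLp D D₀ β a = 0) : ∀ a ∈ A, ∀ β ∈ T, c a β = 0 := by
  have hl : 0 < Real.sqrt D / D₀ := div_pos (Real.sqrt_pos.2 hD) h₀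
  -- the linear relation holds almost everywhere, hence everywhere
  have h1 : ∀ z, ∑ a ∈ A, ∑ β ∈ T, c a β * featureFun D D₀ β a z = 0 := by
    have hmem : MemLp (fun z => ∑ a ∈ A, ∑ β ∈ T, c a β * featureFun D D₀ β a z) 2
        (stdNormal n) := memLp_finsetSum _ fun a _ => memLp_finsetSum _ fun β _ =>
          (memLp_featureFun D D₀ β a).const_mul _
    have hcont : Continuous fun z => ∑ a ∈ A, ∑ β ∈ T, c a β * featureFun D D₀ β a z := by
      refine continuous_finsetSum _ fun a _ => continuous_finsetSum _ fun β _ =>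
        continuous_const.mul (continuous_finsetProd _ fun i _ =>
          (continuous_sFeature D D₀ _ _).comp (continuous_apply i))
    have hae : (fun z => ∑ a ∈ A, ∑ β ∈ T, c a β * featureFun D D₀ β a z) =ᵐ[stdNormal n]
        fun _ => 0 := by
      have := coeFn_sum_smul_toLp (A ×ˢ T) (fun p => c p.1 p.2)
        fun p => memLp_featureFun D D₀ p.2 p.1
      rw [Finset.sum_product, show ∑ a ∈ A, ∑ β ∈ T, c a β • (memLp_featureFun D D₀ β a).toLp = 0
        from h] at this
      simp_rw [Finset.sum_product] at this
      exact this.symm.trans (Lp.coeFn_zero _ _ _)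
    exact fun z => congrFun (Continuous.ae_eq_iff_eq _ hcont continuous_const |>.1 hae) z
  intro a ha
  have h2 : ∀ z : Fin n → ℝ,
      (∑ β ∈ T, c a β * ∏ i, (sFeaturePoly D D₀ (β i)).eval (slope D D₀ (a i) (z i))) *
      Real.exp (-‖a‖ ^ 2 / D₀) = 0 := by
    refine eq_zero_of_sum_mul_exp_eq_zero hl A (F := fun a z => (∑ β ∈ T, c a β *
      ∏ i, (sFeaturePoly D D₀ (β i)).eval (slope D D₀ (a i) (z i))) * Real.exp (-‖a‖ ^ 2 / D₀))
      (fun a z w => ?_) (fun z => ?_) a ha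
    · refine ⟨(∑ β ∈ T, Polynomial.C (c a β) * ∏ i, (sFeaturePoly D D₀ (β i)).comp
        (Polynomial.C (slope D D₀ (a i) (z i)) + Polynomial.C (Real.sqrt D / D₀ * w i) *
          Polynomial.X)) * Polynomial.C (Real.exp (-‖a‖ ^ 2 / D₀)), fun t => ?_⟩
      simp only [Polynomial.eval_mul, Polynomial.eval_finsetSum, Polynomial.eval_C,
        Polynomial.eval_prod, Polynomial.eval_comp, Polynomial.eval_add, Polynomial.eval_X]
      congr 1
      refine Finset.sum_congr rfl fun β _ => ?_
      congr 1
      refine Finset.prod_congr rfl fun i _ => ?_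
      congr 1
      unfold slope
      ring
    · rw [← h1 z]
      refine Finset.sum_congr rfl fun a _ => ?_
      rw [Finset.sum_mul, Finset.sum_mul]
      refine Finset.sum_congr rfl fun β _ => ?_
      rw [featureFun_eq]
      ring
  refine eq_zero_of_sum_prod_eval_eq_zero (degree_sFeaturePoly hD D₀) fun v => ?_
  -- every vector `v` is a vector of slopes
  have h3 := h2 fun i => (v i + 2 * a i / D₀) / (Real.sqrt D / D₀)
  have h4 := (mul_eq_zero.1 h3).resolve_right (Real.exp_pos _).ne'
  have h5 : ∀ i, slope D D₀ (a i) ((v i + 2 * a i / D₀) / (Real.sqrt D / D₀)) = v i := by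
    intro i
    rw [slope, mul_div_cancel₀ _ hl.ne', add_sub_cancel_right]
  simpa only [h5] using h4

end GaussPU

namespace GaussPU
open MeasureTheory ProbabilityTheory Filter Topology
open scoped InnerProductSpace

/-! ### The local systems -/

theorem mem_multiIdx {n L : ℕ} {β : Fin n →₀ ℕ} : β ∈ multiIdx n L ↔ β.degree ≤ L := by
  simp [multiIdx, Finsupp.degree_eq_sum]

/-- The combination `∑_{a ∈ Σ} ∑_{|β| ≤ L} c_{a,β} 𝒮_β(-√D ∂) feature((a - g)/h)` in `L²`. -/
def combo {n : ℕ} (D D₀ : ℝ) (L : ℕ) (h : ℝ) (g : Pt n) (Sig : Finset (Pt n))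
    (c : Pt n → (Fin n →₀ ℕ) → ℝ) : Lp ℝ 2 (stdNormal n) :=
  ∑ a ∈ Sig, ∑ β ∈ multiIdx n L, c a β • featureLp D D₀ β (h⁻¹ • (a - g))

theorem combo_sub {n : ℕ} (D D₀ : ℝ) (L : ℕ) (h : ℝ) (g : Pt n) (Sig : Finset (Pt n))
    (c c' : Pt n → (Fin n →₀ ℕ) → ℝ) : combo D D₀ L h g Sig (c - c') =
      combo D D₀ L h g Sig c - combo D D₀ L h g Sig c' := by
  simp [combo, sub_smul, Finset.sum_sub_distrib]

theorem inner_combo {n : ℕ} (D D₀ : ℝ) (L : ℕ) (h : ℝ) (g : Pt n) (Sig : Finset (Pt n))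
    (c : Pt n → (Fin n →₀ ℕ) → ℝ) (v : Lp ℝ 2 (stdNormal n)) : ⟪combo D D₀ L h g Sig c, v⟫_ℝ =
      ∑ a ∈ Sig, ∑ β ∈ multiIdx n L, ⟪featureLp D D₀ β (h⁻¹ • (a - g)), v⟫_ℝ * c a β := by
  simp_rw [combo, sum_inner, real_inner_smul_left, mul_comm]

/-- The local systems are the normal equations of the least squares approximation, in `L²`, of the
feature at the origin by the features at the scaled nodes. -/
theorem solvesLocal_iff {n : ℕ} {D D₀ : ℝ} (hD : 0 ≤ D) (hD₀ : D₀ ≠ 0) (L : ℕ) (h : ℝ) (g : Pt n)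
    (Sig : Finset (Pt n)) (c : Pt n → (Fin n →₀ ℕ) → ℝ) :
    SolvesLocal D D₀ L h g Sig c ↔ (∀ a β, ¬ (a ∈ Sig ∧ β ∈ multiIdx n L) → c a β = 0) ∧
      ∀ c', ⟪featureLp D D₀ 0 0 - combo D D₀ L h g Sig c, combo D D₀ L h g Sig c'⟫_ℝ = 0 := by
  classical
  refine and_congr_right fun _ => ?_
  have h1 : ∀ b γ, (∑ a ∈ Sig, ∑ β ∈ multiIdx n L,
      calC D D₀ β γ (h⁻¹ • (a - g)) (h⁻¹ • (b - g)) * c a β = calC D D₀ 0 γ 0 (h⁻¹ • (b - g))) ↔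
      ⟪featureLp D D₀ γ (h⁻¹ • (b - g)), featureLp D D₀ 0 0 - combo D D₀ L h g Sig c⟫_ℝ = 0 := by
    intro b γ
    rw [real_inner_comm, inner_sub_left, inner_combo]
    simp_rw [inner_featureLp hD hD₀]
    rw [sub_eq_zero, eq_comm]
  simp_rw [h1]
  constructor
  · intro hb c'
    rw [real_inner_comm, inner_combo]
    exact Finset.sum_eq_zero fun b hbS => Finset.sum_eq_zero fun γ hγ => by
      rw [hb b hbS γ hγ, zero_mul]
  · intro hc b hb γ hγ
    have := hc fun a β => if a = b ∧ β = γ then 1 else 0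
    rw [real_inner_comm, inner_combo, Finset.sum_eq_single_of_mem b hb,
      Finset.sum_eq_single_of_mem γ hγ] at this
    · simpa using this
    · intro β _ hne; simp [hne]
    · intro a _ hne; simp [hne]

theorem eq_zero_of_combo_eq_zero {n : ℕ} {D D₀ : ℝ} (hD : 0 < D) (h₀ : 0 < D₀) {L : ℕ} {h : ℝ}
    (hh : 0 < h) {g : Pt n} {Sig : Finset (Pt n)} {c : Pt n → (Fin n →₀ ℕ) → ℝ}
    (hc : combo D D₀ L h g Sig c = 0) : ∀ a ∈ Sig, ∀ β ∈ multiIdx n L, c a β = 0 := by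
  classical
  have hinv : ∀ a : Pt n, h • (h⁻¹ • (a - g)) + g = a := by
    intro a
    rw [smul_inv_smul₀ hh.ne', sub_add_cancel]
  have hinj : Function.Injective fun a : Pt n => h⁻¹ • (a - g) := fun a b hab => by
    rw [← hinv a, ← hinv b]; exact congrArg (fun y => h • y + g) hab
  have h1 := eq_zero_of_sum_featureLp_eq_zero hD h₀ (Sig.image fun a => h⁻¹ • (a - g))
    (multiIdx n L) (fun y => c (h • y + g)) (by
      rw [Finset.sum_image hinj.injOn]
      simp only [hinv]
      exact hc)
  intro a ha β hβ
  have := h1 _ (Finset.mem_image_of_mem _ ha) β hβ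
  rwa [hinv] at this

theorem combo_congr {n : ℕ} (D D₀ : ℝ) {L : ℕ} (h : ℝ) (g : Pt n) {Sig : Finset (Pt n)}
    {c c' : Pt n → (Fin n →₀ ℕ) → ℝ} (hc : ∀ a ∈ Sig, ∀ β ∈ multiIdx n L, c a β = c' a β) :
    combo D D₀ L h g Sig c = combo D D₀ L h g Sig c' :=
  Finset.sum_congr rfl fun a ha => Finset.sum_congr rfl fun β hβ => by rw [hc a ha β hβ]

/-- The solution consists of the coordinates of the orthogonal projection of the feature at the
origin to the span of the linearly independent features at the scaled nodes. -/
theorem existsUnique_solvesLocal {n : ℕ} {D D₀ : ℝ} (hD : 0 < D) (h₀ : 0 < D₀) (L : ℕ) {h : ℝ}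
    (hh : 0 < h) (g : Pt n) (Sig : Finset (Pt n)) : ∃! c, SolvesLocal D D₀ L h g Sig c := by
  classical
  simp_rw [solvesLocal_iff hD.le h₀.ne']
  let u : Pt n × (Fin n →₀ ℕ) → Lp ℝ 2 (stdNormal n) := fun p =>
    featureLp D D₀ p.2 (h⁻¹ • (p.1 - g))
  let K := Submodule.span ℝ (u '' (Sig ×ˢ multiIdx n L : Finset _))
  have hfin : FiniteDimensional ℝ K :=
    FiniteDimensional.span_of_finite ℝ ((Finset.finite_toSet _).image _)
  have hmemK : ∀ c, combo D D₀ L h g Sig c ∈ K := fun c =>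
    Submodule.sum_mem _ fun a ha => Submodule.sum_mem _ fun β hβ => Submodule.smul_mem _ _
      (Submodule.subset_span ⟨(a, β), Finset.mem_coe.2 (Finset.mem_product.2 ⟨ha, hβ⟩), rfl⟩)
  obtain ⟨c, hc⟩ := (Submodule.mem_span_image_finset_iff_exists_fun' ℝ).1
    (K.starProjection_apply_mem (featureLp D D₀ 0 0))
  let c' : Pt n → (Fin n →₀ ℕ) → ℝ := fun a β =>
    if a ∈ Sig ∧ β ∈ multiIdx n L then c (a, β) else 0
  have hc' : combo D D₀ L h g Sig c' = K.starProjection (featureLp D D₀ 0 0) := by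
    rw [← hc, Finset.sum_product]
    exact combo_congr D D₀ h g fun a ha β hβ => by simp [c', ha, hβ]
  refine ⟨c', ⟨fun a β hab => by simp only [c', if_neg hab], fun c'' => ?_⟩, ?_⟩
  · rw [hc', real_inner_comm]
    exact (K.sub_starProjection_mem_orthogonal _) _ (hmemK c'')
  · rintro d ⟨hd0, hd⟩
    have h1 : combo D D₀ L h g Sig (d - c') = 0 := by
      have e1 := hd (d - c')
      have e2 := (K.sub_starProjection_mem_orthogonal (featureLp D D₀ 0 0)) _ (hmemK (d - c'))
      rw [real_inner_comm, ← hc'] at e2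
      rw [← inner_self_eq_zero (𝕜 := ℝ)]
      nth_rewrite 1 [combo_sub]
      rw [← sub_sub_sub_cancel_left, inner_sub_left, e1, e2, sub_zero]
    have h2 := eq_zero_of_combo_eq_zero hD h₀ hh h1
    funext a β
    by_cases hab : a ∈ Sig ∧ β ∈ multiIdx n L
    · exact sub_eq_zero.1 (h2 a hab.1 β hab.2)
    · rw [hd0 a β hab]; simp only [c', if_neg hab]

/-- The solution of a local system is optimal among all coefficients. -/
theorem SolvesLocal.norm_sub_combo_le {n : ℕ} {D D₀ : ℝ} (hD : 0 ≤ D) (hD₀ : D₀ ≠ 0) {L : ℕ} {h : ℝ}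
    {g : Pt n} {Sig : Finset (Pt n)} {c : Pt n → (Fin n →₀ ℕ) → ℝ}
    (hc : SolvesLocal D D₀ L h g Sig c) (c' : Pt n → (Fin n →₀ ℕ) → ℝ) :
    ‖featureLp D D₀ 0 0 - combo D D₀ L h g Sig c‖ ≤
      ‖featureLp D D₀ 0 0 - combo D D₀ L h g Sig c'‖ := by
  have h1 := ((solvesLocal_iff hD hD₀ L h g Sig c).1 hc).2 (c - c')
  have h2 := norm_add_sq_eq_norm_sq_add_norm_sq_real h1
  rw [combo_sub, sub_add_sub_cancel] at h2
  refine le_of_sq_le_sq ?_ (norm_nonneg _)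
  nlinarith [norm_nonneg (combo D D₀ L h g Sig c - combo D D₀ L h g Sig c')]

/-- The difference between a Gaussian and its approximation from the nodes is an inner product
with the residual of the least squares problem. -/
theorem inner_sub_combo_evaluation {n : ℕ} {D D₀ h : ℝ} (hh : 0 < h) (L : ℕ) (g x : Pt n)
    (Sig : Finset (Pt n)) (c : Pt n → (Fin n →₀ ℕ) → ℝ) {ψ : Lp ℝ 2 (stdNormal n)}
    (hψ : ∀ β a, ⟪featureLp D D₀ β a, ψ⟫_ℝ =
        (∏ i, (((h⁻¹ • (x - g)) i - a i) / Real.sqrt D) ^ β i) *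
          Real.exp (-‖h⁻¹ • (x - g) - a‖ ^ 2 / D)) :
    ⟪featureLp D D₀ 0 0 - combo D D₀ L h g Sig c, ψ⟫_ℝ =
      Real.exp (-‖x - g‖ ^ 2 / (h ^ 2 * D)) - gridTerm D h L Sig c x := by
  have hn : ∀ y : Pt n, -‖h⁻¹ • y‖ ^ 2 / D = -‖y‖ ^ 2 / (h ^ 2 * D) := by
    intro y
    rw [norm_smul, norm_inv, Real.norm_eq_abs, abs_of_pos hh]
    field_simp
  rw [inner_sub_left, inner_combo, hψ, sub_zero, hn]
  congr 1
  · simp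
  · unfold gridTerm gaussTerm polyOf
    refine Finset.sum_congr rfl fun a _ => ?_
    rw [map_sum, Finset.sum_mul]
    refine Finset.sum_congr rfl fun β _ => ?_
    have e1 : h⁻¹ • (x - g) - h⁻¹ • (a - g) = h⁻¹ • (x - a) := by
      rw [← smul_sub]; congr 1; abel
    rw [hψ, e1, hn, MvPolynomial.eval_monomial, Finsupp.prod_fintype _ _ (by simp)]
    have e2 : ∀ i, ((h⁻¹ • (x - g)) i - (h⁻¹ • (a - g)) i) / Real.sqrt D =
        (x i - a i) / (h * Real.sqrt D) := by
      intro i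
      simp only [PiLp.smul_apply, PiLp.sub_apply, smul_eq_mul]
      field_simp
      ring
    simp_rw [e2]
    ring

end GaussPU

namespace GaussPU
open MeasureTheory ProbabilityTheory Filter Topology
open scoped InnerProductSpace

/-! ### Approximation of the constant feature from a nearby node -/

theorem exists_pow_eq_sum_eval {q : ℕ → Polynomial ℝ} (hq : ∀ b, (q b).degree = b) (k : ℕ) :
    ∃ t : ℕ → ℝ, ∀ v : ℝ, v ^ k = ∑ b ∈ Finset.range (k + 1), t b * (q b).eval v := by
  have key : ∀ k : ℕ, ∀ P : Polynomial ℝ, P.degree < k →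
      ∃ t : ℕ → ℝ, ∀ v : ℝ, P.eval v = ∑ b ∈ Finset.range k, t b * (q b).eval v := by
    intro k
    induction k with
    | zero =>
      intro P hP
      refine ⟨0, fun v => ?_⟩
      rw [Polynomial.degree_lt_iff_coeff_zero] at hP
      have : P = 0 := by ext m; simpa using hP m (Nat.zero_le m)
      simp [this]
    | succ k ih =>
      intro P hP
      have hlead : (q k).coeff k ≠ 0 := Polynomial.coeff_ne_zero_of_eq_degree (hq k)
      rw [Polynomial.degree_lt_iff_coeff_zero] at hP
      obtain ⟨t, ht⟩ := ih (P - Polynomial.C (P.coeff k / (q k).coeff k) * q k) (by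
        rw [Polynomial.degree_lt_iff_coeff_zero]
        intro m hm
        rw [Polynomial.coeff_sub, Polynomial.coeff_C_mul]
        rcases hm.eq_or_lt with rfl | hm
        · rw [div_mul_cancel₀ _ hlead, sub_self]
        · have h0 : (q k).coeff m = 0 :=
            Polynomial.coeff_eq_zero_of_degree_lt (by rw [hq]; exact Nat.cast_lt.2 hm)
          rw [hP m hm, h0, mul_zero, sub_zero])
      refine ⟨fun b => if b = k then P.coeff k / (q k).coeff k else t b, fun v => ?_⟩
      have h1 := ht v
      rw [Polynomial.eval_sub, Polynomial.eval_mul, Polynomial.eval_C, sub_eq_iff_eq_add] at h1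
      rw [Finset.sum_range_succ, h1]
      simp only [if_true]
      congr 1
      refine Finset.sum_congr rfl fun b hb => ?_
      rw [if_neg (Finset.mem_range.1 hb).ne]
  obtain ⟨t, ht⟩ := key (k + 1) (Polynomial.X ^ k)
    (by rw [Polynomial.degree_X_pow]; exact Nat.cast_lt.2 k.lt_succ_self)
  exact ⟨t, fun v => by simpa using ht v⟩

/-- Products of polynomials of one variable, one polynomial of each degree, span the polynomials of
several variables, compatibly with the total degree. -/
theorem exists_eval_eq_sum_prod {n L : ℕ} {q : ℕ → Polynomial ℝ} (hq : ∀ b, (q b).degree = b)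
    (P : MvPolynomial (Fin n) ℝ) (hP : P.totalDegree ≤ L) :
    ∃ c : (Fin n →₀ ℕ) → ℝ, ∀ v : Fin n → ℝ,
      MvPolynomial.eval v P = ∑ β ∈ multiIdx n L, c β * ∏ i, (q (β i)).eval (v i) := by
  let u : (Fin n →₀ ℕ) → (Fin n → ℝ) → ℝ := fun β v => ∏ i, (q (β i)).eval (v i)
  have hmem : (fun v => MvPolynomial.eval v P) ∈
      Submodule.span ℝ (u '' (multiIdx n L : Set _)) := by
    choose t ht using fun k => exists_pow_eq_sum_eval hq k
    have h1 : (fun v => MvPolynomial.eval v P) = ∑ m ∈ P.support, P.coeff m •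
        ∑ e ∈ Fintype.piFinset fun i => Finset.range (m i + 1), (∏ i, t (m i) (e i)) •
          u (Finsupp.equivFunOnFinite.symm e) := by
      funext v
      rw [MvPolynomial.eval_eq', Finset.sum_apply]
      refine Finset.sum_congr rfl fun m _ => ?_
      rw [Finset.prod_congr rfl fun i _ => ht (m i) (v i), Finset.prod_univ_sum, Pi.smul_apply,
        Finset.sum_apply, smul_eq_mul]
      simp only [Finset.prod_mul_distrib, Pi.smul_apply, smul_eq_mul, u,
        Finsupp.equivFunOnFinite_symm_apply_apply]
    rw [h1]
    refine Submodule.sum_mem _ fun m hm => Submodule.smul_mem _ _ (Submodule.sum_mem _ fun e he =>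
      Submodule.smul_mem _ _ (Submodule.subset_span ⟨_, ?_, rfl⟩))
    rw [Finset.mem_coe, mem_multiIdx, Finsupp.degree_eq_sum]
    have h2 := (MvPolynomial.le_totalDegree hm).trans hP
    rw [Finsupp.sum_fintype _ _ (by simp)] at h2
    refine (Finset.sum_le_sum fun i _ => ?_).trans h2
    have := Finset.mem_range.1 (Fintype.mem_piFinset.1 he i)
    simpa using Nat.lt_succ_iff.1 this
  obtain ⟨c, hc⟩ := (Submodule.mem_span_image_finset_iff_exists_fun' ℝ).1 hmem
  refine ⟨c, fun v => ?_⟩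
  have := congrFun hc v
  rw [Finset.sum_apply] at this
  exact this.symm

/-- The remainder of the exponential series. -/
def expTail (N : ℕ) (y : ℝ) : ℝ := Real.exp y - ∑ k ∈ Finset.range N, y ^ k / k.factorial

theorem hasSum_exp (y : ℝ) : HasSum (fun k : ℕ => y ^ k / k.factorial) (Real.exp y) := by
  rw [Real.exp_eq_exp_ℝ]
  exact NormedSpace.expSeries_div_hasSum_exp y

theorem hasSum_expTail (N : ℕ) (y : ℝ) :
    HasSum (fun k : ℕ => y ^ (k + N) / (k + N).factorial) (expTail N y) :=
  (hasSum_nat_add_iff' N).2 (hasSum_exp y)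

theorem expTail_nonneg (N : ℕ) {y : ℝ} (hy : 0 ≤ y) : 0 ≤ expTail N y :=
  (hasSum_expTail N y).nonneg fun k => by positivity

theorem expTail_mono (N : ℕ) {y y' : ℝ} (hy : 0 ≤ y) (h : y ≤ y') : expTail N y ≤ expTail N y' :=
  hasSum_le (fun k => by gcongr) (hasSum_expTail N y) (hasSum_expTail N y')

theorem expTail_le_exp (N : ℕ) {y : ℝ} (hy : 0 ≤ y) : expTail N y ≤ Real.exp y :=
  sub_le_self _ (Finset.sum_nonneg fun k _ => by positivity)

theorem tendsto_expTail (y : ℝ) : Tendsto (fun N => expTail N y) atTop (𝓝 0) := by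
  have := (hasSum_exp y).tendsto_sum_nat.const_sub (Real.exp y)
  rwa [sub_self] at this

theorem abs_exp_sub_sum_le_expTail (N : ℕ) {x y : ℝ} (h : |x| ≤ y) :
    |Real.exp x - ∑ k ∈ Finset.range N, x ^ k / k.factorial| ≤ expTail N y := by
  refine le_trans ?_ (expTail_mono N (abs_nonneg x) h)
  have := Complex.norm_exp_sub_sum_le_exp_norm_sub_sum x N
  rw [Complex.norm_real, Real.norm_eq_abs] at this
  refine le_trans (le_of_eq ?_) this
  rw [← Real.norm_eq_abs, ← Complex.norm_real]
  push_cast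
  rfl

/-- The constant feature (at the origin) is approximated, up to a function that does not depend on
the node `a` near the origin, by the features at `a`. The feature at `a` is a Gaussian factor times
`e^y`, with `y` linear in the slopes, so that `1 = e^y e^{-y}` and the Taylor polynomial of `e^{-y}`
give the approximation. -/
theorem exists_abs_featureFun_sub_le {n : ℕ} {D D₀ : ℝ} (hD : 0 < D) (h₀ : 0 < D₀) {κ : ℝ}
    (L : ℕ) {a : Pt n} (ha : ‖a‖ ≤ κ) :
    ∃ c : (Fin n →₀ ℕ) → ℝ, ∀ z : Fin n → ℝ,
      |featureFun D D₀ 0 0 z - ∑ β ∈ multiIdx n L, c β * featureFun D D₀ β a z| ≤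
        Real.exp (κ * (Real.sqrt D / D₀) * ∑ i, |z i| + 2 * κ ^ 2 / D₀) *
          expTail (L + 1) (κ * (Real.sqrt D / D₀) * ∑ i, |z i| + 2 * κ ^ 2 / D₀) := by
  have hl : 0 < Real.sqrt D / D₀ := div_pos (Real.sqrt_pos.2 hD) h₀
  set l := Real.sqrt D / D₀ with hldef
  have hκ : 0 ≤ κ := (norm_nonneg a).trans ha
  -- the truncated exponential series, as a polynomial in the slopes
  let Y : MvPolynomial (Fin n) ℝ := ∑ i, MvPolynomial.C (-a i) * MvPolynomial.X i
  let P : MvPolynomial (Fin n) ℝ := MvPolynomial.C (Real.exp (-‖a‖ ^ 2 / D₀)) *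
    ∑ k ∈ Finset.range (L + 1), MvPolynomial.C ((k.factorial : ℝ)⁻¹) * Y ^ k
  have hCmul : ∀ (r : ℝ) (Q : MvPolynomial (Fin n) ℝ),
      (MvPolynomial.C r * Q).totalDegree ≤ Q.totalDegree := by
    intro r Q
    rw [← MvPolynomial.smul_eq_C_mul]
    exact MvPolynomial.totalDegree_smul_le _ _
  have hY : Y.totalDegree ≤ 1 := MvPolynomial.totalDegree_finsetSum_le fun i _ =>
    (hCmul _ _).trans (MvPolynomial.totalDegree_X i).le
  have hP : P.totalDegree ≤ L := by
    refine (hCmul _ _).trans (MvPolynomial.totalDegree_finsetSum_le fun k hk => ?_)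
    refine (hCmul _ _).trans ((MvPolynomial.totalDegree_pow _ _).trans ?_)
    have := Finset.mem_range.1 hk
    nlinarith
  obtain ⟨c, hc⟩ := exists_eval_eq_sum_prod (degree_sFeaturePoly hD D₀) P hP
  refine ⟨c, fun z => ?_⟩
  set w := ∑ i, a i * z i with hw
  set y := ∑ i, a i * slope D D₀ (a i) (z i) with hy
  have hyw : y = l * w - 2 * ‖a‖ ^ 2 / D₀ := by
    rw [hy, hw, EuclideanSpace.real_norm_sq_eq, Finset.mul_sum, Finset.mul_sum, Finset.sum_div,
      ← Finset.sum_sub_distrib]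
    refine Finset.sum_congr rfl fun i _ => ?_
    rw [slope, ← hldef]; ring
  have h1 : ∑ β ∈ multiIdx n L, c β * featureFun D D₀ β a z =
      Real.exp y * ∑ k ∈ Finset.range (L + 1), (-y) ^ k / k.factorial := by
    simp_rw [featureFun_eq, ← mul_assoc]
    rw [← Finset.sum_mul, ← Finset.sum_mul, ← hc]
    have e1 : MvPolynomial.eval (fun i => slope D D₀ (a i) (z i)) P = Real.exp (-‖a‖ ^ 2 / D₀) *
        ∑ k ∈ Finset.range (L + 1), (-y) ^ k / k.factorial := by
      simp only [P, Y, map_mul, MvPolynomial.eval_C, map_sum, map_pow, MvPolynomial.eval_X]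
      congr 1
      refine Finset.sum_congr rfl fun k _ => ?_
      rw [hy, ← Finset.sum_neg_distrib, div_eq_inv_mul]
      simp only [neg_mul]
    have e2 : Real.exp y = Real.exp (-‖a‖ ^ 2 / D₀) * Real.exp (-‖a‖ ^ 2 / D₀) *
        Real.exp (l * w) := by
      rw [← Real.exp_add, ← Real.exp_add, hyw]
      congr 1; ring
    rw [e1, e2]
    ring
  have h0 : featureFun D D₀ 0 0 z = 1 := by
    have e1 : sFeaturePoly D D₀ 0 = 1 := by
      rw [sFeaturePoly, sPoly, ← Polynomial.C_1, Polynomial.sum_C_index (by simp)]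
      simp [featurePoly]
    rw [featureFun_eq]
    simp [e1]
  have hyb : |y| ≤ κ * l * ∑ i, |z i| + 2 * κ ^ 2 / D₀ := by
    have e1 : |w| ≤ κ * ∑ i, |z i| := by
      rw [hw, Finset.mul_sum]
      refine (Finset.abs_sum_le_sum_abs _ _).trans (Finset.sum_le_sum fun i _ => ?_)
      rw [abs_mul]
      gcongr
      rw [← Real.norm_eq_abs]
      exact (PiLp.norm_apply_le a i).trans ha
    rw [hyw]
    refine (abs_sub _ _).trans ?_
    rw [abs_mul, abs_of_pos hl, abs_of_nonneg (by positivity : 0 ≤ 2 * ‖a‖ ^ 2 / D₀)]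
    have e2 : 2 * ‖a‖ ^ 2 / D₀ ≤ 2 * κ ^ 2 / D₀ := by gcongr
    nlinarith
  rw [h0, h1]
  have h2 : (1 : ℝ) - Real.exp y * ∑ k ∈ Finset.range (L + 1), (-y) ^ k / k.factorial =
      Real.exp y * (Real.exp (-y) - ∑ k ∈ Finset.range (L + 1), (-y) ^ k / k.factorial) := by
    rw [mul_sub, ← Real.exp_add, add_neg_cancel, Real.exp_zero]
  rw [h2, abs_mul, Real.abs_exp]
  have hYn : 0 ≤ κ * l * ∑ i, |z i| + 2 * κ ^ 2 / D₀ := (abs_nonneg y).trans hyb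
  gcongr
  · exact (le_abs_self y).trans hyb
  · exact abs_exp_sub_sum_le_expTail _ (by rwa [abs_neg])

/-- The degree `L` needed for a given accuracy in `L²` does not depend on the node `a`, as long as
`‖a‖ ≤ κ`. -/
theorem exists_norm_featureLp_sub_le (n : ℕ) {D D₀ : ℝ} (hD : 0 < D) (h₀ : 0 < D₀) (κ : ℝ)
    {η : ℝ} (hη : 0 < η) :
    ∃ Lmin : ℕ, ∀ L ≥ Lmin, ∀ a : Pt n, ‖a‖ ≤ κ → ∃ c : (Fin n →₀ ℕ) → ℝ,
      ‖featureLp D D₀ 0 0 - ∑ β ∈ multiIdx n L, c β • featureLp D D₀ β a‖ ≤ η := by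
  rcases lt_or_ge κ 0 with hκ | hκ
  · exact ⟨0, fun L _ a ha => absurd ((norm_nonneg a).trans ha) (not_le.2 hκ)⟩
  set l := Real.sqrt D / D₀ with hldef
  have hl : 0 < l := div_pos (Real.sqrt_pos.2 hD) h₀
  let Y : (Fin n → ℝ) → ℝ := fun z => κ * l * ∑ i, |z i| + 2 * κ ^ 2 / D₀
  have hY0 : ∀ z, 0 ≤ Y z := fun z => by
    have : 0 ≤ ∑ i, |z i| := Finset.sum_nonneg fun i _ => abs_nonneg _
    positivity
  have hYc : Continuous Y := by fun_prop
  have hFc : ∀ N, Continuous fun z => (Real.exp (Y z) * expTail N (Y z)) ^ 2 := by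
    intro N; unfold expTail; fun_prop
  have hFb : ∀ N z, (Real.exp (Y z) * expTail N (Y z)) ^ 2 ≤ Real.exp (4 * Y z) := by
    intro N z
    have h1 := expTail_le_exp N (hY0 z)
    have h2 := expTail_nonneg N (hY0 z)
    calc (Real.exp (Y z) * expTail N (Y z)) ^ 2 ≤ (Real.exp (Y z) * Real.exp (Y z)) ^ 2 := by gcongr
      _ = _ := by rw [← Real.exp_add, ← Real.exp_nat_mul]; congr 1; push_cast; ring
  have hint : Integrable (fun z => Real.exp (4 * Y z)) (stdNormal n) := by
    have h1 : ∀ z, Real.exp (4 * Y z) = Real.exp (4 * (2 * κ ^ 2 / D₀)) *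
        ∏ i, Real.exp (4 * κ * l * |z i|) := by
      intro z
      rw [← Real.exp_sum, ← Real.exp_add, ← Finset.mul_sum]
      congr 1; simp only [Y]; ring
    simp_rw [h1]
    refine Integrable.const_mul (Integrable.fintype_prod
      (f := fun _ (t : ℝ) => Real.exp (4 * κ * l * |t|)) fun i => ?_) _
    simpa using expIntegrable_one (4 * κ * l)
  have hFint : ∀ N, Integrable (fun z => (Real.exp (Y z) * expTail N (Y z)) ^ 2) (stdNormal n) :=
    fun N => hint.mono' (hFc N).aestronglyMeasurable (.of_forall fun z => by
      rw [Real.norm_eq_abs, abs_of_nonneg (sq_nonneg _)]; exact hFb N z)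
  have hlim : Tendsto (fun N => ∫ z, (Real.exp (Y z) * expTail N (Y z)) ^ 2 ∂stdNormal n) atTop
      (𝓝 (∫ _, 0 ∂stdNormal n)) := by
    refine tendsto_integral_of_dominated_convergence _ (fun N => (hFc N).aestronglyMeasurable) hint
      (fun N => .of_forall fun z => by
        rw [Real.norm_eq_abs, abs_of_nonneg (sq_nonneg _)]; exact hFb N z) (.of_forall fun z => ?_)
    have := ((tendsto_expTail (Y z)).const_mul (Real.exp (Y z))).pow 2
    simpa using this
  rw [integral_zero] at hlim
  obtain ⟨N, hN⟩ := eventually_atTop.1 (hlim.eventually (gt_mem_nhds (by positivity : 0 < η ^ 2)))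
  refine ⟨N, fun L hL a ha => ?_⟩
  obtain ⟨c, hc⟩ := exists_abs_featureFun_sub_le hD h₀ L ha
  refine ⟨c, le_of_sq_le_sq ?_ hη.le⟩
  have hmem : MemLp (fun z => ∑ β ∈ multiIdx n L, c β * featureFun D D₀ β a z) 2 (stdNormal n) :=
    memLp_finsetSum _ fun β _ => (memLp_featureFun D D₀ β a).const_mul _
  have hsum : ∑ β ∈ multiIdx n L, c β • featureLp D D₀ β a = hmem.toLp :=
    Lp.ext ((coeFn_sum_smul_toLp (multiIdx n L) c fun β => memLp_featureFun D D₀ β a).trans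
      hmem.coeFn_toLp.symm)
  rw [hsum, featureLp, ← MemLp.toLp_sub, ← real_inner_self_eq_norm_sq, inner_toLp]
  refine le_trans (integral_mono_of_nonneg (.of_forall fun z => mul_self_nonneg _)
    (hFint (L + 1)) (.of_forall fun z => ?_)) (hN (L + 1) (by omega)).le
  simp only [Pi.sub_apply, ← sq]
  exact sq_le_sq' (by linarith [neg_abs_le (featureFun D D₀ 0 0 z -
    ∑ β ∈ multiIdx n L, c β * featureFun D D₀ β a z), hc z]) ((le_abs_self _).trans (hc z))

/-- The Gaussian attached to a grid point is approximated by its local least squares approximation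
with a small error that decays like a Gaussian: by optimality the residual is at most that of an
approximation from the single nearby node, and the decay comes from the evaluation vector. -/
theorem exists_abs_gridTerm_sub_le (n : ℕ) {D D₀ : ℝ} (h₀ : 0 < D₀) (h : D₀ < D) (κ : ℝ) :
    ∃ q > 0, ∀ η > 0, ∃ Lmin : ℕ, ∀ L ≥ Lmin, ∀ (h : ℝ) (_ : 0 < h) (g : Pt n)
      (Sig : Finset (Pt n)) (c : Pt n → (Fin n →₀ ℕ) → ℝ), SolvesLocal D D₀ L h g Sig c →
      (∃ a ∈ Sig, dist a g < κ * h) → ∀ x,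
        |gridTerm D h L Sig c x - Real.exp (-‖x - g‖ ^ 2 / (h ^ 2 * D))| ≤
          η * Real.exp (-q * ‖h⁻¹ • (x - g)‖ ^ 2) := by
  classical
  have hD : 0 < D := h₀.trans h
  obtain ⟨C, hC, q, hq, hψ⟩ := exists_evaluation_vector n h₀ h
  refine ⟨q, hq, fun η hη => ?_⟩
  obtain ⟨Lmin, hL⟩ := exists_norm_featureLp_sub_le n hD h₀ κ (div_pos hη hC)
  refine ⟨Lmin, fun L hLL h hh g Sig c hc ⟨a, haS, ha⟩ x => ?_⟩
  obtain ⟨ψ, hψn, hψe⟩ := hψ (h⁻¹ • (x - g))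
  obtain ⟨c₀, hc₀⟩ := hL L hLL (h⁻¹ • (a - g)) (by
    rw [norm_smul, norm_inv, Real.norm_eq_abs, abs_of_pos hh, inv_mul_le_iff₀ hh, ← dist_eq_norm,
      mul_comm]
    exact ha.le)
  have h1 := hc.norm_sub_combo_le hD.le h₀.ne' fun b β => if b = a then c₀ β else 0
  have h2 : combo D D₀ L h g Sig (fun b β => if b = a then c₀ β else 0) =
      ∑ β ∈ multiIdx n L, c₀ β • featureLp D D₀ β (h⁻¹ • (a - g)) := by
    rw [combo, Finset.sum_eq_single_of_mem a haS fun b _ hb => by simp [hb]]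
    simp
  rw [h2] at h1
  rw [abs_sub_comm, ← inner_sub_combo_evaluation hh L g x Sig c hψe]
  refine (abs_real_inner_le_norm _ _).trans ?_
  calc _ ≤ (η / C) * (C * Real.exp (-q * ‖h⁻¹ • (x - g)‖ ^ 2)) :=
        mul_le_mul (h1.trans hc₀) hψn (norm_nonneg _) (by positivity)
    _ = _ := by field_simp

end GaussPU

namespace GaussPU
open MeasureTheory ProbabilityTheory Filter Topology

/-! ### Sums of Gaussians over the lattice -/

theorem hasSum_prod_pi {n : ℕ} {f : Fin n → ℤ → ℝ} {s : Fin n → ℝ} (hf : ∀ i k, 0 ≤ f i k)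
    (h : ∀ i, HasSum (f i) (s i)) : HasSum (fun m : Fin n → ℤ => ∏ i, f i (m i)) (∏ i, s i) := by
  induction n with
  | zero => simp
  | succ n ih =>
    have h1 : HasSum (fun m : Fin n → ℤ => ∏ i : Fin n, f i.succ (m i)) (∏ i : Fin n, s i.succ) :=
      ih (f := fun i => f i.succ) (s := fun i => s i.succ) (fun i k => hf i.succ k)
        fun i => h i.succ
    have hn : ∀ m : Fin n → ℤ, 0 ≤ ∏ i : Fin n, f i.succ (m i) := fun m =>
      Finset.prod_nonneg fun i _ => hf i.succ (m i)
    have h2 : HasSum (fun p : ℤ × (Fin n → ℤ) => f 0 p.1 * ∏ i : Fin n, f i.succ (p.2 i))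
        (s 0 * ∏ i : Fin n, s i.succ) :=
      HasSum.mul (f := f 0) (g := fun m : Fin n → ℤ => ∏ i : Fin n, f i.succ (m i)) (h 0) h1
        (Summable.mul_of_nonneg (f := f 0)
        (g := fun m : Fin n → ℤ => ∏ i : Fin n, f i.succ (m i)) (h 0).summable h1.summable
        (fun k => hf 0 k) (fun m => hn m))
    rw [Fin.prod_univ_succ, ← (Fin.consEquiv fun _ => ℤ).hasSum_iff]
    refine h2.congr_fun fun p => ?_
    simp [Fin.consEquiv, Fin.prod_univ_succ]

/-- The sum `2 ∑_{k ≥ 1} e^{-π²k²D}`, which bounds the relative oscillation of the sum of the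
Gaussians `e^{-(t-k)²/D}`, `k ∈ ℤ`. -/
def thetaErr (D : ℝ) : ℝ :=
  ∑' k : ℤ, if k = 0 then 0 else Real.exp (-Real.pi * k ^ 2 * (Real.pi * D))

theorem summable_thetaErr {D : ℝ} (hD : 0 < D) : Summable fun k : ℤ =>
    if k = 0 then 0 else Real.exp (-Real.pi * k ^ 2 * (Real.pi * D)) := by
  have h := (HurwitzZeta.hasSum_int_evenKernel 0 (t := Real.pi * D) (by positivity)).summable
  refine h.of_nonneg_of_le (fun k => by split_ifs <;> positivity) fun k => ?_
  split_ifs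
  · positivity
  · simp

theorem thetaErr_nonneg (D : ℝ) : 0 ≤ thetaErr D :=
  tsum_nonneg fun k => by split_ifs <;> positivity

theorem tendsto_thetaErr : Tendsto thetaErr atTop (𝓝 0) := by
  have h1 : ∀ D ≥ (1 : ℝ), thetaErr D ≤ Real.exp (-Real.pi ^ 2 * (D - 1)) * thetaErr 1 := by
    intro D hD
    rw [thetaErr, thetaErr, ← tsum_mul_left]
    refine (summable_thetaErr (by linarith)).tsum_le_tsum (fun k => ?_)
      ((summable_thetaErr one_pos).mul_left _)
    split_ifs with hk
    · simp
    · rw [← Real.exp_add]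
      refine Real.exp_le_exp.2 ?_
      have hk1 : (1 : ℝ) ≤ (k : ℝ) ^ 2 := by
        have : (1 : ℤ) ≤ k ^ 2 := by have := sq_nonneg k; have := pow_ne_zero 2 hk; omega
        exact_mod_cast this
      have : 0 ≤ Real.pi ^ 2 * ((D - 1) * ((k : ℝ) ^ 2 - 1)) :=
        mul_nonneg (sq_nonneg _) (mul_nonneg (by linarith) (by linarith))
      nlinarith
  have h2 : Tendsto (fun D : ℝ => Real.exp (-Real.pi ^ 2 * (D - 1)) * thetaErr 1) atTop (𝓝 0) := by
    have e1 : Tendsto (fun D : ℝ => -Real.pi ^ 2 * (D - 1)) atTop atBot :=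
      (tendsto_atTop_add_const_right atTop (-1) tendsto_id).const_mul_atTop_of_neg
        (by have := Real.pi_pos; nlinarith)
    simpa using (Real.tendsto_exp_atBot.comp e1).mul_const (thetaErr 1)
  exact squeeze_zero' (.of_forall thetaErr_nonneg) (eventually_atTop.2 ⟨1, h1⟩) h2

/-- Poisson summation in one variable, in the form of the functional equation of Jacobi's theta
function. -/
theorem hasSum_gaussian_int {D : ℝ} (hD : 0 < D) (t : ℝ) :
    ∃ e, |e| ≤ thetaErr D ∧
      HasSum (fun k : ℤ => Real.exp (-(t - k) ^ 2 / D))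
        ((Real.pi * D) ^ (1 / 2 : ℝ) * (1 + e)) := by
  have hx : 0 < Real.pi * D := by positivity
  refine ⟨HurwitzZeta.cosKernel ((-t : ℝ) : UnitAddCircle) (Real.pi * D) - 1, ?_, ?_⟩
  · have h := HurwitzZeta.hasSum_int_cosKernel₀ (-t) hx
    rw [← Real.norm_eq_abs, ← Complex.norm_real]
    push_cast
    rw [← h.tsum_eq]
    refine tsum_of_norm_bounded (summable_thetaErr hD).hasSum fun k => ?_
    split_ifs with hk
    · simp
    · rw [norm_mul]
      have e1 : ‖Complex.exp (2 * Real.pi * Complex.I * ((-t : ℝ) : ℂ) * k)‖ = 1 := by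
        have : (2 * Real.pi * Complex.I * ((-t : ℝ) : ℂ) * k) =
            ((2 * Real.pi * (-t) * k : ℝ) : ℂ) * Complex.I := by push_cast; ring
        rw [this, Complex.norm_exp_ofReal_mul_I]
      rw [e1, one_mul, Complex.norm_real, Real.norm_eq_abs, Real.abs_exp]
  · have h := HurwitzZeta.hasSum_int_evenKernel (-t) (t := 1 / (Real.pi * D)) (by positivity)
    rw [HurwitzZeta.evenKernel_functional_equation, one_div_one_div, one_div (Real.pi * D),
      Real.inv_rpow hx.le, one_div (_⁻¹), inv_inv] at h
    rw [add_sub_cancel]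
    refine h.congr_fun fun k => ?_
    congr 1
    field_simp
    ring

/-- A bound for the relative oscillation of the sum of the Gaussians `e^{-|x-m|²/D}`, `m ∈ ℤⁿ`. -/
def gaussErr (n : ℕ) (D : ℝ) : ℝ := Real.exp (n * thetaErr D) - 1

theorem gaussErr_nonneg (n : ℕ) (D : ℝ) : 0 ≤ gaussErr n D :=
  sub_nonneg.2 (Real.one_le_exp (mul_nonneg (Nat.cast_nonneg n) (thetaErr_nonneg D)))

theorem tendsto_gaussErr (n : ℕ) : Tendsto (gaussErr n) atTop (𝓝 0) := by
  have := (Real.continuous_exp.tendsto _).comp (tendsto_thetaErr.const_mul (n : ℝ))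
  have h2 := this.sub_const 1
  simp only [mul_zero, Real.exp_zero, sub_self] at h2
  exact h2

/-- The sum of the Gaussians over the lattice is almost constant. -/
theorem hasSum_gaussian_lattice {n : ℕ} {D : ℝ} (hD : 0 < D) (x : Pt n) :
    ∃ e, |e| ≤ gaussErr n D ∧ HasSum (fun m : Fin n → ℤ => Real.exp (-‖x - gridPt 1 m‖ ^ 2 / D))
      ((Real.pi * D) ^ ((n : ℝ) / 2) * (1 + e)) := by
  choose e he hs using fun i => hasSum_gaussian_int hD (x i)
  refine ⟨∏ i, (1 + e i) - 1, ?_, ?_⟩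
  · have := Finset.univ.norm_prod_one_add_sub_one_le e
    rw [← Real.norm_eq_abs]
    refine this.trans (sub_le_sub_right (Real.exp_le_exp.2 ?_) 1)
    refine (Finset.sum_le_sum fun i _ => he i).trans ?_
    simp
  · have h := hasSum_prod_pi (fun i k => (Real.exp_pos _).le) hs
    rw [Finset.prod_mul_distrib, Finset.prod_const, Finset.card_univ, Fintype.card_fin,
      ← Real.rpow_natCast, ← Real.rpow_mul (by positivity)] at h
    rw [add_sub_cancel]
    have e1 : (1 / 2 * (n : ℝ)) = n / 2 := by ring
    rw [e1] at h
    refine h.congr_fun fun m => ?_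
    rw [← Real.exp_sum, EuclideanSpace.real_norm_sq_eq, ← Finset.sum_div, Finset.sum_neg_distrib]
    simp [gridPt]

end GaussPU

namespace GaussPU
open MeasureTheory ProbabilityTheory Filter Topology

/-! ### The refinement relation and the piecewise uniform grid -/

/-- Completing the square in `k` turns the terms of the refinement relation into Gaussians over the
lattice with the parameter `D (1 - H²)`. -/
theorem refCoeff_mul_exp {n : ℕ} {H D : ℝ} (hH₀ : 0 < H) (hH₁ : H < 1) (hD : 0 < D) (y : Pt n)
    (k : Fin n → ℤ) :
    refCoeff H D k * Real.exp (-‖y - gridPt H k‖ ^ 2 / (H ^ 2 * D)) =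
      Real.exp (-‖y‖ ^ 2 / D) * ((Real.pi * (D * (1 - H ^ 2))) ^ (-(n : ℝ) / 2) *
        Real.exp (-‖((1 - H ^ 2) / H) • y - gridPt 1 k‖ ^ 2 / (D * (1 - H ^ 2)))) := by
  have hH : 1 - H ^ 2 ≠ 0 := by nlinarith
  rw [refCoeff, mul_assoc, ← Real.exp_add, mul_left_comm, ← Real.exp_add, mul_assoc Real.pi]
  congr 2
  simp only [EuclideanSpace.real_norm_sq_eq, gridPt, PiLp.sub_apply, PiLp.smul_apply, smul_eq_mul,
    Finset.mul_sum, ← Finset.sum_neg_distrib, Finset.sum_div, ← Finset.sum_add_distrib]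
  refine Finset.sum_congr rfl fun i _ => ?_
  field_simp
  ring

theorem rpow_neg_mul_rpow {a : ℝ} (ha : 0 < a) (r s : ℝ) : a ^ (-r) * (a ^ r * s) = s := by
  rw [← mul_assoc, ← Real.rpow_add ha, neg_add_cancel, Real.rpow_zero, one_mul]

/-- The approximate refinement relation: the Gaussian of the coarse grid is almost a combination of
the Gaussians of the fine grid, with a small relative error. -/
theorem hasSum_refinement {n : ℕ} {H D : ℝ} (hH₀ : 0 < H) (hH₁ : H < 1) (hD : 0 < D) (y : Pt n) :
    ∃ e, |e| ≤ gaussErr n (D * (1 - H ^ 2)) ∧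
      HasSum (fun k => refCoeff H D k * Real.exp (-‖y - gridPt H k‖ ^ 2 / (H ^ 2 * D)))
        (Real.exp (-‖y‖ ^ 2 / D) * (1 + e)) := by
  have hD' : 0 < D * (1 - H ^ 2) := mul_pos hD (by nlinarith)
  obtain ⟨e, he, hs⟩ := hasSum_gaussian_lattice hD' (((1 - H ^ 2) / H) • y)
  refine ⟨e, he, ?_⟩
  simp_rw [refCoeff_mul_exp hH₀ hH₁ hD]
  have h := (hs.mul_left ((Real.pi * (D * (1 - H ^ 2))) ^ (-(n : ℝ) / 2))).mul_left
    (Real.exp (-‖y‖ ^ 2 / D))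
  have e1 : (Real.pi * (D * (1 - H ^ 2))) ^ (-(n : ℝ) / 2) *
      ((Real.pi * (D * (1 - H ^ 2))) ^ ((n : ℝ) / 2) * (1 + e)) = 1 + e := by
    rw [neg_div]
    exact rpow_neg_mul_rpow (by positivity) _ _
  rwa [e1] at h

theorem refCoeff_pos {n : ℕ} {H D : ℝ} (hH₀ : 0 < H) (hH₁ : H < 1) (hD : 0 < D) (k : Fin n → ℤ) :
    0 < refCoeff H D k := by
  have : 0 < Real.pi * D * (1 - H ^ 2) := mul_pos (mul_pos Real.pi_pos hD) (by nlinarith)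
  unfold refCoeff
  positivity

theorem summable_refCoeff {n : ℕ} {H D : ℝ} (hH₀ : 0 < H) (hH₁ : H < 1) (hD : 0 < D) :
    Summable fun k : Fin n → ℤ => refCoeff H D k := by
  have h1 : 0 < 1 - H ^ 2 := by nlinarith
  obtain ⟨e, -, hs⟩ := hasSum_gaussian_lattice (n := n) (D := (1 - H ^ 2) * D / H ^ 2)
    (by positivity) 0
  refine (hs.summable.mul_left ((Real.pi * D * (1 - H ^ 2)) ^ (-(n : ℝ) / 2))).congr fun k => ?_
  rw [refCoeff, zero_sub, norm_neg]
  congr 2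
  field_simp

/-- The fine Gaussian with centre `m + H k`, weighted by the coefficient `a_k`. -/
def fineGauss {n : ℕ} (H D : ℝ) (x : Pt n) (p : (Fin n → ℤ) × (Fin n → ℤ)) : ℝ :=
  refCoeff H D p.2 * Real.exp (-‖x - gridPt 1 p.1 - gridPt H p.2‖ ^ 2 / (H ^ 2 * D))

theorem fineGauss_nonneg {n : ℕ} {H D : ℝ} (hH₀ : 0 < H) (hH₁ : H < 1) (hD : 0 < D) (x : Pt n)
    (p : (Fin n → ℤ) × (Fin n → ℤ)) : 0 ≤ fineGauss H D x p :=
  mul_nonneg (refCoeff_pos hH₀ hH₁ hD _).le (Real.exp_pos _).le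

theorem summable_fineGauss {n : ℕ} {H D : ℝ} (hH₀ : 0 < H) (hH₁ : H < 1) (hD : 0 < D) (x : Pt n) :
    Summable (fineGauss H D x) := by
  rw [summable_prod_of_nonneg (fineGauss_nonneg hH₀ hH₁ hD x)]
  choose e he hs using fun m : Fin n → ℤ => hasSum_refinement hH₀ hH₁ hD (x - gridPt 1 m)
  refine ⟨fun m => (hs m).summable, ?_⟩
  obtain ⟨e', -, hs'⟩ := hasSum_gaussian_lattice hD x
  refine (hs'.summable.mul_right (1 + gaussErr n (D * (1 - H ^ 2)))).of_nonneg_of_le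
    (fun m => tsum_nonneg fun k => fineGauss_nonneg hH₀ hH₁ hD x _) fun m => ?_
  have h1 : ∑' k, fineGauss H D x (m, k) = _ := (hs m).tsum_eq
  rw [h1]
  gcongr
  exact (le_abs_self _).trans (he m)

/-- The Gaussians of a piecewise uniform grid form an approximate partition of unity. The first
error term comes from the coarse lattice, the second one from the refinement relation and the third
one from the truncation of the refinement relation to the index set `S`. -/
theorem abs_piecewise_gaussian_sub_one_le {n : ℕ} {H D : ℝ} (hH₀ : 0 < H) (hH₁ : H < 1) (hD : 0 < D)
    {S : Finset (Fin n → ℤ)} {δ : ℝ} (hS : ∑' k : {k : Fin n → ℤ // k ∉ S}, refCoeff H D k.1 ≤ δ)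
    (M : Set (Fin n → ℤ)) (x : Pt n) :
    |(Real.pi * D) ^ (-(n : ℝ) / 2) *
        (∑' m : (Mᶜ : Set (Fin n → ℤ)), Real.exp (-‖x - gridPt 1 m.1‖ ^ 2 / D) +
          ∑' p : {p : (Fin n → ℤ) × (Fin n → ℤ) | p.1 ∈ M ∧ p.2 ∈ S}, fineGauss H D x p) - 1| ≤
      gaussErr n D + gaussErr n (D * (1 - H ^ 2)) * (1 + gaussErr n D) +
        δ * (1 + gaussErr n (H ^ 2 * D)) := by
  classical
  set N := (Real.pi * D) ^ (-(n : ℝ) / 2) with hN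
  have hN0 : 0 < N := by positivity
  set G : (Fin n → ℤ) → ℝ := fun m => Real.exp (-‖x - gridPt 1 m‖ ^ 2 / D) with hG
  set F := fineGauss H D x with hF
  have hG0 : ∀ m, 0 ≤ G m := fun m => (Real.exp_pos _).le
  have hF0 : ∀ p, 0 ≤ F p := fineGauss_nonneg hH₀ hH₁ hD x
  have hFs : Summable F := summable_fineGauss hH₀ hH₁ hD x
  obtain ⟨e, he, hGs⟩ := hasSum_gaussian_lattice hD x
  have hNG : N * ∑' m, G m = 1 + e := by
    rw [hGs.tsum_eq, hN, neg_div]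
    exact rpow_neg_mul_rpow (by positivity) _ _
  choose e' he' hs' using fun m : Fin n → ℤ => hasSum_refinement hH₀ hH₁ hD (x - gridPt 1 m)
  have hFk : ∀ m, HasSum (fun k => F (m, k)) (G m * (1 + e' m)) := hs'
  set I : Set ((Fin n → ℤ) × (Fin n → ℤ)) := {p | p.1 ∈ M ∧ p.2 ∈ S} with hI
  set J : Set ((Fin n → ℤ) × (Fin n → ℤ)) := {p | p.1 ∈ M ∧ p.2 ∉ S} with hJ
  -- the sum over all `k` for `m ∈ M`, by the refinement relation
  have hIJ : ∑' p : I, F p + ∑' p : J, F p = ∑' m, M.indicator (fun m => G m * (1 + e' m)) m := by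
    rw [tsum_subtype, tsum_subtype, ← (hFs.indicator I).tsum_add (hFs.indicator J)]
    have h1 : (fun p => I.indicator F p + J.indicator F p) =
        {p : (Fin n → ℤ) × (Fin n → ℤ) | p.1 ∈ M}.indicator F := by
      funext p
      by_cases h1 : p.1 ∈ M <;> by_cases h2 : p.2 ∈ S <;>
        simp [hI, hJ, h1, h2]
    rw [h1, (hFs.indicator _).tsum_prod]
    refine tsum_congr fun m => ?_
    by_cases hm : m ∈ M
    · simp [hm, (hFk m).tsum_eq]
    · simp [hm]
  -- the error of the refinement relation
  have hGe : Summable fun m => M.indicator (fun m => G m * e' m) m := by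
    refine Summable.indicator ?_ M
    refine Summable.of_norm_bounded (hGs.summable.mul_right (gaussErr n (D * (1 - H ^ 2))))
      fun m => ?_
    rw [norm_mul, Real.norm_eq_abs, Real.norm_eq_abs, abs_of_nonneg (hG0 m)]
    exact mul_le_mul_of_nonneg_left (he' m) (hG0 m)
  have hsum : ∑' m : (Mᶜ : Set (Fin n → ℤ)), G m + (∑' p : I, F p + ∑' p : J, F p) =
      ∑' m, G m + ∑' m, M.indicator (fun m => G m * e' m) m := by
    rw [hIJ, tsum_subtype, ← (hGs.summable.indicator _).tsum_add, ← hGs.summable.tsum_add hGe]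
    · refine tsum_congr fun m => ?_
      by_cases hm : m ∈ M <;> simp [hm]
      ring
    · refine ((hGs.summable.indicator M).add hGe).congr fun m => ?_
      by_cases hm : m ∈ M <;> simp [hm]
      ring
  have herr1 : |∑' m, M.indicator (fun m => G m * e' m) m| ≤
      gaussErr n (D * (1 - H ^ 2)) * ∑' m, G m := by
    rw [← Real.norm_eq_abs, mul_comm]
    refine tsum_of_norm_bounded (hGs.summable.hasSum.mul_right _) fun m => ?_
    rw [Set.indicator_apply]
    split_ifs
    · rw [norm_mul, Real.norm_eq_abs, Real.norm_eq_abs, abs_of_nonneg (hG0 m)]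
      exact mul_le_mul_of_nonneg_left (he' m) (hG0 m)
    · simpa using mul_nonneg (hG0 m) (gaussErr_nonneg _ _)
  -- the error of the truncation
  have hJ0 : 0 ≤ ∑' p : J, F p := tsum_nonneg fun p => hF0 _
  have hH2 : 0 < H ^ 2 * D := by positivity
  have hNk : ∀ k, N * ∑' m, Real.exp (-‖x - gridPt 1 m - gridPt H k‖ ^ 2 / (H ^ 2 * D)) ≤
      1 + gaussErr n (H ^ 2 * D) := by
    intro k
    obtain ⟨e'', he'', hs''⟩ := hasSum_gaussian_lattice hH2 (x - gridPt H k)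
    have h1 : N ≤ (Real.pi * (H ^ 2 * D)) ^ (-(n : ℝ) / 2) := by
      refine Real.rpow_le_rpow_of_nonpos (by positivity) ?_ ?_
      · have : H ^ 2 * D ≤ D := mul_le_of_le_one_left hD.le (by nlinarith)
        exact mul_le_mul_of_nonneg_left this Real.pi_pos.le
      · have : (0 : ℝ) ≤ n := Nat.cast_nonneg n
        linarith
    simp_rw [sub_right_comm x _ (gridPt H k)]
    rw [hs''.tsum_eq]
    refine (mul_le_mul_of_nonneg_right h1 (hs''.nonneg fun m => (Real.exp_pos _).le)).trans ?_
    rw [neg_div, rpow_neg_mul_rpow (by positivity)]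
    linarith [(le_abs_self e'').trans he'']
  have herr2 : N * ∑' p : J, F p ≤ δ * (1 + gaussErr n (H ^ 2 * D)) := by
    have h1 : ∑' p : J, F p ≤
        ∑' k : {k : Fin n → ℤ | k ∉ S}, ∑' m, F (m, k.1) := by
      have hsw : Summable fun p : (Fin n → ℤ) × (Fin n → ℤ) => F (p.2, p.1) := hFs.prod_symm
      have hK : Summable fun p : (Fin n → ℤ) × (Fin n → ℤ) => J.indicator F (p.2, p.1) :=
        (hFs.indicator J).prod_symm
      have hKF : ∀ k m, J.indicator F (m, k) ≤ F (m, k) := fun k m =>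
        Set.indicator_le_self' (fun _ _ => hF0 _) _
      have e1 : ∑' p, J.indicator F p = ∑' k, ∑' m, J.indicator F (m, k) := by
        rw [← (Equiv.prodComm _ _).tsum_eq]
        exact hK.tsum_prod
      rw [tsum_subtype, tsum_subtype {k : Fin n → ℤ | k ∉ S} fun k => ∑' m, F (m, k), e1]
      refine Summable.tsum_le_tsum (fun k => ?_) hK.prod (hsw.prod.indicator _)
      by_cases hk : k ∈ S
      · simp [hJ, hk]
      · rw [Set.indicator_of_mem (show k ∈ {k : Fin n → ℤ | k ∉ S} from hk)]
        exact Summable.tsum_le_tsum (hKF k) (hK.prod_factor k) (hsw.prod_factor k)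
    have h2 : N * ∑' k : {k : Fin n → ℤ | k ∉ S}, ∑' m, F (m, k.1) ≤
        ∑' k : {k : Fin n → ℤ | k ∉ S}, refCoeff H D k.1 * (1 + gaussErr n (H ^ 2 * D)) := by
      rw [← tsum_mul_left]
      have hle : ∀ k : {k : Fin n → ℤ | k ∉ S}, N * ∑' m, F (m, k.1) ≤
          refCoeff H D k.1 * (1 + gaussErr n (H ^ 2 * D)) := by
        intro k
        have e1 : ∑' m, F (m, k.1) = ∑' m, refCoeff H D k.1 *
            Real.exp (-‖x - gridPt 1 m - gridPt H k.1‖ ^ 2 / (H ^ 2 * D)) := rfl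
        rw [e1, tsum_mul_left, mul_left_comm]
        exact mul_le_mul_of_nonneg_left (hNk k) (refCoeff_pos hH₀ hH₁ hD _).le
      have hsr : Summable fun k : {k : Fin n → ℤ | k ∉ S} =>
          refCoeff H D k.1 * (1 + gaussErr n (H ^ 2 * D)) :=
        ((summable_refCoeff hH₀ hH₁ hD).subtype _).mul_right _
      exact Summable.tsum_le_tsum hle (hsr.of_nonneg_of_le
        (fun k => mul_nonneg hN0.le (tsum_nonneg fun m => hF0 _)) hle) hsr
    rw [tsum_mul_right] at h2
    refine (mul_le_mul_of_nonneg_left h1 hN0.le).trans (h2.trans ?_)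
    exact mul_le_mul_of_nonneg_right hS (by linarith [gaussErr_nonneg n (H ^ 2 * D)])
  have hfin : N * (∑' m : (Mᶜ : Set (Fin n → ℤ)), G m + ∑' p : I, F p) - 1 =
      e + N * ∑' m, M.indicator (fun m => G m * e' m) m - N * ∑' p : J, F p := by
    linear_combination N * hsum + hNG
  rw [hfin]
  have h3 : |N * ∑' m, M.indicator (fun m => G m * e' m) m| ≤
      gaussErr n (D * (1 - H ^ 2)) * (1 + gaussErr n D) := by
    rw [abs_mul, abs_of_pos hN0]
    calc _ ≤ N * (gaussErr n (D * (1 - H ^ 2)) * ∑' m, G m) := by gcongr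
      _ = gaussErr n (D * (1 - H ^ 2)) * (1 + e) := by rw [mul_left_comm, hNG]
      _ ≤ _ := by
        have := gaussErr_nonneg n (D * (1 - H ^ 2))
        gcongr
        exact (le_abs_self e).trans he
  have h4 : |N * ∑' p : J, F p| ≤ δ * (1 + gaussErr n (H ^ 2 * D)) := by
    rwa [abs_of_nonneg (mul_nonneg hN0.le hJ0)]
  refine (abs_sub _ _).trans (add_le_add ((abs_add_le _ _).trans (add_le_add he h3)) h4)

/-- The three error terms of `abs_piecewise_gaussian_sub_one_le` are small for large `D`. -/
theorem exists_piecewise_gaussian_error_lt (n : ℕ) {H : ℝ} (hH₀ : 0 < H) (hH₁ : H < 1) {ε : ℝ}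
    (hε : 0 < ε) : ∃ Dmin > 0, ∀ D ≥ Dmin,
      gaussErr n D + gaussErr n (D * (1 - H ^ 2)) * (1 + gaussErr n D) +
        Real.exp (-(Real.pi ^ 2 * D * (1 - H ^ 2))) * (1 + gaussErr n (H ^ 2 * D)) < ε := by
  have h1 : 0 < 1 - H ^ 2 := by nlinarith
  have t0 := tendsto_gaussErr n
  have t1 := t0.comp (tendsto_id.atTop_mul_const h1)
  have t2 := t0.comp (tendsto_id.const_mul_atTop (pow_pos hH₀ 2))
  have t3 : Tendsto (fun D : ℝ => Real.exp (-(Real.pi ^ 2 * D * (1 - H ^ 2)))) atTop (𝓝 0) :=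
    Real.tendsto_exp_neg_atTop_nhds_zero.comp
      ((tendsto_id.const_mul_atTop (by positivity : 0 < Real.pi ^ 2)).atTop_mul_const h1)
  have t := (t0.add (t1.mul (t0.const_add 1))).add (t3.mul (t2.const_add 1))
  simp only [zero_mul, add_zero] at t
  obtain ⟨D₁, hD₁⟩ := eventually_atTop.1 (t.eventually (gt_mem_nhds hε))
  exact ⟨max D₁ 1, by positivity, fun D hD => hD₁ D ((le_max_left _ _).trans hD)⟩

end GaussPU

namespace GaussPU
open MeasureTheory ProbabilityTheory Filter Topology

/-! ### The approximate partition of unity, grouped by grid points -/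

theorem gridPt_mul {n : ℕ} (h a : ℝ) (m : Fin n → ℤ) : gridPt (h * a) m = h • gridPt a m := by
  ext i; simp [gridPt, mul_assoc]

theorem inv_smul_sub_gridPt {n : ℕ} {h : ℝ} (hh : 0 < h) (x : Pt n) (m : Fin n → ℤ) :
    h⁻¹ • (x - gridPt h m) = h⁻¹ • x - gridPt 1 m := by
  rw [← mul_one h, gridPt_mul, mul_one, smul_sub, inv_smul_smul₀ hh.ne']

theorem inv_smul_sub_finePt {n : ℕ} (H : ℝ) {h : ℝ} (hh : 0 < h) (x : Pt n)
    (p : (Fin n → ℤ) × (Fin n → ℤ)) :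
    (H * h)⁻¹ • (x - finePt h (H * h) p) = H⁻¹ • (h⁻¹ • x - gridPt 1 p.1 - gridPt H p.2) := by
  have e1 : gridPt h p.1 = h • gridPt 1 p.1 := by rw [← gridPt_mul, mul_one]
  rw [finePt, e1, mul_comm H h, gridPt_mul, mul_inv, mul_comm h⁻¹, mul_smul, smul_sub, smul_add,
    inv_smul_smul₀ hh.ne', inv_smul_smul₀ hh.ne', sub_sub]

theorem neg_norm_sq_div_eq {n : ℕ} {h : ℝ} (hh : 0 < h) (D : ℝ) (y : Pt n) :
    -‖y‖ ^ 2 / (h ^ 2 * D) = -‖h⁻¹ • y‖ ^ 2 / D := by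
  rw [norm_smul, norm_inv, Real.norm_eq_abs, abs_of_pos hh]
  field_simp

theorem exists_tsum_gaussian_lattice_le (n : ℕ) {q : ℝ} (hq : 0 < q) :
    ∃ C, ∀ x : Pt n, Summable (fun m : Fin n → ℤ => Real.exp (-q * ‖x - gridPt 1 m‖ ^ 2)) ∧
      ∑' m : Fin n → ℤ, Real.exp (-q * ‖x - gridPt 1 m‖ ^ 2) ≤ C := by
  refine ⟨(Real.pi * q⁻¹) ^ ((n : ℝ) / 2) * (1 + gaussErr n q⁻¹), fun x => ?_⟩
  obtain ⟨e, he, hs⟩ := hasSum_gaussian_lattice (inv_pos.2 hq) x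
  have h1 : ∀ m : Fin n → ℤ, Real.exp (-q * ‖x - gridPt 1 m‖ ^ 2) =
      Real.exp (-‖x - gridPt 1 m‖ ^ 2 / q⁻¹) := fun m => by
    congr 1; rw [div_inv_eq_mul]; ring
  simp_rw [h1]
  refine ⟨hs.summable, hs.tsum_eq.le.trans ?_⟩
  gcongr
  exact (le_abs_self e).trans he

theorem summable_prod_and_tsum_le {α β : Type*} {f : α × β → ℝ} (hf : ∀ p, 0 ≤ f p) {b : β → ℝ}
    (hb : Summable b) (h1 : ∀ k, Summable fun m => f (m, k)) (h2 : ∀ k, ∑' m, f (m, k) ≤ b k) :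
    Summable f ∧ ∑' p, f p ≤ ∑' k, b k := by
  have hs : Summable fun p : β × α => f (p.2, p.1) :=
    (summable_prod_of_nonneg fun p => hf _).2
      ⟨h1, hb.of_nonneg_of_le (fun k => tsum_nonneg fun m => hf _) h2⟩
  refine ⟨hs.prod_symm, ?_⟩
  have e : ∑' p : β × α, f (p.2, p.1) = ∑' p, f p := (Equiv.prodComm β α).tsum_eq f
  rw [← e, hs.tsum_prod]
  exact hs.prod.tsum_le_tsum h2 hb

theorem exists_tsum_refCoeff_mul_gaussian_le (n : ℕ) {H D : ℝ} (hH₀ : 0 < H) (hH₁ : H < 1)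
    (hD : 0 < D) {q : ℝ} (hq : 0 < q) :
    ∃ C, ∀ x : Pt n, Summable (fun p : (Fin n → ℤ) × (Fin n → ℤ) =>
        refCoeff H D p.2 * Real.exp (-q * ‖x - gridPt 1 p.1 - gridPt H p.2‖ ^ 2)) ∧
      ∑' p : (Fin n → ℤ) × (Fin n → ℤ),
        refCoeff H D p.2 * Real.exp (-q * ‖x - gridPt 1 p.1 - gridPt H p.2‖ ^ 2) ≤ C := by
  obtain ⟨C, hC⟩ := exists_tsum_gaussian_lattice_le n hq
  refine ⟨∑' k : Fin n → ℤ, refCoeff H D k * C, fun x => ?_⟩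
  have h1 : ∀ k m : Fin n → ℤ, x - gridPt 1 m - gridPt H k = x - gridPt H k - gridPt 1 m :=
    fun k m => sub_right_comm _ _ _
  refine summable_prod_and_tsum_le
    (fun p => mul_nonneg (refCoeff_pos hH₀ hH₁ hD _).le (Real.exp_pos _).le)
    ((summable_refCoeff (n := n) hH₀ hH₁ hD).mul_right C) (fun k => ?_) (fun k => ?_)
  · simp only [h1]
    exact (hC (x - gridPt H k)).1.mul_left _
  · simp only [h1]
    rw [tsum_mul_left]
    exact mul_le_mul_of_nonneg_left (hC _).2 (refCoeff_pos hH₀ hH₁ hD _).le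

theorem tsum_subtype_le_of_nonneg {α : Type*} {f : α → ℝ} (hf : Summable f) (h0 : ∀ a, 0 ≤ f a)
    (s : Set α) : ∑' a : s, f a ≤ ∑' a, f a := by
  rw [tsum_subtype]
  exact (hf.indicator s).tsum_le_tsum (Set.indicator_le_self' fun a _ => h0 a) hf

theorem summable_and_abs_tsum_sub_le {ι : Type*} {f g b : ι → ℝ} (hg : Summable g)
    (hb : Summable b) (h : ∀ i, |f i - g i| ≤ b i) :
    Summable f ∧ |∑' i, f i - ∑' i, g i| ≤ ∑' i, b i := by
  have h1 : Summable fun i => f i - g i := Summable.of_norm_bounded hb h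
  have hf : Summable f := (h1.add hg).congr fun i => sub_add_cancel _ _
  refine ⟨hf, ?_⟩
  rw [← hf.tsum_sub hg, ← Real.norm_eq_abs]
  exact tsum_of_norm_bounded hb.hasSum h

/-- For large `D` and `L`, the local approximations of the Gaussians on a piecewise uniform grid
form an approximate partition of unity. The set `M` of refined grid points is arbitrary. -/
theorem exists_abs_grid_series_sub_one_lt (n : ℕ) {H : ℝ} (hH₀ : 0 < H) (hH₁ : H < 1) {ε : ℝ}
    (hε : 0 < ε) :
    ∃ Dmin : ℝ, 0 < Dmin ∧ ∀ D : ℝ, Dmin ≤ D → ∀ D₀ : ℝ, 0 < D₀ → D₀ < D → ∀ κ : ℝ,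
    ∃ Lmin : ℕ, ∀ L : ℕ, Lmin ≤ L → ∀ h : ℝ, 0 < h → ∀ S : Finset (Fin n → ℤ),
      ∑' k : {k : Fin n → ℤ // k ∉ S}, refCoeff H D k.1 <
        Real.exp (-(Real.pi ^ 2 * D * (1 - H ^ 2))) →
    ∀ (M : Set (Fin n → ℤ)) (Sig₁ : (Fin n → ℤ) → Finset (Pt n))
      (Sig₂ : (Fin n → ℤ) × (Fin n → ℤ) → Finset (Pt n))
      (c₁ : (Fin n → ℤ) → Pt n → (Fin n →₀ ℕ) → ℝ)
      (c₂ : (Fin n → ℤ) × (Fin n → ℤ) → Pt n → (Fin n →₀ ℕ) → ℝ),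
      (∀ m ∈ Mᶜ, SolvesLocal D D₀ L h (gridPt h m) (Sig₁ m) (c₁ m) ∧
        ∃ a ∈ Sig₁ m, dist a (gridPt h m) < κ * h) →
      (∀ p ∈ {p : (Fin n → ℤ) × (Fin n → ℤ) | p.1 ∈ M ∧ p.2 ∈ S},
        SolvesLocal D D₀ L (H * h) (finePt h (H * h) p) (Sig₂ p) (c₂ p) ∧
        ∃ a ∈ Sig₂ p, dist a (finePt h (H * h) p) < κ * (H * h)) →
    ∀ x : Pt n,
      Summable (fun m : (Mᶜ : Set (Fin n → ℤ)) => gridTerm D h L (Sig₁ m) (c₁ m) x) ∧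
      Summable (fun p : {p : (Fin n → ℤ) × (Fin n → ℤ) | p.1 ∈ M ∧ p.2 ∈ S} =>
        refCoeff H D p.1.2 * gridTerm D (H * h) L (Sig₂ p) (c₂ p) x) ∧
      |(Real.pi * D) ^ (-(n : ℝ) / 2) *
          (∑' m : (Mᶜ : Set (Fin n → ℤ)), gridTerm D h L (Sig₁ m) (c₁ m) x +
            ∑' p : {p : (Fin n → ℤ) × (Fin n → ℤ) | p.1 ∈ M ∧ p.2 ∈ S},
              refCoeff H D p.1.2 * gridTerm D (H * h) L (Sig₂ p) (c₂ p) x) - 1| < ε := by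
  obtain ⟨Dmin, hDmin, hDm⟩ := exists_piecewise_gaussian_error_lt n hH₀ hH₁ (half_pos hε)
  refine ⟨Dmin, hDmin, fun D hDD D₀ h₀ hD₀ κ => ?_⟩
  have hD : 0 < D := h₀.trans hD₀
  obtain ⟨q, hq, hloc⟩ := exists_abs_gridTerm_sub_le n h₀ hD₀ κ
  obtain ⟨C₁, hC₁⟩ := exists_tsum_gaussian_lattice_le n hq
  obtain ⟨C₂, hC₂⟩ := exists_tsum_refCoeff_mul_gaussian_le n hH₀ hH₁ hD
    (q := q / H ^ 2) (by positivity)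
  have hC₁0 : 0 ≤ C₁ := (tsum_nonneg fun m => (Real.exp_pos _).le).trans (hC₁ 0).2
  have hC₂0 : 0 ≤ C₂ := (tsum_nonneg fun p => mul_nonneg (refCoeff_pos hH₀ hH₁ hD _).le
    (Real.exp_pos _).le).trans (hC₂ 0).2
  set N := (Real.pi * D) ^ (-(n : ℝ) / 2) with hN
  have hN0 : 0 < N := by positivity
  -- the local accuracy for which the errors of all grid points add up to at most `ε / 2`
  obtain ⟨η, hη, hηε⟩ : ∃ η > 0, N * (η * C₁ + η * C₂) ≤ ε / 2 := by
    refine ⟨ε / 2 / (N * (C₁ + C₂) + 1), by positivity, ?_⟩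
    have h1 : N * (ε / 2 / (N * (C₁ + C₂) + 1) * C₁ + ε / 2 / (N * (C₁ + C₂) + 1) * C₂) =
        ε / 2 * ((N * (C₁ + C₂)) / (N * (C₁ + C₂) + 1)) := by ring
    rw [h1]
    refine mul_le_of_le_one_right (by positivity) ((div_le_one (by positivity)).2 (by linarith))
  obtain ⟨Lmin, hL⟩ := hloc η hη
  refine ⟨Lmin, fun L hLL h hh S hS M Sig₁ Sig₂ c₁ c₂ h₁ h₂ x => ?_⟩
  set x' := h⁻¹ • x with hx'
  have hHh : 0 < H * h := mul_pos hH₀ hh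
  have hmain := (abs_piecewise_gaussian_sub_one_le hH₀ hH₁ hD hS.le M x').trans_lt (hDm D hDD)
  set G : (Fin n → ℤ) → ℝ := fun m => Real.exp (-‖x' - gridPt 1 m‖ ^ 2 / D) with hG
  have hGs : Summable G := (hasSum_gaussian_lattice hD x').choose_spec.2.summable
  have hFs := summable_fineGauss (n := n) hH₀ hH₁ hD x'
  set I : Set ((Fin n → ℤ) × (Fin n → ℤ)) := {p | p.1 ∈ M ∧ p.2 ∈ S} with hI
  obtain ⟨hs₁, he₁⟩ := summable_and_abs_tsum_sub_le
    (f := fun m : (Mᶜ : Set (Fin n → ℤ)) => gridTerm D h L (Sig₁ m) (c₁ m) x)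
    (g := fun m : (Mᶜ : Set (Fin n → ℤ)) => G m)
    (b := fun m : (Mᶜ : Set (Fin n → ℤ)) => η * Real.exp (-q * ‖x' - gridPt 1 m.1‖ ^ 2))
    (hGs.subtype _) (((hC₁ x').1.subtype _).mul_left η) (fun m => by
      have := hL L hLL h hh (gridPt h m) (Sig₁ m) (c₁ m) (h₁ m m.2).1 (h₁ m m.2).2 x
      rwa [neg_norm_sq_div_eq hh, inv_smul_sub_gridPt hh] at this)
  obtain ⟨hs₂, he₂⟩ := summable_and_abs_tsum_sub_le
    (f := fun p : I => refCoeff H D p.1.2 * gridTerm D (H * h) L (Sig₂ p) (c₂ p) x)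
    (g := fun p : I => fineGauss H D x' p)
    (b := fun p : I => η * (refCoeff H D p.1.2 *
      Real.exp (-(q / H ^ 2) * ‖x' - gridPt 1 p.1.1 - gridPt H p.1.2‖ ^ 2)))
    (hFs.subtype _) (((hC₂ x').1.subtype _).mul_left η) (fun p => by
      have := hL L hLL (H * h) hHh (finePt h (H * h) p) (Sig₂ p) (c₂ p) (h₂ p p.2).1 (h₂ p p.2).2 x
      rw [neg_norm_sq_div_eq hHh, inv_smul_sub_finePt H hh, ← neg_norm_sq_div_eq hH₀] at this
      rw [fineGauss, ← mul_sub, abs_mul, abs_of_pos (refCoeff_pos hH₀ hH₁ hD _), mul_left_comm]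
      refine mul_le_mul_of_nonneg_left (this.trans_eq ?_) (refCoeff_pos hH₀ hH₁ hD _).le
      congr 2
      rw [norm_smul, norm_inv, Real.norm_eq_abs, abs_of_pos hH₀, mul_pow, inv_pow]
      ring)
  refine ⟨hs₁, hs₂, ?_⟩
  have hb₁ : ∑' m : (Mᶜ : Set (Fin n → ℤ)), η * Real.exp (-q * ‖x' - gridPt 1 m.1‖ ^ 2) ≤
      η * C₁ := by
    rw [tsum_mul_left]
    exact mul_le_mul_of_nonneg_left ((tsum_subtype_le_of_nonneg (hC₁ x').1
      (fun _ => (Real.exp_pos _).le) _).trans (hC₁ x').2) hη.le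
  have hb₂ : ∑' p : I, η * (refCoeff H D p.1.2 *
      Real.exp (-(q / H ^ 2) * ‖x' - gridPt 1 p.1.1 - gridPt H p.1.2‖ ^ 2)) ≤ η * C₂ := by
    rw [tsum_mul_left]
    have h3 := tsum_subtype_le_of_nonneg (hC₂ x').1
      (fun p => mul_nonneg (refCoeff_pos hH₀ hH₁ hD _).le (Real.exp_pos _).le) I
    exact mul_le_mul_of_nonneg_left (h3.trans (hC₂ x').2) hη.le
  set A₁ := ∑' m : (Mᶜ : Set (Fin n → ℤ)), gridTerm D h L (Sig₁ m) (c₁ m) x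
  set A₂ := ∑' p : I, refCoeff H D p.1.2 * gridTerm D (H * h) L (Sig₂ p) (c₂ p) x
  set B₁ := ∑' m : (Mᶜ : Set (Fin n → ℤ)), G m
  set B₂ := ∑' p : I, fineGauss H D x' p
  have h3 : N * (A₁ + A₂) - 1 = (N * (B₁ + B₂) - 1) + N * ((A₁ - B₁) + (A₂ - B₂)) := by ring
  rw [h3]
  have h4 : |N * ((A₁ - B₁) + (A₂ - B₂))| ≤ N * (η * C₁ + η * C₂) := by
    rw [abs_mul, abs_of_pos hN0]
    exact mul_le_mul_of_nonneg_left ((abs_add_le _ _).trans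
      (add_le_add (he₁.trans hb₁) (he₂.trans hb₂))) hN0.le
  refine (abs_add_le _ _).trans_lt ?_
  have h5 : |N * (B₁ + B₂) - 1| < ε / 2 := hmain
  linarith

end GaussPU

namespace GaussPU
open MeasureTheory ProbabilityTheory Filter Topology

/-! ### Grouping by nodes -/

theorem gaussTerm_sum_smul {n : ℕ} {ι : Type*} (D h : ℝ) (s : Finset ι) (w : ι → ℝ)
    (P : ι → MvPolynomial (Fin n) ℝ) (a x : Pt n) :
    gaussTerm D h (∑ i ∈ s, w i • P i) a x = ∑ i ∈ s, w i * gaussTerm D h (P i) a x := by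
  simp only [gaussTerm, map_sum, MvPolynomial.smul_eval, Finset.sum_mul, mul_assoc]

theorem gaussTerm_polyOf_eq_zero {n : ℕ} (D h : ℝ) (L : ℕ) {c : (Fin n →₀ ℕ) → ℝ}
    (hc : ∀ β, c β = 0) (a x : Pt n) : gaussTerm D h (polyOf L c) a x = 0 := by
  simp [gaussTerm, polyOf, hc]

/-- An absolutely convergent double series over pairs of grid points and nodes can be summed by
nodes or by grid points. -/
theorem summable_and_tsum_nodePoly {n : ℕ} {ι : Type} {I : Set ι} {w : ι → ℝ}
    {Sig : ι → Finset (Pt n)} {c : ι → Pt n → (Fin n →₀ ℕ) → ℝ} {J : Set (Pt n)} {D h : ℝ} {L : ℕ}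
    {x : Pt n} (hsub : ∀ i ∈ I, (↑(Sig i) : Set (Pt n)) ⊆ J)
    (hfin : ∀ a ∈ J, {i ∈ I | a ∈ Sig i}.Finite)
    (hc : ∀ i ∈ I, ∀ a ∉ Sig i, ∀ β, c i a β = 0)
    (hs : Summable fun q : I × J => w q.1 * gaussTerm D h (polyOf L (c q.1 q.2)) q.2 x) :
    Summable (fun a : J => gaussTerm D h (nodePoly L I w Sig c a) a x) ∧
      ∑' a : J, gaussTerm D h (nodePoly L I w Sig c a) a x =
        ∑' i : I, w i * gridTerm D h L (Sig i) (c i) x := by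
  classical
  have h1 : ∀ a : J, gaussTerm D h (nodePoly L I w Sig c a) a x =
      ∑' i : I, w i * gaussTerm D h (polyOf L (c i a)) a x := by
    intro a
    rw [nodePoly, finsum_mem_eq_finite_toFinset_sum _ (hfin a a.2), gaussTerm_sum_smul,
      tsum_subtype I fun i => w i * gaussTerm D h (polyOf L (c i a)) a x,
      tsum_eq_sum (s := (hfin a a.2).toFinset)]
    · refine Finset.sum_congr rfl fun i hi => ?_
      rw [Set.indicator_of_mem ((hfin a a.2).mem_toFinset.1 hi).1]
    · intro i hi
      by_cases hI : i ∈ I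
      · have ha : (a : Pt n) ∉ Sig i := fun ha => hi ((hfin a a.2).mem_toFinset.2 ⟨hI, ha⟩)
        rw [Set.indicator_of_mem hI, gaussTerm_polyOf_eq_zero D h L (hc i hI a ha), mul_zero]
      · rw [Set.indicator_of_notMem hI]
  have h2 : ∀ i : I, ∑' a : J, w i * gaussTerm D h (polyOf L (c i a)) a x =
      w i * gridTerm D h L (Sig i) (c i) x := by
    intro i
    rw [tsum_mul_left, gridTerm, tsum_subtype J fun a => gaussTerm D h (polyOf L (c i a)) a x,
      tsum_eq_sum (s := Sig i)]
    · congr 1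
      refine Finset.sum_congr rfl fun a ha => ?_
      rw [Set.indicator_of_mem (hsub i i.2 ha)]
    · intro a ha
      rw [Set.indicator_apply, gaussTerm_polyOf_eq_zero D h L (hc i i.2 a ha), ite_self]
  have hs' : Summable fun q : J × I => w q.2 * gaussTerm D h (polyOf L (c q.2 q.1)) q.1 x :=
    hs.prod_symm
  simp_rw [h1, ← h2]
  refine ⟨hs'.prod, ?_⟩
  rw [← hs.tsum_prod, ← hs'.tsum_prod]
  exact ((Equiv.prodComm _ _).tsum_eq fun q : I × J =>
    w q.1 * gaussTerm D h (polyOf L (c q.1 q.2)) q.2 x)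

/-- The fine grid is finite: `k` belongs to the finite set `S`, and for each `k ∈ S` the boundedness
of `Ω` leaves finitely many `m`. -/
theorem finite_I₂ {n : ℕ} {h₁ h₂ : ℝ} (hh : 0 < h₁) {Ω : Set (Pt n)} (hΩ : Bornology.IsBounded Ω)
    (S : Finset (Fin n → ℤ)) : (I₂ h₁ h₂ Ω S).Finite := by
  have h1 : ∀ k : Fin n → ℤ, {m : Fin n → ℤ | gridPt h₁ m + gridPt h₂ k ∈ Ω}.Finite := by
    intro k
    obtain ⟨R, hR⟩ := hΩ.exists_norm_le
    obtain ⟨N, hN⟩ := exists_nat_ge ((R + ‖gridPt h₂ k‖) / h₁)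
    refine (Set.finite_Icc (fun _ : Fin n => -(N : ℤ)) fun _ => (N : ℤ)).subset fun m hm => ?_
    have hb : ∀ i, |(m i : ℝ)| ≤ N := by
      intro i
      refine le_trans ?_ hN
      rw [le_div_iff₀ hh]
      have e1 : ‖gridPt h₁ m‖ ≤ R + ‖gridPt h₂ k‖ := by
        have := norm_sub_le (gridPt h₁ m + gridPt h₂ k) (gridPt h₂ k)
        rw [add_sub_cancel_right] at this
        linarith [hR _ hm]
      have e2 := PiLp.norm_apply_le (gridPt h₁ m) i
      have e3 : ‖gridPt h₁ m i‖ = |(m i : ℝ)| * h₁ := by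
        simp [gridPt, abs_of_pos hh, mul_comm]
      linarith
    constructor <;> intro i
    · have := (abs_le.1 (hb i)).1
      exact_mod_cast this
    · have := (abs_le.1 (hb i)).2
      exact_mod_cast this
  refine ((S.finite_toSet.biUnion fun k _ => (h1 k).prod (Set.finite_singleton k))).subset ?_
  rintro ⟨m, k⟩ ⟨hm, hk⟩
  exact Set.mem_biUnion (Finset.mem_coe.2 hk) ⟨hm k hk, rfl⟩

/-- For a finite family of grid points the double series over grid points and nodes is finite. -/
theorem summable_of_finite_grid {n : ℕ} {ι : Type} {I : Set ι} (hI : I.Finite) {w : ι → ℝ}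
    {Sig : ι → Finset (Pt n)} {c : ι → Pt n → (Fin n →₀ ℕ) → ℝ} (J : Set (Pt n)) (D h : ℝ) (L : ℕ)
    (x : Pt n) (hc : ∀ i ∈ I, ∀ a ∉ Sig i, ∀ β, c i a β = 0) :
    Summable fun q : I × J => w q.1 * gaussTerm D h (polyOf L (c q.1 q.2)) q.2 x := by
  refine summable_of_hasFiniteSupport ?_
  have hfin : (⋃ i ∈ I, ({i} ×ˢ (↑(Sig i) : Set (Pt n)))).Finite :=
    hI.biUnion fun i _ => (Set.finite_singleton i).prod (Sig i).finite_toSet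
  refine (hfin.preimage (f := fun q : I × J => (q.1.1, q.2.1)) ?_).subset fun q hq => ?_
  · rintro ⟨i, a⟩ _ ⟨i', a'⟩ _ h
    simp only [Prod.mk.injEq] at h
    exact Prod.ext (Subtype.ext h.1) (Subtype.ext h.2)
  · refine Set.mem_biUnion q.1.2 ⟨rfl, ?_⟩
    by_contra ha
    exact hq (by
      simp only
      rw [gaussTerm_polyOf_eq_zero D h L (hc q.1 q.1.2 q.2 ha), mul_zero])

end GaussPU

namespace GaussPU
open MeasureTheory ProbabilityTheory Filter Topology
open scoped InnerProductSpace

/-! ### A uniform bound for the solutions of the local systems -/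

theorem continuous_calC₁ {D D₀ : ℝ} (hD : 0 ≤ D) (hD₀ : D₀ ≠ 0) (b c : ℕ) :
    Continuous fun p : ℝ × ℝ => calC₁ D D₀ b c p.1 p.2 := by
  simp_rw [calC₁_eq_integral hD hD₀]
  have hcont : ∀ b' : ℕ, Continuous fun p : ℝ × ℝ => sFeature D D₀ b' p.1 p.2 := fun b' =>
    continuous_eval_slope_mul_feature D D₀ (sFeaturePoly D D₀ b')
  refine continuous_iff_continuousAt.2 fun p₀ => ?_
  obtain ⟨A, u, hA⟩ := exists_abs_eval_slope_mul_feature_le D D₀ (sFeaturePoly D D₀ b) (|p₀.1| + 1)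
  obtain ⟨B, v, hB⟩ := exists_abs_eval_slope_mul_feature_le D D₀ (sFeaturePoly D D₀ c) (|p₀.2| + 1)
  have h1 : ∀ᶠ p : ℝ × ℝ in 𝓝 p₀, |p.1| < |p₀.1| + 1 :=
    continuousAt_fst.abs.eventually_lt continuousAt_const (lt_add_one _)
  have h2 : ∀ᶠ p : ℝ × ℝ in 𝓝 p₀, |p.2| < |p₀.2| + 1 :=
    continuousAt_snd.abs.eventually_lt continuousAt_const (lt_add_one _)
  refine continuousAt_of_dominated
    (bound := fun z => A * B * (Real.exp ((u + v) * |z|) * 1)) (.of_forall fun p => ?_) ?_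
    ((expIntegrable_one (u + v)).const_mul _) (.of_forall fun z => ?_)
  · exact (((hcont b).comp (by fun_prop : Continuous fun z : ℝ => (p.1, z))).mul
      ((hcont c).comp (by fun_prop : Continuous fun z : ℝ => (p.2, z)))).aestronglyMeasurable
  · filter_upwards [h1, h2] with p hp1 hp2
    refine .of_forall fun z => ?_
    have e1 := hA p.1 hp1.le z
    have e2 := hB p.2 hp2.le z
    rw [norm_mul, Real.norm_eq_abs, Real.norm_eq_abs]
    calc _ ≤ (A * Real.exp (u * |z|)) * (B * Real.exp (v * |z|)) :=
          mul_le_mul e1 e2 (abs_nonneg _) ((abs_nonneg _).trans e1)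
      _ = _ := by rw [add_mul, Real.exp_add]; ring
  · exact (((hcont b).comp (by fun_prop : Continuous fun p : ℝ × ℝ => (p.1, z))).mul
      ((hcont c).comp (by fun_prop : Continuous fun p : ℝ × ℝ => (p.2, z)))).continuousAt

theorem continuous_featureLp {n : ℕ} {D D₀ : ℝ} (hD : 0 ≤ D) (hD₀ : D₀ ≠ 0) (β : Fin n →₀ ℕ) :
    Continuous (featureLp D D₀ β) := by
  have hc : Continuous fun p : Pt n × Pt n => calC D D₀ β β p.1 p.2 := by
    simp_rw [calC_eq_prod]
    exact continuous_finsetProd _ fun i _ => (continuous_calC₁ hD hD₀ _ _).comp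
      (by fun_prop : Continuous fun p : Pt n × Pt n => (p.1 i, p.2 i))
  refine continuous_iff_continuousAt.2 fun a => tendsto_iff_norm_sub_tendsto_zero.2 ?_
  have h1 : ∀ y, ‖featureLp D D₀ β y - featureLp D D₀ β a‖ =
      Real.sqrt (calC D D₀ β β y y - 2 * calC D D₀ β β y a + calC D D₀ β β a a) := fun y => by
    rw [← inner_featureLp hD hD₀, ← inner_featureLp hD hD₀, ← inner_featureLp hD hD₀,
      real_inner_self_eq_norm_sq, real_inner_self_eq_norm_sq, ← norm_sub_sq_real,
      Real.sqrt_sq (norm_nonneg _)]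
  have h2 : Continuous fun y =>
      Real.sqrt (calC D D₀ β β y y - 2 * calC D D₀ β β y a + calC D D₀ β β a a) :=
    Real.continuous_sqrt.comp (((hc.comp (by fun_prop : Continuous fun y : Pt n => (y, y))).sub
      ((hc.comp (by fun_prop : Continuous fun y : Pt n => (y, a))).const_mul 2)).add_const _)
  have h3 := h2.tendsto a
  simp only [← h1, sub_self, norm_zero] at h3
  exact h3

/-- Linear independence is uniform on compact sets of parameters. -/
theorem exists_pos_mul_norm_le_of_isCompact {Y ι E : Type*} [TopologicalSpace Y] [Fintype ι]
    [NormedAddCommGroup E] [NormedSpace ℝ E] {K : Set Y} (hK : IsCompact K) {F : ι → Y → E}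
    (hF : ∀ i, Continuous (F i)) (hli : ∀ y ∈ K, ∀ d : ι → ℝ, ∑ i, d i • F i y = 0 → d = 0) :
    ∃ lam > 0, ∀ y ∈ K, ∀ d : ι → ℝ, lam * ‖d‖ ≤ ‖∑ i, d i • F i y‖ := by
  have hc : Continuous fun p : Y × (ι → ℝ) => ‖∑ i, p.2 i • F i p.1‖ := by
    refine (continuous_finsetSum _ fun i _ => ?_).norm
    exact ((continuous_apply i).comp continuous_snd).smul ((hF i).comp continuous_fst)
  have hcpt : IsCompact (K ×ˢ Metric.sphere (0 : ι → ℝ) 1) := hK.prod (isCompact_sphere _ _)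
  obtain ⟨lam, hl, hlam⟩ : ∃ lam > 0, ∀ p ∈ K ×ˢ Metric.sphere (0 : ι → ℝ) 1,
      lam ≤ ‖∑ i, p.2 i • F i p.1‖ := by
    rcases (K ×ˢ Metric.sphere (0 : ι → ℝ) 1).eq_empty_or_nonempty with he | hne
    · exact ⟨1, one_pos, fun p hp => by simp [he] at hp⟩
    · obtain ⟨p, hp, hmin⟩ := hcpt.exists_isMinOn hne hc.continuousOn
      refine ⟨_, norm_pos_iff.2 fun h0 => ?_, fun p' hp' => hmin hp'⟩
      have h1 : ‖p.2‖ = 1 := mem_sphere_zero_iff_norm.1 hp.2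
      rw [hli p.1 hp.1 p.2 h0, norm_zero] at h1
      exact zero_ne_one h1
  refine ⟨lam, hl, fun y hy d => ?_⟩
  rcases eq_or_ne d 0 with rfl | hd
  · simp
  have hd' : 0 < ‖d‖ := norm_pos_iff.2 hd
  have h1 := hlam (y, ‖d‖⁻¹ • d) ⟨hy, by simp [norm_smul, hd'.ne']⟩
  have h2 : ∑ i, (‖d‖⁻¹ • d) i • F i y = ‖d‖⁻¹ • ∑ i, d i • F i y := by
    simp only [Pi.smul_apply, smul_assoc, Finset.smul_sum]
  rw [h2, norm_smul, norm_inv, norm_norm, inv_mul_eq_div, le_div_iff₀ hd'] at h1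
  exact h1

/-- Each ball of a finite cover by balls of radius `δ/2` contains at most one of the points. -/
theorem exists_card_le_of_separated {Y : Type*} [PseudoMetricSpace Y] {K : Set Y} (hK : IsCompact K)
    {δ : ℝ} (hδ : 0 < δ) :
    ∃ N : ℕ, ∀ A : Finset Y, (↑A : Set Y) ⊆ K → (∀ a ∈ A, ∀ b ∈ A, a ≠ b → δ ≤ dist a b) →
      A.card ≤ N := by
  obtain ⟨t, -, ht, hcov⟩ := finite_cover_balls_of_compact hK (half_pos hδ)
  refine ⟨ht.toFinset.card, fun A hA hsep => ?_⟩
  have h1 : ∀ a ∈ A, ∃ y ∈ t, dist a y < δ / 2 := fun a ha => by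
    simpa only [Set.mem_iUnion, exists_prop, Metric.mem_ball] using hcov (hA ha)
  choose! f hft hf using h1
  refine Finset.card_le_card_of_injOn f (fun a ha => ht.mem_toFinset.2 (hft a ha)) ?_
  intro a ha b hb hab
  by_contra hne
  have h2 := hsep a ha b hb hne
  have h3 := dist_triangle_right a b (f a)
  have h4 := hf b hb
  rw [← hab] at h4
  linarith [hf a ha]

/-- The orthogonal projection does not increase the norm. -/
theorem SolvesLocal.norm_combo_le {n : ℕ} {D D₀ : ℝ} (hD : 0 ≤ D) (hD₀ : D₀ ≠ 0) {L : ℕ} {h : ℝ}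
    {g : Pt n} {Sig : Finset (Pt n)} {c : Pt n → (Fin n →₀ ℕ) → ℝ}
    (hc : SolvesLocal D D₀ L h g Sig c) :
    ‖combo D D₀ L h g Sig c‖ ≤ ‖(featureLp D D₀ 0 0 : Lp ℝ 2 (stdNormal n))‖ := by
  have h2 := norm_add_sq_eq_norm_sq_add_norm_sq_real
    (((solvesLocal_iff hD hD₀ L h g Sig c).1 hc).2 c)
  rw [sub_add_cancel] at h2
  refine le_of_sq_le_sq ?_ (norm_nonneg _)
  nlinarith [norm_nonneg (featureLp D D₀ 0 0 - combo D D₀ L h g Sig c)]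

theorem isCompact_separated {n : ℕ} (N : ℕ) (R δ : ℝ) :
    IsCompact {y : Fin N → Pt n | (∀ j, ‖y j‖ ≤ R) ∧ ∀ j k, j ≠ k → δ ≤ dist (y j) (y k)} := by
  have h1 : IsCompact (Set.univ.pi fun _ : Fin N => Metric.closedBall (0 : Pt n) R) :=
    isCompact_univ_pi fun _ => isCompact_closedBall _ _
  have h2 : IsClosed {y : Fin N → Pt n | ∀ j k, j ≠ k → δ ≤ dist (y j) (y k)} := by
    simp only [Set.ofPred_forall]
    exact isClosed_iInter fun j => isClosed_iInter fun k => isClosed_iInter fun _ =>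
      isClosed_le continuous_const (by fun_prop)
  convert h1.inter_right h2 using 1
  ext y
  simp

/-- For node sets of a fixed cardinality the bound for the solutions follows by compactness. -/
theorem exists_abs_coeff_le_of_card (n : ℕ) {D D₀ : ℝ} (hD : 0 < D) (h₀ : 0 < D₀) (L N : ℕ) (R : ℝ)
    {δ : ℝ} (hδ : 0 < δ) :
    ∃ C, 0 ≤ C ∧ ∀ h : ℝ, 0 < h → ∀ (g : Pt n) (Sig : Finset (Pt n))
      (c : Pt n → (Fin n →₀ ℕ) → ℝ), SolvesLocal D D₀ L h g Sig c → Sig.card = N →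
      (∀ a ∈ Sig, ‖h⁻¹ • (a - g)‖ ≤ R) →
      (∀ a ∈ Sig, ∀ b ∈ Sig, a ≠ b → δ ≤ dist (h⁻¹ • (a - g)) (h⁻¹ • (b - g))) →
      ∀ a β, |c a β| ≤ C := by
  classical
  obtain ⟨lam, hl, hlam⟩ := exists_pos_mul_norm_le_of_isCompact (isCompact_separated (n := n) N R δ)
    (F := fun (i : Fin N × multiIdx n L) (y : Fin N → Pt n) => featureLp D D₀ i.2.1 (y i.1))
    (fun i => (continuous_featureLp hD.le h₀.ne' _).comp (continuous_apply i.1)) (by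
      intro y hy d hd
      have hinj : Function.Injective y := fun j k hjk => by
        by_contra hne
        have := hy.2 j k hne
        rw [hjk, dist_self] at this
        exact absurd this (not_le.2 hδ)
      have h1 := eq_zero_of_sum_featureLp_eq_zero hD h₀ (Finset.univ.image y) (multiIdx n L)
        (Function.extend y (fun j β => if hβ : β ∈ multiIdx n L then d (j, ⟨β, hβ⟩) else 0) 0) (by
          rw [Finset.sum_image hinj.injOn, ← hd, Fintype.sum_prod_type]
          refine Finset.sum_congr rfl fun j _ => ?_
          rw [← Finset.sum_coe_sort (multiIdx n L)]
          refine Finset.sum_congr rfl fun β _ => ?_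
          rw [hinj.extend_apply, dif_pos β.2])
      funext i
      have h2 := h1 (y i.1) (Finset.mem_image_of_mem _ (Finset.mem_univ _)) i.2.1 i.2.2
      rwa [hinj.extend_apply, dif_pos i.2.2] at h2)
  refine ⟨‖(featureLp D D₀ 0 0 : Lp ℝ 2 (stdNormal n))‖ / lam, by positivity,
    fun h hh g Sig c hc hN hR hsep a β => ?_⟩
  by_cases hab : a ∈ Sig ∧ β ∈ multiIdx n L
  swap
  · rw [hc.1 a β hab, abs_zero]; positivity
  let e : Fin N ≃ Sig := (Sig.equivFinOfCardEq hN).symm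
  let d : Fin N × multiIdx n L → ℝ := fun i => c (e i.1) i.2
  have h1 := hlam (fun j => h⁻¹ • ((e j : Pt n) - g)) ⟨fun j => hR _ (e j).2, fun j k hjk =>
    hsep _ (e j).2 _ (e k).2 fun hne => hjk (e.injective (Subtype.ext hne))⟩ d
  have h2 : ∑ i, d i • featureLp D D₀ i.2.1 (h⁻¹ • ((e i.1 : Pt n) - g)) =
      combo D D₀ L h g Sig c := by
    rw [combo, Fintype.sum_prod_type, ← Finset.sum_coe_sort Sig, ← e.sum_comp]
    refine Finset.sum_congr rfl fun j _ => ?_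
    rw [← Finset.sum_coe_sort (multiIdx n L)]
  rw [h2] at h1
  rw [le_div_iff₀' hl]
  refine le_trans ?_ (h1.trans (hc.norm_combo_le hD.le h₀.ne'))
  have h3 := norm_le_pi_norm d (e.symm ⟨a, hab.1⟩, ⟨β, hab.2⟩)
  simp only [d, Equiv.apply_symm_apply, Real.norm_eq_abs] at h3
  gcongr

/-- The solutions of the local systems for uniformly local and uniformly separated node sets are
bounded by a constant. -/
theorem exists_abs_coeff_le (n : ℕ) {D D₀ : ℝ} (hD : 0 < D) (h₀ : 0 < D₀) (L : ℕ) {h : ℝ}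
    (hh : 0 < h) (R : ℝ) {δ : ℝ} (hδ : 0 < δ) :
    ∃ (N : ℕ) (C : ℝ), 0 ≤ C ∧ ∀ (g : Pt n) (Sig : Finset (Pt n))
      (c : Pt n → (Fin n →₀ ℕ) → ℝ), SolvesLocal D D₀ L h g Sig c →
      (∀ a ∈ Sig, dist a g ≤ R) → (∀ a ∈ Sig, ∀ b ∈ Sig, a ≠ b → δ ≤ dist a b) →
      Sig.card ≤ N ∧ ∀ a β, |c a β| ≤ C := by
  classical
  have hscale : ∀ g a b : Pt n, dist (h⁻¹ • (a - g)) (h⁻¹ • (b - g)) = h⁻¹ * dist a b := by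
    intro g a b
    rw [dist_smul₀, dist_sub_right, Real.norm_eq_abs, abs_of_pos (inv_pos.2 hh)]
  have hδ' : 0 < h⁻¹ * δ := by positivity
  obtain ⟨N, hN⟩ := exists_card_le_of_separated (isCompact_closedBall (0 : Pt n) (h⁻¹ * R)) hδ'
  choose C hC0 hC using fun k : ℕ => exists_abs_coeff_le_of_card n hD h₀ L k (h⁻¹ * R) hδ'
  refine ⟨N, ∑ k ∈ Finset.range (N + 1), C k, Finset.sum_nonneg fun k _ => hC0 k,
    fun g Sig c hc hR hsep => ?_⟩
  have hR' : ∀ a ∈ Sig, ‖h⁻¹ • (a - g)‖ ≤ h⁻¹ * R := fun a ha => by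
    rw [norm_smul, norm_inv, Real.norm_eq_abs, abs_of_pos hh, ← dist_eq_norm]
    exact mul_le_mul_of_nonneg_left (hR a ha) (inv_pos.2 hh).le
  have hsep' : ∀ a ∈ Sig, ∀ b ∈ Sig, a ≠ b →
      h⁻¹ * δ ≤ dist (h⁻¹ • (a - g)) (h⁻¹ • (b - g)) := fun a ha b hb hab => by
    rw [hscale]
    exact mul_le_mul_of_nonneg_left (hsep a ha b hb hab) (inv_pos.2 hh).le
  have hinj : Function.Injective fun a : Pt n => h⁻¹ • (a - g) := fun a b hab => by
    have h1 := hscale g a b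
    rw [dist_eq_zero.2 hab] at h1
    exact dist_eq_zero.1 ((mul_eq_zero.1 h1.symm).resolve_left (inv_pos.2 hh).ne')
  have hcard : Sig.card ≤ N := by
    rw [← Finset.card_image_of_injective Sig hinj]
    refine hN _ ?_ ?_
    · intro y hy
      obtain ⟨a, ha, rfl⟩ := Finset.mem_image.1 hy
      exact mem_closedBall_zero_iff.2 (hR' a ha)
    · intro y hy z hz hyz
      obtain ⟨a, ha, rfl⟩ := Finset.mem_image.1 hy
      obtain ⟨b, hb, rfl⟩ := Finset.mem_image.1 hz
      exact hsep' a ha b hb fun hab => hyz (by rw [hab])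
  refine ⟨hcard, fun a β => (hC Sig.card h hh g Sig c hc rfl hR' hsep' a β).trans ?_⟩
  exact Finset.single_le_sum (fun k _ => hC0 k) (Finset.mem_range.2 (Nat.lt_succ_of_le hcard))

/-! ### Uniformly local and separated node sets -/

/-- Half of the Gaussian absorbs the polynomial. -/
theorem exists_abs_gaussTerm_le (n L : ℕ) :
    ∃ B, 0 ≤ B ∧ ∀ D > 0, ∀ h > 0, ∀ (c : (Fin n →₀ ℕ) → ℝ) (C : ℝ), (∀ β, |c β| ≤ C) →
      ∀ a x : Pt n, |gaussTerm D h (polyOf L c) a x| ≤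
        C * B * Real.exp (-‖x - a‖ ^ 2 / (2 * (h ^ 2 * D))) := by
  refine ⟨∑ β ∈ multiIdx n L, ((β.degree.factorial : ℝ) * Real.exp (1 / 2)), by positivity,
    fun D hD h hh c C hc a x => ?_⟩
  have hC : 0 ≤ C := (abs_nonneg _).trans (hc 0)
  set r := ‖x - a‖ / (h * Real.sqrt D) with hr
  have hr0 : 0 ≤ r := by positivity
  have hr2 : ‖x - a‖ ^ 2 / (h ^ 2 * D) = r ^ 2 := by
    rw [hr, div_pow, mul_pow, Real.sq_sqrt hD.le]
  have hmon : ∀ β : Fin n →₀ ℕ, |∏ i, ((x i - a i) / (h * Real.sqrt D)) ^ β i| ≤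
      β.degree.factorial * Real.exp (1 / 2) * Real.exp (r ^ 2 / 2) := by
    intro β
    calc |∏ i, ((x i - a i) / (h * Real.sqrt D)) ^ β i|
        = ∏ i, |(x i - a i) / (h * Real.sqrt D)| ^ β i := by
          rw [Finset.abs_prod]; simp_rw [abs_pow]
      _ ≤ ∏ i, r ^ β i := by
          refine Finset.prod_le_prod (fun _ _ => by positivity) fun i _ => ?_
          refine pow_le_pow_left₀ (abs_nonneg _) ?_ _
          rw [abs_div, abs_of_pos (by positivity : 0 < h * Real.sqrt D), hr]
          gcongr
          simpa using PiLp.norm_apply_le (x - a) i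
      _ = r ^ β.degree := by rw [Finset.prod_pow_eq_pow_sum, Finsupp.degree_eq_sum]
      _ ≤ β.degree.factorial * Real.exp r := by
          have := Real.pow_div_factorial_le_exp r hr0 β.degree
          rwa [div_le_iff₀' (by positivity)] at this
      _ ≤ _ := by
          rw [mul_assoc, ← Real.exp_add]
          gcongr
          nlinarith [sq_nonneg (r - 1)]
  have h1 : |MvPolynomial.eval (fun i => (x i - a i) / (h * Real.sqrt D)) (polyOf L c)| ≤
      C * (∑ β ∈ multiIdx n L, ((β.degree.factorial : ℝ) * Real.exp (1 / 2))) *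
        Real.exp (r ^ 2 / 2) := by
    rw [polyOf, map_sum, Finset.mul_sum, Finset.sum_mul]
    refine (Finset.abs_sum_le_sum_abs _ _).trans (Finset.sum_le_sum fun β _ => ?_)
    rw [MvPolynomial.eval_monomial, Finsupp.prod_fintype _ _ (by simp), abs_mul, mul_assoc]
    exact mul_le_mul (hc β) (hmon β) (abs_nonneg _) hC
  rw [gaussTerm, abs_mul, Real.abs_exp, neg_div, neg_div, hr2]
  have e1 : ‖x - a‖ ^ 2 / (2 * (h ^ 2 * D)) = r ^ 2 / 2 := by
    rw [← hr2]; field_simp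
  rw [e1]
  calc _ ≤ _ := mul_le_mul_of_nonneg_right h1 (Real.exp_pos _).le
    _ = _ := by
      rw [mul_assoc, ← Real.exp_add]
      congr 2; ring

/-- For uniformly local and separated node sets the double series over grid points and nodes
converges absolutely: its terms are bounded by a Gaussian of the distance to the grid point. -/
theorem summable_of_uniformChoice {n : ℕ} {D D₀ : ℝ} (hD : 0 < D) (h₀ : 0 < D₀) (L : ℕ) {h : ℝ}
    (hh : 0 < h) {I : Set (Fin n → ℤ)} {Sig : (Fin n → ℤ) → Finset (Pt n)}
    (hu : UniformChoice I (gridPt h) Sig) {c : (Fin n → ℤ) → Pt n → (Fin n →₀ ℕ) → ℝ}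
    (hc : ∀ m ∈ I, SolvesLocal D D₀ L h (gridPt h m) (Sig m) (c m)) (J : Set (Pt n)) (x : Pt n) :
    Summable fun q : I × J => gaussTerm D h (polyOf L (c q.1 q.2)) q.2 x := by
  classical
  obtain ⟨R, hR, δ, hδ, hu⟩ := hu
  obtain ⟨N, C, hC, hNC⟩ := exists_abs_coeff_le n hD h₀ L hh R hδ
  obtain ⟨B, hB, hterm⟩ := exists_abs_gaussTerm_le n L
  obtain ⟨C', hC'⟩ := exists_tsum_gaussian_lattice_le n (q := 1 / (4 * D)) (by positivity)
  set E := C * B * Real.exp (R ^ 2 / (2 * (h ^ 2 * D))) with hE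
  have hE0 : 0 ≤ E := by positivity
  set b : (Fin n → ℤ) → ℝ := fun m =>
    E * Real.exp (-(1 / (4 * D)) * ‖h⁻¹ • x - gridPt 1 m‖ ^ 2) with hb
  have hb0 : ∀ m, 0 ≤ b m := fun m => by positivity
  have hle : ∀ m ∈ I, ∀ a ∈ Sig m, |gaussTerm D h (polyOf L (c m a)) a x| ≤ b m := by
    intro m hm a ha
    refine (hterm D hD h hh _ C
      ((hNC _ _ _ (hc m hm) (hu m hm).1 (hu m hm).2).2 a) a x).trans ?_
    rw [hb, hE]
    simp only
    rw [mul_assoc (C * B), ← Real.exp_add]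
    refine mul_le_mul_of_nonneg_left (Real.exp_le_exp.2 ?_) (mul_nonneg hC hB)
    have h1 : ‖x - gridPt h m‖ ≤ ‖x - a‖ + R := by
      rw [← dist_eq_norm, ← dist_eq_norm]
      exact (dist_triangle x a _).trans (add_le_add_right ((hu m hm).1 a ha) _)
    have h2 : ‖x - gridPt h m‖ ^ 2 ≤ 2 * ‖x - a‖ ^ 2 + 2 * R ^ 2 := by
      have := pow_le_pow_left₀ (norm_nonneg _) h1 2
      nlinarith [sq_nonneg (‖x - a‖ - R)]
    have h3 : ‖h⁻¹ • x - gridPt 1 m‖ ^ 2 = ‖x - gridPt h m‖ ^ 2 / h ^ 2 := by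
      rw [← inv_smul_sub_gridPt hh, norm_smul, norm_inv, Real.norm_eq_abs, abs_of_pos hh]
      field_simp
    rw [h3]
    have h4 : R ^ 2 / (2 * (h ^ 2 * D)) + -(1 / (4 * D)) * (‖x - gridPt h m‖ ^ 2 / h ^ 2) =
        (R ^ 2 - ‖x - gridPt h m‖ ^ 2 / 2) / (2 * (h ^ 2 * D)) := by
      field_simp
      ring
    rw [h4]
    gcongr
    linarith
  have hzero : ∀ m ∈ I, ∀ a ∉ Sig m, gaussTerm D h (polyOf L (c m a)) a x = 0 :=
    fun m hm a ha => gaussTerm_polyOf_eq_zero D h L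
      (fun β => (hc m hm).1 a β fun hab => ha hab.1) a x
  refine Summable.of_norm ((summable_prod_of_nonneg fun _ => norm_nonneg _).2 ⟨fun m => ?_, ?_⟩)
  · refine (summable_of_hasFiniteSupport ?_).norm
    refine ((Sig m).finite_toSet.preimage Subtype.val_injective.injOn).subset fun a ha => ?_
    by_contra hn
    exact ha (hzero m m.2 a hn)
  · refine Summable.of_nonneg_of_le (fun m => tsum_nonneg fun a => norm_nonneg _) (fun m => ?_)
      (((((hC' (h⁻¹ • x)).1.mul_left E).subtype I).mul_left (N : ℝ)))
    have h1 : ∑' a : J, ‖gaussTerm D h (polyOf L (c m a)) a x‖ ≤ ∑ a ∈ Sig m, b m := by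
      rw [tsum_subtype J fun a => ‖gaussTerm D h (polyOf L (c m a)) a x‖, tsum_eq_sum (s := Sig m)]
      · refine Finset.sum_le_sum fun a ha => ?_
        refine (Set.indicator_le_self' (fun _ _ => norm_nonneg _) a).trans ?_
        exact hle m m.2 a ha
      · intro a ha
        rw [Set.indicator_apply, hzero m m.2 a ha, norm_zero, ite_self]
    refine h1.trans ?_
    rw [Finset.sum_const, nsmul_eq_mul]
    exact mul_le_mul_of_nonneg_right (Nat.cast_le.2
      (hNC _ _ _ (hc m m.2) (hu m m.2).1 (hu m m.2).2).1) (hb0 m)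

end GaussPU

end

theorem mainTheorem6 (n : ℕ) (H : ℝ) (hH₀ : 0 < H) (hH₁ : H < 1) (ε : ℝ) (hε : 0 < ε) :
    ∃ Dmin : ℝ, 0 < Dmin ∧ ∀ D : ℝ, Dmin ≤ D → ∀ D₀ : ℝ, 0 < D₀ → D₀ < D →
    ∀ κ : ℝ, 0 < κ → ∃ Lmin : ℕ, ∀ L : ℕ, Lmin ≤ L →
    ∀ (h₁ h₂ κ₁ : ℝ), 0 < h₁ → h₂ = H * h₁ → 0 < κ₁ →
    ∀ (X Ω : Set (GaussPU.Pt n)) (S : Finset (Fin n → ℤ)),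
      Bornology.IsBounded Ω →
      GaussPU.IsMinimalIndexSet H D S →
      GaussPU.PiecewiseCondition1 X Ω h₁ h₂ κ₁ →
      GaussPU.Condition4 X Ω h₁ h₂ κ₁ S →
    ∀ (Sig₁ : (Fin n → ℤ) → Finset (GaussPU.Pt n))
      (Sig₂ : (Fin n → ℤ) × (Fin n → ℤ) → Finset (GaussPU.Pt n)),
      GaussPU.AdmissibleChoice (GaussPU.Z₁ h₁ h₂ Ω S) (GaussPU.gridPt h₁) h₁ κ (X \ Ω) Sig₁ →
      GaussPU.AdmissibleChoice (GaussPU.I₂ h₁ h₂ Ω S) (GaussPU.finePt h₁ h₂) h₂ κ (X ∩ Ω) Sig₂ →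
      -- the local linear systems are uniquely solvable
      (∀ m ∈ GaussPU.Z₁ h₁ h₂ Ω S,
        ∃! c, GaussPU.SolvesLocal D D₀ L h₁ (GaussPU.gridPt h₁ m) (Sig₁ m) c) ∧
      (∀ p ∈ GaussPU.I₂ h₁ h₂ Ω S,
        ∃! c, GaussPU.SolvesLocal D D₀ L h₂ (GaussPU.finePt h₁ h₂ p) (Sig₂ p) c) ∧
      -- and their solutions generate an approximate partition of unity
      ∀ (c₁ : (Fin n → ℤ) → GaussPU.Pt n → (Fin n →₀ ℕ) → ℝ)
        (c₂ : (Fin n → ℤ) × (Fin n → ℤ) → GaussPU.Pt n → (Fin n →₀ ℕ) → ℝ),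
        (∀ m ∈ GaussPU.Z₁ h₁ h₂ Ω S,
          GaussPU.SolvesLocal D D₀ L h₁ (GaussPU.gridPt h₁ m) (Sig₁ m) (c₁ m)) →
        (∀ p ∈ GaussPU.I₂ h₁ h₂ Ω S,
          GaussPU.SolvesLocal D D₀ L h₂ (GaussPU.finePt h₁ h₂ p) (Sig₂ p) (c₂ p)) →
        -- the series grouped by grid points always converges, with sum within `ε` of `1`
        (∀ x : GaussPU.Pt n,
          Summable (fun m : GaussPU.Z₁ h₁ h₂ Ω S =>
            GaussPU.gridTerm D h₁ L (Sig₁ m) (c₁ m) x) ∧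
          Summable (fun p : GaussPU.I₂ h₁ h₂ Ω S =>
            GaussPU.refCoeff H D p.1.2 * GaussPU.gridTerm D h₂ L (Sig₂ p) (c₂ p) x) ∧
          |(Real.pi * D) ^ (-(n : ℝ) / 2) *
              (∑' m : GaussPU.Z₁ h₁ h₂ Ω S, GaussPU.gridTerm D h₁ L (Sig₁ m) (c₁ m) x +
                ∑' p : GaussPU.I₂ h₁ h₂ Ω S,
                  GaussPU.refCoeff H D p.1.2 * GaussPU.gridTerm D h₂ L (Sig₂ p) (c₂ p) x) - 1|
            < ε) ∧
        -- wherever the terms form an absolutely convergent double series,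
        -- the two series over the nodes converge and `|Θ(x) - 1| < ε`
        (∀ x : GaussPU.Pt n,
          Summable (fun q : GaussPU.Z₁ h₁ h₂ Ω S × (X \ Ω : Set (GaussPU.Pt n)) =>
            GaussPU.gaussTerm D h₁ (GaussPU.polyOf L (c₁ q.1 q.2)) q.2 x) →
          Summable (fun a : (X \ Ω : Set (GaussPU.Pt n)) => GaussPU.gaussTerm D h₁
            (GaussPU.nodePoly L (GaussPU.Z₁ h₁ h₂ Ω S) (fun _ => 1) Sig₁ c₁ a) a x) ∧
          Summable (fun a : (X ∩ Ω : Set (GaussPU.Pt n)) => GaussPU.gaussTerm D h₂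
            (GaussPU.nodePoly L (GaussPU.I₂ h₁ h₂ Ω S) (fun p => GaussPU.refCoeff H D p.2)
              Sig₂ c₂ a) a x) ∧
          |GaussPU.Theta D h₁ h₂ (X \ Ω) (X ∩ Ω)
              (GaussPU.nodePoly L (GaussPU.Z₁ h₁ h₂ Ω S) (fun _ => 1) Sig₁ c₁)
              (GaussPU.nodePoly L (GaussPU.I₂ h₁ h₂ Ω S) (fun p => GaussPU.refCoeff H D p.2)
                Sig₂ c₂) x - 1| < ε) ∧
        -- this is so at every point if the node sets `Σ(g)` are uniformly local and separated
        (GaussPU.UniformChoice (GaussPU.Z₁ h₁ h₂ Ω S) (GaussPU.gridPt h₁) Sig₁ →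
          ∀ x : GaussPU.Pt n,
          Summable (fun q : GaussPU.Z₁ h₁ h₂ Ω S × (X \ Ω : Set (GaussPU.Pt n)) =>
            GaussPU.gaussTerm D h₁ (GaussPU.polyOf L (c₁ q.1 q.2)) q.2 x)) := by
  obtain ⟨Dmin, hDmin, hmain⟩ := GaussPU.exists_abs_grid_series_sub_one_lt n hH₀ hH₁ hε
  refine ⟨Dmin, hDmin, fun D hDD D₀ h₀ hD₀ κ _ => ?_⟩
  obtain ⟨Lmin, hL⟩ := hmain D hDD D₀ h₀ hD₀ κ
  have hD : 0 < D := h₀.trans hD₀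
  refine ⟨Lmin, ?_⟩
  rintro L hLL h₁ _ κ₁ hh₁ rfl - X Ω S hΩ hS - - Sig₁ Sig₂ hA₁ hA₂
  refine ⟨fun m _ => GaussPU.existsUnique_solvesLocal hD h₀ L hh₁ _ _,
    fun p _ => GaussPU.existsUnique_solvesLocal hD h₀ L (mul_pos hH₀ hh₁) _ _,
    fun c₁ c₂ hc₁ hc₂ => ?_⟩
  have hgrid := hL L hLL h₁ hh₁ S hS.prop (GaussPU.Z₂ h₁ (H * h₁) Ω S) Sig₁ Sig₂ c₁ c₂
    (fun m hm => ⟨hc₁ m hm, (hA₁.1 m hm).2⟩) (fun p hp => ⟨hc₂ p hp, (hA₂.1 p hp).2⟩)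
  have hz₁ : ∀ m ∈ GaussPU.Z₁ h₁ (H * h₁) Ω S, ∀ a ∉ Sig₁ m, ∀ β, c₁ m a β = 0 :=
    fun m hm a ha β => (hc₁ m hm).1 a β fun hab => ha hab.1
  have hz₂ : ∀ p ∈ GaussPU.I₂ h₁ (H * h₁) Ω S, ∀ a ∉ Sig₂ p, ∀ β, c₂ p a β = 0 :=
    fun p hp a ha β => (hc₂ p hp).1 a β fun hab => ha hab.1
  refine ⟨hgrid, fun x hx => ?_, fun hu x =>
    GaussPU.summable_of_uniformChoice hD h₀ L hh₁ hu hc₁ (X \ Ω) x⟩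
  obtain ⟨hs₁, ht₁⟩ := GaussPU.summable_and_tsum_nodePoly (w := fun _ => 1)
    (fun m hm => (hA₁.1 m hm).1) hA₁.2 hz₁ (by simpa only [one_mul] using hx)
  have hf₂ := GaussPU.summable_of_finite_grid (GaussPU.finite_I₂ hh₁ hΩ S)
    (w := fun p : (Fin n → ℤ) × (Fin n → ℤ) => GaussPU.refCoeff H D p.2) (X ∩ Ω) D (H * h₁) L x hz₂
  obtain ⟨hs₂, ht₂⟩ := GaussPU.summable_and_tsum_nodePoly (I := GaussPU.I₂ h₁ (H * h₁) Ω S)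
    (w := fun p : (Fin n → ℤ) × (Fin n → ℤ) => GaussPU.refCoeff H D p.2) (Sig := Sig₂) (c := c₂)
    (J := X ∩ Ω) (D := D) (h := H * h₁) (L := L) (x := x)
    (fun p hp => (hA₂.1 p hp).1) hA₂.2 hz₂ hf₂
  refine ⟨hs₁, hs₂, ?_⟩
  rw [GaussPU.Theta, ht₁, ht₂]
  simp only [one_mul]
  exact (hgrid x).2.2
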